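/- **Setting.** Identify $\mathfrak{sl}_2(\mathbb C)$ with $\mathbb C^3$ by $(z_1,z_2,z_3)\mapsto A=\begin{pmatrix} iz_1 & -z_2+iz_3\\ z_2+iz_3 & -iz_1\end{pmatrix}$, put $z_j=x_j+iy_j$, and let $R^2=\mathrm{tr}(AA^*)=2|z|^2$ and $f=f_1+if_2=\det A=z_1^2+z_2^2+z_3^2$. Let $$\pi=4\,\mathrm{Re}\big(z_1\partial_{z_2}\wedge\partial_{z_3}+z_2\partial_{z_3}\wedge\partial_{z_1}+z_3\partial_{z_1}\wedge\partial_{z_2}\big),$$ the linear Poisson structure of the real Lie algebra $\mathfrak{sl}_2(\mathbb C)$ (identified with its dual by the trace form). On $\mathfrak{sl}_2(\mathbb C)\setminus\{0\}$ let $$V_1=\tfrac1{R^2}\sum_j(x_j\partial_{x_j}-y_j\partial_{y_j}),\qquad V_2=\tfrac1{R^2}\sum_j(x_j\partial_{y_j}+y_j\partial_{x_j}),$$ $$\tilde\omega_1=\tfrac{2}{R^2}\sum_{c.p.}\big(x_1(dy_2\wedge dy_3-dx_2\wedge dx_3)-y_1(dx_2\wedge dy_3+dy_2\wedge dx_3)\big),\qquad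 \gamma_i=i_{V_i}d\tilde\omega_1\quad(i=1,2),$$ where $\sum_{c.p.}$ runs over the cyclic permutations of $1,2,3$; $\tilde\omega_1$ extends the leafwise symplectic form of $\pi$. A section is *flat* if it is smooth and all its partial derivatives vanish at the origin. Let $\mathfrak X_0^n(\mathfrak{sl}_2(\mathbb C))$ and $\Omega_0^n(\mathfrak{sl}_2(\mathbb C))$ be the spaces of flat $n$-vector fields and flat $n$-forms, $d_\pi=[\pi,\cdot]$ the Poisson differential, $\varphi=df_1\wedge df_2$, and $\mathcal C^p=\varphi\wedge\Omega^p_0(\mathfrak{sl}_2(\mathbb C))\subset\Omega_0^{p+2}(\mathfrak{sl}_2(\mathbb C))$ for $p\ge 0$ (and $\mathcal C^p=0$ for $p<0$), with the exterior derivative $d$. **Property SLB.** For a section $s$ over the closed ball $\overline B_r$ of radius $r>0$ around the origin which is the restriction of a flat section, let $\|s\|_{n,k,r}=\sup_{x\in\overline B_r}\sup_{|a|\le n}|x|^{-k}|D^as(x)|$. A linear operator $\ell:\mathscr V\to\mathscr W$ between spaces of flat sections of vector bundles has property SLB for $(a,b,c)\in\mathbb N_0^3$ if for every $r>0$ it induces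 a linear operator $\ell_r:\mathscr V_r\to\mathscr W_r$ between the spaces of restrictions to $\overline B_r$ (so that $\ell_r(\alpha|_{\overline B_r})=\ell(\alpha)|_{\overline B_r}$), and for all $n,k\in\mathbb N_0$ there is a constant $C=C(r,n,k)$, depending continuously on $r$, with $$\|\ell_r(\alpha)\|_{n,k,r}\le C\,\|\alpha\|_{n+a,\,k+bn+c,\,r}\qquad\text{for all }\alpha\in\mathscr V_r.$$ **Proposition.** There is an isomorphism of cochain complexes of real vector spaces $$\tilde a:(\mathfrak X_0^{\bullet}(\mathfrak{sl}_2(\mathbb C)),d_\pi)\xrightarrow{\ \sim\ }\Big(\bigoplus_{p+q=\bullet}\mathcal C^p\otimes\wedge^q\mathbb R^2,\ d+\delta\Big),$$ where $d$ acts on the first factor as the exterior derivative, and $\delta:\mathcal C^p\otimes\wedge^q\mathbb R^2\to\mathcal C^{p+2}\otimes\wedge^{q-1}\mathbb R^2$ is given, with $e_1,e_2$ the standard basis of $\mathbb R^2$ and $\eta\in\mathcal C^p$, by $$\delta(\eta)=0,\qquad \delta(\eta\otimes e_i)=(-1)^p\gamma_i\wedge\eta\quad(i=1,2),\qquad \delta(\eta\otimes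 e_1\wedge e_2)=(-1)^p\big(\gamma_1\wedge\eta\otimes e_2-\gamma_2\wedge\eta\otimes e_1\big).$$ Moreover, in every degree the operators $\tilde a$, $\tilde a^{-1}$ and $\delta$ satisfy property SLB for $(0,0,2)$, $(0,0,4)$ and $(0,0,3)$, respectively. -/

import Mathlib

open scoped ContDiff ENNReal NNReal

noncomputable section

namespace FlatPoisson

/-! ### Exterior algebra in a normed space -/

section Wedge

variable {E : Type*} [NormedAddCommGroup E] [NormedSpace ℝ E] {n : ℕ}

/-- A continuous linear functional regarded as an alternating form of degree one. -/
def oneForm (a : E →L[ℝ] ℝ) : E [⋀^Fin 1]→L[ℝ] ℝ :=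
  ContinuousAlternatingMap.ofSubsingleton ℝ E ℝ (0 : Fin 1) a

/-- The exterior product `a ∧ η` of a form of degree one with a form of degree `n`. -/
def wedge1 (a : E →L[ℝ] ℝ) (η : E [⋀^Fin n]→L[ℝ] ℝ) : E [⋀^Fin (n + 1)]→L[ℝ] ℝ :=
  ContinuousAlternatingMap.alternatizeUncurryFin (a.smulRight η)

/-- `(a ∧ η)(v₀, …, vₙ) = ∑ i, (-1)^i a(vᵢ) η(v₀, …, v̂ᵢ, …, vₙ)`. -/
theorem wedge1_apply (a : E →L[ℝ] ℝ) (η : E [⋀^Fin n]→L[ℝ] ℝ) (v : Fin (n + 1) → E) :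
    wedge1 a η v = ∑ i : Fin (n + 1), (-1 : ℝ) ^ (i : ℕ) * (a (v i) * η (i.removeNth v)) := by
  simp [wedge1, ContinuousAlternatingMap.alternatizeUncurryFin_apply]

/-- The bilinear map `(u, v) ↦ β(u, v) η`. -/
def bilinSMul (β : E [⋀^Fin 2]→L[ℝ] ℝ) (η : E [⋀^Fin n]→L[ℝ] ℝ) :
    E →L[ℝ] E →L[ℝ] E [⋀^Fin n]→L[ℝ] ℝ :=
  ((ContinuousLinearMap.smulRightL ℝ E (E [⋀^Fin n]→L[ℝ] ℝ)).flip η) ∘L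
    ((ContinuousAlternatingMap.ofSubsingletonLIE (𝕜 := ℝ) (E := E) (F := ℝ)
      (0 : Fin 1)).symm.toContinuousLinearEquiv :
      (E [⋀^Fin 1]→L[ℝ] ℝ) →L[ℝ] (E →L[ℝ] ℝ)) ∘L β.curryLeft

theorem bilinSMul_apply (β : E [⋀^Fin 2]→L[ℝ] ℝ) (η : E [⋀^Fin n]→L[ℝ] ℝ) (u v : E) :
    bilinSMul β η u v = β ![u, v] • η := by
  have : (ContinuousAlternatingMap.ofSubsingletonLIE (𝕜 := ℝ) (E := E) (F := ℝ)
      (0 : Fin 1)).symm (β.curryLeft u) v = β ![u, v] := by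
    change β.curryLeft u (fun _ => v) = _
    rw [ContinuousAlternatingMap.curryLeft_apply_apply]
    congr 1
    ext i
    fin_cases i <;> rfl
  rw [← this]
  rfl

/-- The exterior product `β ∧ η` of a form of degree two with a form of degree `n`; see
`wedge2_apply` for the formula as a sum over shuffles. -/
def wedge2 (β : E [⋀^Fin 2]→L[ℝ] ℝ) (η : E [⋀^Fin n]→L[ℝ] ℝ) : E [⋀^Fin (n + 2)]→L[ℝ] ℝ :=
  (1 / 2 : ℝ) • ContinuousAlternatingMap.alternatizeUncurryFin
    (ContinuousAlternatingMap.alternatizeUncurryFinCLM ℝ E ℝ ∘L bilinSMul β η)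

/-- `β ∧ η` as a sum over all pairs of positions `i < j + 1` filled by the arguments of `β`. -/
theorem wedge2_apply (β : E [⋀^Fin 2]→L[ℝ] ℝ) (η : E [⋀^Fin n]→L[ℝ] ℝ) (v : Fin (n + 2) → E) :
    wedge2 β η v = ∑ i : Fin (n + 1), ∑ j ≥ i, (-1 : ℝ) ^ (i + j : ℕ) *
      (β ![v i.castSucc, v j.succ] * η (j.removeNth (i.castSucc.removeNth v))) := by
  have hβ : ∀ u w : E, β ![u, w] = -β ![w, u] := by
    intro u w
    have h := β.toAlternatingMap.map_swap ![w, u] (i := 0) (j := 1) (by decide)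
    have h2 : (![w, u] ∘ Equiv.swap (0 : Fin 2) 1) = ![u, w] := by
      ext i
      fin_cases i <;> rfl
    rw [h2] at h
    exact h
  have := ContinuousAlternatingMap.alternatizeUncurryFin_alternatizeUncurryFinCLM_comp_apply
    (bilinSMul β η) v
  simp only [wedge2, ContinuousAlternatingMap.smul_apply, this, Finset.smul_sum]
  refine Finset.sum_congr rfl fun i _ => Finset.sum_congr rfl fun j _ => ?_
  rw [bilinSMul_apply, bilinSMul_apply, hβ (v j.succ) (v i.castSucc)]
  simp only [ContinuousAlternatingMap.smul_apply, smul_eq_mul, zsmul_eq_mul]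
  push_cast
  ring

theorem wedge2_add (β : E [⋀^Fin 2]→L[ℝ] ℝ) (η θ : E [⋀^Fin n]→L[ℝ] ℝ) :
    wedge2 β (η + θ) = wedge2 β η + wedge2 β θ := by
  ext v
  simp only [ContinuousAlternatingMap.add_apply, wedge2_apply, mul_add, Finset.sum_add_distrib]

theorem wedge2_smul (β : E [⋀^Fin 2]→L[ℝ] ℝ) (c : ℝ) (η : E [⋀^Fin n]→L[ℝ] ℝ) :
    wedge2 β (c • η) = c • wedge2 β η := by
  ext v
  simp only [ContinuousAlternatingMap.smul_apply, wedge2_apply, smul_eq_mul, Finset.mul_sum]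
  refine Finset.sum_congr rfl fun i _ => Finset.sum_congr rfl fun j _ => ?_
  ring

end Wedge

/-! ### Flat sections -/

section Flat

variable (H V : Type*) [NormedAddCommGroup H] [NormedSpace ℝ H]
  [NormedAddCommGroup V] [NormedSpace ℝ V]

/-- `Γ₀(V)`: smooth sections of the trivial bundle with fibre `V` over `H` all of whose
derivatives vanish at the origin. -/
def flatSections : Submodule ℝ (H → V) where
  carrier := {s | ContDiff ℝ ∞ s ∧ ∀ m : ℕ, iteratedFDeriv ℝ m s 0 = 0}
  zero_mem' := ⟨contDiff_const, fun m => by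
    rw [Pi.zero_def, iteratedFDeriv_fun_zero]; rfl⟩
  add_mem' := by
    rintro s t ⟨hs, hs0⟩ ⟨ht, ht0⟩
    refine ⟨hs.add ht, fun m => ?_⟩
    rw [iteratedFDeriv_add_apply (hs.of_le (mod_cast le_top)).contDiffAt
      (ht.of_le (mod_cast le_top)).contDiffAt, hs0, ht0, add_zero]
  smul_mem' := by
    rintro c s ⟨hs, hs0⟩
    refine ⟨hs.const_smul c, fun m => ?_⟩
    rw [iteratedFDeriv_const_smul_apply (hs.of_le (mod_cast le_top)).contDiffAt, hs0, smul_zero]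

end Flat

/-! ### Flat norms and property SLB -/

section SLB

variable {ι : Type*} [Fintype ι] [DecidableEq ι]
  {V W : Type*} [NormedAddCommGroup V] [NormedSpace ℝ V] [NormedAddCommGroup W] [NormedSpace ℝ W]

/-- Restriction of sections over `H = ℝ^ι` to the closed ball of radius `r` around the origin. -/
def restrictBall (ι V : Type*) [Fintype ι] [NormedAddCommGroup V] [NormedSpace ℝ V] (r : ℝ) :
    (EuclideanSpace ℝ ι → V) →ₗ[ℝ] (Metric.closedBall (0 : EuclideanSpace ℝ ι) r → V) :=
  LinearMap.funLeft ℝ V Subtype.val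

/-- The flat norm `sup_{|x| ≤ r} sup_{|a| ≤ n} |x|^{-k} |D^a s(x)|` of a section `s` over the closed
ball of radius `r`. A partial derivative `D^a` with `|a| = m` is given by a sequence of `m` indices.
At `x = 0` the quotient `0 / 0` is read as `0` (all derivatives of flat sections vanish there). -/
def flatNorm (n k : ℕ) (r : ℝ) (s : Metric.closedBall (0 : EuclideanSpace ℝ ι) r → V) : ℝ≥0∞ :=
  ⨆ x : Metric.closedBall (0 : EuclideanSpace ℝ ι) r, ⨆ m : Fin (n + 1), ⨆ a : Fin m → ι,
    ‖iteratedFDerivWithin ℝ m (Function.extend Subtype.val s 0)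
        (Metric.closedBall (0 : EuclideanSpace ℝ ι) r) x
        (fun i => EuclideanSpace.single (a i) (1 : ℝ))‖ₑ / ‖(x : EuclideanSpace ℝ ι)‖ₑ ^ k

/-- Property SLB for `(a, b, c)` of a linear operator `ℓ : 𝒱 → 𝒲` between spaces of sections:
`ℓ` induces linear operators `ℓ_r` on the restrictions to all closed balls around the origin, and
`‖ℓ_r α‖_{n,k,r} ≤ C(n,k,r) ‖α‖_{n+a,k+bn+c,r}` with `C` continuous in `r > 0`. -/
def PropertySLB {𝒱 : Submodule ℝ (EuclideanSpace ℝ ι → V)}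
    {𝒲 : Submodule ℝ (EuclideanSpace ℝ ι → W)} (ℓ : 𝒱 →ₗ[ℝ] 𝒲) (a b c : ℕ) : Prop :=
  ∃ ℓr : (r : ℝ) → (𝒱.map (restrictBall ι V r) →ₗ[ℝ] 𝒲.map (restrictBall ι W r)),
    (∀ r : ℝ, 0 < r → ∀ α : 𝒱,
      (ℓr r ⟨restrictBall ι V r α, Submodule.mem_map_of_mem α.2⟩ :
        Metric.closedBall (0 : EuclideanSpace ℝ ι) r → W) = restrictBall ι W r (ℓ α)) ∧
    ∃ C : ℕ → ℕ → ℝ → ℝ≥0, (∀ n k : ℕ, ContinuousOn (C n k) (Set.Ioi 0)) ∧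
      ∀ (n k : ℕ) (r : ℝ), 0 < r → ∀ α : 𝒱.map (restrictBall ι V r),
        flatNorm n k r (ℓr r α : Metric.closedBall (0 : EuclideanSpace ℝ ι) r → W) ≤
          C n k r * flatNorm (n + a) (k + b * n + c) r
            (α : Metric.closedBall (0 : EuclideanSpace ℝ ι) r → V)

end SLB

/-! ### The Poisson differential -/

section Poisson

variable {H : Type*} [NormedAddCommGroup H] [NormedSpace ℝ H]

/-- The fibre of the bundle of `n`-vectors on `H`: alternating `n`-linear forms on the dual. -/
abbrev MultiVec (H : Type*) [NormedAddCommGroup H] [NormedSpace ℝ H] (n : ℕ) : Type _ :=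
  (H →L[ℝ] ℝ) [⋀^Fin n]→L[ℝ] ℝ

/-- The constant bivector `u ∧ v`, as the map `ξ ↦ i_ξ (u ∧ v) = ξ(u) v - ξ(v) u`. -/
def bivec (u v : H) : (H →L[ℝ] ℝ) →L[ℝ] H :=
  (ContinuousLinearMap.apply ℝ ℝ u).smulRight v - (ContinuousLinearMap.apply ℝ ℝ v).smulRight u

/-- For a bivector field `P`, given by its sharp map (so that `P(ξ, η) = η (P ξ)`), the map
`(ξ, η) ↦ d_x (P(ξ, η))`, where `ξ` and `η` are constant covector fields. This is the Koszul
bracket `[ξ, η]_P` of `ξ` and `η`, the differential of the Poisson bracket of two linear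
functions. -/
def koszulBracket (P : H → (H →L[ℝ] ℝ) →L[ℝ] H) (x : H) :
    (H →L[ℝ] ℝ) →L[ℝ] (H →L[ℝ] ℝ) →L[ℝ] (H →L[ℝ] ℝ) :=
  (ContinuousLinearMap.compL ℝ H H ℝ).flip ∘L (fderiv ℝ P x).flip

theorem koszulBracket_apply (P : H → (H →L[ℝ] ℝ) →L[ℝ] H) (x : H) (hP : DifferentiableAt ℝ P x)
    (ξ η : H →L[ℝ] ℝ) : koszulBracket P x ξ η = fderiv ℝ (fun y => η (P y ξ)) x := by
  have h : HasFDerivAt (fun y => η (P y ξ)) (η ∘L (fderiv ℝ P x).flip ξ) x := by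
    have h1 : HasFDerivAt (fun y => P y ξ) ((fderiv ℝ P x).flip ξ) x := by
      have := hP.hasFDerivAt.clm_apply (hasFDerivAt_const ξ x)
      simpa using this
    exact η.hasFDerivAt.comp x h1
  rw [h.fderiv]
  rfl

/-- The Poisson differential `d_P = [P, ·]` of a bivector field `P` on a vector space `H`, given by
its sharp map. It is the differential of the cotangent Lie algebroid of `P`, written out on
constant covector fields; see `poissonDiff_zero_apply` and `poissonDiff_succ_apply`. -/
def poissonDiff (P : H → (H →L[ℝ] ℝ) →L[ℝ] H) :
    {n : ℕ} → (H → MultiVec H n) → H → MultiVec H (n + 1)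
  | 0, w, x => ContinuousAlternatingMap.alternatizeUncurryFin (fderiv ℝ w x ∘L P x)
  | _ + 1, w, x => ContinuousAlternatingMap.alternatizeUncurryFin (fderiv ℝ w x ∘L P x) -
      (1 / 2 : ℝ) • ContinuousAlternatingMap.alternatizeUncurryFin
        (ContinuousAlternatingMap.alternatizeUncurryFinCLM ℝ (H →L[ℝ] ℝ) ℝ ∘L
          (ContinuousLinearMap.compL ℝ (H →L[ℝ] ℝ) (H →L[ℝ] ℝ) _ (w x).curryLeft) ∘L
            koszulBracket P x)

theorem poissonDiff_zero_apply (P : H → (H →L[ℝ] ℝ) →L[ℝ] H) (w : H → MultiVec H 0) (x : H)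
    (ξ : Fin 1 → H →L[ℝ] ℝ) :
    poissonDiff P w x ξ = fderiv ℝ w x (P x (ξ 0)) (Fin.removeNth 0 ξ) := by
  simp [poissonDiff, ContinuousAlternatingMap.alternatizeUncurryFin_apply]

/-- The Koszul formula
`(d_P w)(ξ₀, …, ξₙ) = ∑ i, (-1)^i (P ξᵢ)(w(ξ₀, …, ξ̂ᵢ, …, ξₙ))`
`+ ∑_{i < j} (-1)^{i + j} w([ξᵢ, ξⱼ]_P, ξ₀, …, ξ̂ᵢ, …, ξ̂ⱼ, …, ξₙ)`
for constant covector fields; in the second sum the index `j` is shifted by one. -/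
theorem poissonDiff_succ_apply (P : H → (H →L[ℝ] ℝ) →L[ℝ] H)
    (hP : ∀ (x : H) (ξ η : H →L[ℝ] ℝ), η (P x ξ) = -ξ (P x η)) {n : ℕ} (w : H → MultiVec H (n + 1)) (x : H)
    (hPx : DifferentiableAt ℝ P x) (ξ : Fin (n + 2) → H →L[ℝ] ℝ) :
    poissonDiff P w x ξ =
      ∑ i : Fin (n + 2), (-1 : ℝ) ^ (i : ℕ) * fderiv ℝ w x (P x (ξ i)) (i.removeNth ξ) +
      ∑ i : Fin (n + 1), ∑ j ≥ i, (-1 : ℝ) ^ (i + (j + 1) : ℕ) *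
        w x (Fin.cons (fderiv ℝ (fun y => (ξ j.succ) (P y (ξ i.castSucc))) x)
          (j.removeNth (i.castSucc.removeNth ξ))) := by
  have hanti : ∀ α β : H →L[ℝ] ℝ, koszulBracket P x α β = -koszulBracket P x β α := by
    intro α β
    rw [koszulBracket_apply P x hPx, koszulBracket_apply P x hPx, ← fderiv_fun_neg]
    congr 1
    ext y
    exact hP y α β
  have := ContinuousAlternatingMap.alternatizeUncurryFin_alternatizeUncurryFinCLM_comp_apply
    ((ContinuousLinearMap.compL ℝ (H →L[ℝ] ℝ) (H →L[ℝ] ℝ) _ (w x).curryLeft) ∘L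
            koszulBracket P x) ξ
  rw [poissonDiff, ContinuousAlternatingMap.sub_apply, ContinuousAlternatingMap.smul_apply, this,
    ContinuousAlternatingMap.alternatizeUncurryFin_apply, sub_eq_add_neg]
  congr 1
  · simp
  rw [Finset.smul_sum, ← Finset.sum_neg_distrib]
  refine Finset.sum_congr rfl fun i _ => ?_
  rw [Finset.smul_sum, ← Finset.sum_neg_distrib]
  refine Finset.sum_congr rfl fun j _ => ?_
  rw [← koszulBracket_apply P x hPx]
  simp only [ContinuousLinearMap.comp_apply, ContinuousLinearMap.compL_apply]
  rw [hanti (ξ j.succ) (ξ i.castSucc)]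
  simp only [map_neg, ContinuousAlternatingMap.neg_apply,
    ContinuousAlternatingMap.curryLeft_apply_apply, Matrix.vecCons, zsmul_eq_mul, smul_eq_mul]
  push_cast
  ring

end Poisson

/-! ### The Lie algebra `sl₂(ℂ)` and its linear Poisson structure -/

section Sl2

/-- `sl₂(ℂ)` as a real vector space, in the real coordinates `x_j, y_j` with `z_j = x_j + i y_j`:
`x_j = u (inl j)` and `y_j = u (inr j)`, where `j : Fin 3`; see `toMatrix`. The Euclidean norm is
`|z|`, which is a constant multiple of the norm `R = √2 |z|` given by `R² = tr (A A*)`. -/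
abbrev Sl2 : Type := EuclideanSpace ℝ (Fin 3 ⊕ Fin 3)

/-- The complex coordinate `z_j`. -/
def zc (u : Sl2) (j : Fin 3) : ℂ := ⟨u (Sum.inl j), u (Sum.inr j)⟩

/-- The trace-free matrix with coordinates `z₁, z₂, z₃`. -/
def toMatrix (u : Sl2) : Matrix (Fin 2) (Fin 2) ℂ :=
  !![Complex.I * zc u 0, -zc u 1 + Complex.I * zc u 2;
     zc u 1 + Complex.I * zc u 2, -(Complex.I * zc u 0)]

/-- The coordinate vector field `∂_{x_j}`. -/
def eX (j : Fin 3) : Sl2 := EuclideanSpace.single (Sum.inl j) 1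

/-- The coordinate vector field `∂_{y_j}`. -/
def eY (j : Fin 3) : Sl2 := EuclideanSpace.single (Sum.inr j) 1

/-- The coordinate one-form `dx_j`. -/
def dX (j : Fin 3) : Sl2 →L[ℝ] ℝ := EuclideanSpace.proj (Sum.inl j)

/-- The coordinate one-form `dy_j`. -/
def dY (j : Fin 3) : Sl2 →L[ℝ] ℝ := EuclideanSpace.proj (Sum.inr j)

/-- The Poisson structure `π = 4 Re (z₁ ∂_{z₂} ∧ ∂_{z₃} + z₂ ∂_{z₃} ∧ ∂_{z₁} + z₃ ∂_{z₁} ∧ ∂_{z₂})`,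
written in the real coordinates. -/
def piSharp (u : Sl2) : (Sl2 →L[ℝ] ℝ) →L[ℝ] Sl2 :=
  ∑ j : Fin 3,
    (u (Sum.inl j) • (bivec (eX (j + 1)) (eX (j + 2)) - bivec (eY (j + 1)) (eY (j + 2))) +
      u (Sum.inr j) • (bivec (eX (j + 1)) (eY (j + 2)) + bivec (eY (j + 1)) (eX (j + 2))))

/-- The real part `f₁` of the Casimir function `f = det = z₁² + z₂² + z₃²`. -/
def f1 (u : Sl2) : ℝ := ∑ j : Fin 3, (u (Sum.inl j) ^ 2 - u (Sum.inr j) ^ 2)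

/-- The imaginary part `f₂` of the Casimir function `f = det = z₁² + z₂² + z₃²`. -/
def f2 (u : Sl2) : ℝ := ∑ j : Fin 3, 2 * u (Sum.inl j) * u (Sum.inr j)

/-- `R² = tr (A A*) = 2 |z|²`. -/
def RSq (u : Sl2) : ℝ := 2 * ∑ j : Fin 3, (u (Sum.inl j) ^ 2 + u (Sum.inr j) ^ 2)

theorem det_toMatrix (u : Sl2) : (toMatrix u).det = ⟨f1 u, f2 u⟩ := by
  rw [toMatrix, Matrix.det_fin_two_of]
  apply Complex.ext <;> simp [zc, f1, f2, Fin.sum_univ_three] <;> ring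

theorem trace_toMatrix_mul_conjTranspose (u : Sl2) :
    (toMatrix u * (toMatrix u).conjTranspose).trace = (RSq u : ℂ) := by
  rw [Matrix.trace_fin_two, Matrix.mul_apply, Matrix.mul_apply]
  simp only [Fin.sum_univ_two, Matrix.conjTranspose_apply]
  apply Complex.ext
  · rw [Complex.ofReal_re]
    simp [toMatrix, zc, RSq, Fin.sum_univ_three]
    ring
  · rw [Complex.ofReal_im]
    simp [toMatrix, zc]
    ring

/-- `π` is the linear Poisson structure of the real Lie algebra `sl₂(ℂ)`, transported to `sl₂(ℂ)` by
the trace form: `π(l_X, l_Y) = l_{[X, Y]}` for the linear functions `l_X(A) = Re tr (A X)`. -/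
theorem piSharp_linear (u X Y : Sl2) (lX lY : Sl2 →L[ℝ] ℝ)
    (hX : ∀ v, lX v = (toMatrix v * toMatrix X).trace.re)
    (hY : ∀ v, lY v = (toMatrix v * toMatrix Y).trace.re) :
    lY (piSharp u lX) =
      (toMatrix u * (toMatrix X * toMatrix Y - toMatrix Y * toMatrix X)).trace.re := by
  have h12 : (1 : Fin 3) + 1 = 2 := rfl
  have h13 : (1 : Fin 3) + 2 = 0 := rfl
  have h21 : (2 : Fin 3) + 1 = 0 := rfl
  have h22 : (2 : Fin 3) + 2 = 1 := rfl
  simp only [piSharp, Fin.sum_univ_three, bivec, add_apply, sub_apply,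
    smul_apply, ContinuousLinearMap.smulRight_apply, ContinuousLinearMap.apply_apply, zero_add,
    h12, h13, h21, h22, hX, hY]
  simp [toMatrix, Matrix.trace, Fin.sum_univ_two, zc, eX, eY]
  ring

/-- The vector fields `V₁ = R⁻² ∑ (x_j ∂_{x_j} - y_j ∂_{y_j})` and
`V₂ = R⁻² ∑ (x_j ∂_{y_j} + y_j ∂_{x_j})` on `sl₂(ℂ) ∖ {0}`. -/
def V : Fin 2 → Sl2 → Sl2 :=
  ![fun u => (RSq u)⁻¹ • ∑ j : Fin 3, (u (Sum.inl j) • eX j - u (Sum.inr j) • eY j),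
    fun u => (RSq u)⁻¹ • ∑ j : Fin 3, (u (Sum.inl j) • eY j + u (Sum.inr j) • eX j)]

/-- The fibre of the bundle of differential forms of degree `m` on `sl₂(ℂ)`. -/
abbrev Form (m : ℕ) : Type := Sl2 [⋀^Fin m]→L[ℝ] ℝ

/-- The extension `ω̃₁` of the leafwise symplectic form of `π` to a two-form on `sl₂(ℂ) ∖ {0}`
with kernel spanned by `V₁` and `V₂`. -/
def omegaTilde (u : Sl2) : Form 2 :=
  (2 / RSq u) • ∑ j : Fin 3,
    (u (Sum.inl j) • (wedge1 (dY (j + 1)) (oneForm (dY (j + 2))) -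
        wedge1 (dX (j + 1)) (oneForm (dX (j + 2)))) -
      u (Sum.inr j) • (wedge1 (dX (j + 1)) (oneForm (dY (j + 2))) +
        wedge1 (dY (j + 1)) (oneForm (dX (j + 2)))))

/-- `γ_i = i_{V_i} d ω̃₁`, a two-form on `sl₂(ℂ) ∖ {0}`. -/
def gamma (i : Fin 2) (u : Sl2) : Form 2 := (extDeriv omegaTilde u).curryLeft (V i u)

/-- The two-form `φ = df₁ ∧ df₂`. -/
def phi (u : Sl2) : Form 2 := wedge1 (fderiv ℝ f1 u) (oneForm (fderiv ℝ f2 u))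

/-! ### The two complexes -/

/-- `𝔛₀ⁿ`: the `n`-vector fields on `sl₂(ℂ)` that are flat at the origin. -/
def flatMultivectors (n : ℕ) : Submodule ℝ (Sl2 → MultiVec Sl2 n) :=
  flatSections Sl2 (MultiVec Sl2 n)

/-- The operator `e_φ : η ↦ φ ∧ η` on differential forms. -/
def ePhi (p : ℕ) : (Sl2 → Form p) →ₗ[ℝ] (Sl2 → Form (p + 2)) where
  toFun η := fun u => wedge2 (phi u) (η u)
  map_add' _ _ := funext fun _ => wedge2_add _ _ _
  map_smul' _ _ := funext fun _ => wedge2_smul _ _ _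

/-- The space `𝒞^p = e_φ(Ω₀^p)` of the flat foliated complex; it consists of forms of degree
`p + 2`. -/
def CC (p : ℕ) : Submodule ℝ (Sl2 → Form (p + 2)) :=
  (flatSections Sl2 (Form p)).map (ePhi p)

/-- The flat foliated complex indexed by form degree: `𝒞^{m-2}` as a space of forms of degree `m`,
which is zero for `m < 2`. -/
def CCForm : (m : ℕ) → Submodule ℝ (Sl2 → Form m)
  | 0 => ⊥
  | 1 => ⊥
  | p + 2 => CC p

/-- The fibre of the bundle of which the elements of `⨁_{p+q=n} 𝒞^p ⊗ ∧^q ℝ²` are sections.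
An element `(η₀, (η₁, η₂), η₃)` stands for `η₀ + η₁ ⊗ e₁ + η₂ ⊗ e₂ + η₃ ⊗ e₁ ∧ e₂`, where `η₀`
lies in `𝒞ⁿ`, `η₁` and `η₂` in `𝒞ⁿ⁻¹`, and `η₃` in `𝒞ⁿ⁻²`, which are spaces of forms of degrees
`n + 2`, `n + 1` and `n`. -/
abbrev Fib (n : ℕ) : Type := Form (n + 2) × (Fin 2 → Form (n + 1)) × Form n

/-- The space `⨁_{p+q=n} 𝒞^p ⊗ ∧^q ℝ²`. -/
def cochains (n : ℕ) : Submodule ℝ (Sl2 → Fib n) where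
  carrier := {ξ | (fun u => (ξ u).1) ∈ CCForm (n + 2) ∧
    (∀ i, (fun u => (ξ u).2.1 i) ∈ CCForm (n + 1)) ∧ (fun u => (ξ u).2.2) ∈ CCForm n}
  zero_mem' := ⟨Submodule.zero_mem _, fun _ => Submodule.zero_mem _, Submodule.zero_mem _⟩
  add_mem' := fun h k => ⟨Submodule.add_mem _ h.1 k.1,
    fun i => Submodule.add_mem _ (h.2.1 i) (k.2.1 i), Submodule.add_mem _ h.2.2 k.2.2⟩
  smul_mem' := fun c _ h => ⟨Submodule.smul_mem _ c h.1,
    fun i => Submodule.smul_mem _ c (h.2.1 i), Submodule.smul_mem _ c h.2.2⟩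

/-- The operator `d`: the exterior derivative on the first factor of `𝒞^• ⊗ ∧^• ℝ²`. -/
def dOp {n : ℕ} (ξ : Sl2 → Fib n) (u : Sl2) : Fib (n + 1) :=
  (extDeriv (fun v => (ξ v).1) u, fun i => extDeriv (fun v => (ξ v).2.1 i) u,
    extDeriv (fun v => (ξ v).2.2) u)

/-- The operator `δ`, given for `η ∈ 𝒞^p` by `δ η = 0`, `δ(η ⊗ e_i) = (-1)^p γ_i ∧ η` and
`δ(η ⊗ e₁ ∧ e₂) = (-1)^p (γ₁ ∧ η ⊗ e₂ - γ₂ ∧ η ⊗ e₁)`. In total degree `n` one has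
`p = n - 1` in the second case and `p = n - 2` in the third. -/
def deltaOp {n : ℕ} (ξ : Sl2 → Fib n) (u : Sl2) : Fib (n + 1) :=
  ((-1 : ℝ) ^ (n + 1) • ∑ i : Fin 2, wedge2 (gamma i u) ((ξ u).2.1 i),
    ![-((-1 : ℝ) ^ n • wedge2 (gamma 1 u) (ξ u).2.2), (-1 : ℝ) ^ n • wedge2 (gamma 0 u) (ξ u).2.2],
    0)

end Sl2

end FlatPoisson

end

open FlatPoisson

/-! Away from the origin `π` is regular of rank four. Its leaves are cut out by the Casimirs `f₁,
f₂`, and `V₁, V₂` are dual to `df₁, df₂`, so tangent vectors split into a leafwise part and a span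
of the `V_k`, and covectors split accordingly. The extended form `ω̃₁` kills the `V_k` and inverts
`π` up to the two projections: `π ∘ ω̃₁` is the projection along the `V_k`, and `ω̃₁ ∘ π` is the
projection along the `df_k` (`piSharp_omegaTilde`, `omegaFlat_comp_piSharp`). A multivector is
therefore determined by the leafwise parts of `w`, `i_{df_k} w` and `i_{df₂} i_{df₁} w`. Pulling
these back by `ω̃₁` and wedging with `φ`, which remembers exactly the leafwise part of a form, gives
`fwd`. Contracting with `V₁, V₂`, pulling back by `π` and wedging with the `V_k` gives `bwd`; that
the two are inverse is the decomposition along a dual pair (`decomposition`, `bwd_fwd`,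
`fwd_bwd_apply`).

For the differentials, pullback by `ω̃₁` would carry `d_π` to `d` along the leaves if `ω̃₁` were
closed. The Jacobi identity makes `ω̃₁` closed on each leaf only; the components of `dω̃₁` with one
transverse argument are the `γ_k`, and each enters paired with the contraction by `df_k`
(`fderiv_sub_fderiv_add_koszulBracket`, `extDeriv_fwd₀`). These correction terms are `δ`.
Contraction with a Casimir differential anticommutes with `d_π` (`curryLeft_poissonDiff`), so the
remaining components follow from the first one, and the sign `(-1)^n` in `fwd` absorbs the
anticommutation. That `d_π` squares to zero is a computation for linear Poisson structures from the
symmetry of second derivatives and the Jacobi identity; `(d + δ)² = 0` is then transported through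
the isomorphism.

For the estimates, all operators except `d` and `d_π` are multiplications by coefficients whose
homogeneous components are smooth off the origin. Multiplication by a coefficient with a pole of
order `d` preserves flatness and has property SLB for `(0, 0, d)` (`propertySLB_of_hasPoleLE`): the
extra poles created by differentiating the coefficient are paid for by the mean value inequality,
which trades derivatives of a flat section for orders of vanishing. It remains to count degrees: `φ`
has degree 2, `ω̃₁` and `V_k` have degree -1, `π` and `df_k` have degree 1, and `γ_k` has degree -3.
Since `ω̃₁` has rank at most four, only `n ≤ 4` contributes to the pullback of `n`-vectors, which
leaves a pole of order at most `4 - 2 = 2` in `fwd`; in `bwd` at most four factors `V_k` occur. -/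

noncomputable section

namespace FlatPoisson

/-! ### Homogeneous coefficients -/

section Homogeneous

variable {H F G K : Type*} [NormedAddCommGroup H] [NormedSpace ℝ H]
  [NormedAddCommGroup F] [NormedSpace ℝ F] [NormedAddCommGroup G] [NormedSpace ℝ G]
  [NormedAddCommGroup K] [NormedSpace ℝ K]

/-- Smooth maps on the complement of the origin which are positively homogeneous of degree `e`. -/
structure IsHomogeneous (e : ℤ) (c : H → F) : Prop where
  contDiffOn : ContDiffOn ℝ ∞ c {0}ᶜ
  map_smul : ∀ t : ℝ, 0 < t → ∀ x : H, x ≠ 0 → c (t • x) = t ^ e • c x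

namespace IsHomogeneous

variable {e e₁ e₂ : ℤ} {c : H → F}

theorem contDiffAt (hc : IsHomogeneous e c) {x : H} (hx : x ≠ 0) : ContDiffAt ℝ ∞ c x :=
  hc.contDiffOn.contDiffAt (isOpen_compl_singleton.mem_nhds hx)

theorem differentiableAt (hc : IsHomogeneous e c) {x : H} (hx : x ≠ 0) :
    DifferentiableAt ℝ c x :=
  (hc.contDiffAt hx).differentiableAt (by simp)

theorem comp_clm (hc : IsHomogeneous e c) (L : F →L[ℝ] G) : IsHomogeneous e (fun x => L (c x)) :=
  ⟨L.contDiff.comp_contDiffOn hc.contDiffOn, fun t ht x hx => by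
    rw [hc.map_smul t ht x hx, L.map_smul]⟩

theorem bilin (B : F →L[ℝ] G →L[ℝ] K) {g : H → G} (hc : IsHomogeneous e₁ c)
    (hg : IsHomogeneous e₂ g) : IsHomogeneous (e₁ + e₂) (fun x => B (c x) (g x)) :=
  ⟨(B.contDiff.comp_contDiffOn hc.contDiffOn).clm_apply hg.contDiffOn, fun t ht x hx => by
    rw [hc.map_smul t ht x hx, hg.map_smul t ht x hx, zpow_add₀ ht.ne', mul_smul]
    simp [smul_comm (t ^ e₂)]⟩

theorem clm_comp {f : H → G →L[ℝ] K} {g : H → F →L[ℝ] G} (hf : IsHomogeneous e₁ f)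
    (hg : IsHomogeneous e₂ g) : IsHomogeneous (e₁ + e₂) (fun x => f x ∘L g x) :=
  hf.bilin (ContinuousLinearMap.compL ℝ F G K) hg

theorem smul {f : H → ℝ} (hf : IsHomogeneous e₁ f) (hc : IsHomogeneous e₂ c) :
    IsHomogeneous (e₁ + e₂) (fun x => f x • c x) :=
  hf.bilin (ContinuousLinearMap.lsmul ℝ ℝ) hc

theorem add {g : H → F} (hc : IsHomogeneous e c) (hg : IsHomogeneous e g) :
    IsHomogeneous e (fun x => c x + g x) :=
  ⟨hc.contDiffOn.add hg.contDiffOn, fun t ht x hx => by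
    rw [hc.map_smul t ht x hx, hg.map_smul t ht x hx, smul_add]⟩

theorem neg (hc : IsHomogeneous e c) : IsHomogeneous e (fun x => -c x) :=
  ⟨hc.contDiffOn.neg, fun t ht x hx => by rw [hc.map_smul t ht x hx, smul_neg]⟩

theorem const_smul (hc : IsHomogeneous e c) (a : ℝ) : IsHomogeneous e (fun x => a • c x) :=
  ⟨hc.contDiffOn.const_smul a, fun t ht x hx => by rw [hc.map_smul t ht x hx, smul_comm]⟩

theorem zero (e : ℤ) : IsHomogeneous e (fun _ : H => (0 : F)) :=
  ⟨contDiffOn_const, fun t ht x hx => by simp⟩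

theorem const (a : F) : IsHomogeneous 0 (fun _ : H => a) :=
  ⟨contDiffOn_const, fun t ht x hx => by simp⟩

theorem clm (L : H →L[ℝ] F) : IsHomogeneous 1 (fun x => L x) :=
  ⟨L.contDiff.contDiffOn, fun t ht x hx => by simp⟩

theorem sum {ι : Type*} (s : Finset ι) {g : ι → H → F} (hg : ∀ i ∈ s, IsHomogeneous e (g i)) :
    IsHomogeneous e (fun x => ∑ i ∈ s, g i x) :=
  ⟨ContDiffOn.sum fun i hi => (hg i hi).contDiffOn, fun t ht x hx => by
    rw [Finset.smul_sum]
    exact Finset.sum_congr rfl fun i hi => (hg i hi).map_smul t ht x hx⟩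

theorem congr {g : H → F} (hc : IsHomogeneous e c) (h : ∀ x, x ≠ 0 → g x = c x) :
    IsHomogeneous e g :=
  ⟨hc.contDiffOn.congr fun x hx => h x hx, fun t ht x hx => by
    rw [h x hx, h _ (smul_ne_zero ht.ne' hx), hc.map_smul t ht x hx]⟩

theorem degree_congr (hc : IsHomogeneous e₁ c) (h : e₁ = e₂) : IsHomogeneous e₂ c := h ▸ hc

/-- Differentiating `c (t • y) = t ^ e • c y` in `y` produces an extra factor `t` on the left;
dividing by it lowers the degree by one. -/
theorem fderiv (hc : IsHomogeneous e c) : IsHomogeneous (e - 1) (fderiv ℝ c) := by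
  refine ⟨hc.contDiffOn.fderiv_of_isOpen isOpen_compl_singleton (by simp), fun t ht x hx => ?_⟩
  have h1 : (fun y => c (t • y)) =ᶠ[nhds x] fun y => t ^ e • c y := by
    filter_upwards [isOpen_compl_singleton.mem_nhds (show x ∈ ({0}ᶜ : Set H) from hx)] with y hy
    exact hc.map_smul t ht y hy
  have h2 := h1.fderiv_eq (𝕜 := ℝ)
  rw [fderiv_comp_smul, fderiv_fun_const_smul (hc.differentiableAt hx)] at h2
  have h3 := congrArg (fun L : H →L[ℝ] F => t⁻¹ • L) h2
  simp only [smul_smul, inv_mul_cancel₀ ht.ne', one_smul] at h3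
  rw [h3, zpow_sub₀ ht.ne', zpow_one, div_eq_inv_mul]

theorem iteratedFDeriv (hc : IsHomogeneous e c) (m : ℕ) :
    IsHomogeneous (e - m) (iteratedFDeriv ℝ m c) := by
  induction m with
  | zero =>
    rw [iteratedFDeriv_zero_eq_comp]
    have h0 : e - ((0 : ℕ) : ℤ) = e := by simp
    rw [h0]
    exact hc.comp_clm
      ((continuousMultilinearCurryFin0 ℝ H F).symm.toContinuousLinearEquiv.toContinuousLinearMap)
  | succ m ih =>
    rw [iteratedFDeriv_succ_eq_comp_left]
    refine (ih.fderiv.comp_clm ((continuousMultilinearCurryLeftEquiv ℝ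
      (fun _ : Fin (m + 1) => H) F).symm.toContinuousLinearEquiv.toContinuousLinearMap)
        ).degree_congr ?_
    push_cast
    ring

/-- Compactness of the unit sphere bounds `c` there, and scaling carries the bound to all nonzero
vectors. -/
theorem exists_norm_le [FiniteDimensional ℝ H] (hc : IsHomogeneous e c) :
    ∃ C : ℝ, 0 ≤ C ∧ ∀ x : H, x ≠ 0 → ‖c x‖ ≤ C * ‖x‖ ^ e := by
  have := FiniteDimensional.proper ℝ H
  have hcont : ContinuousOn c (Metric.sphere 0 1) :=
    hc.contDiffOn.continuousOn.mono fun x hx => by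
      rintro rfl
      simp at hx
  obtain ⟨C, hC⟩ := (isCompact_sphere (0 : H) 1).exists_bound_of_continuousOn hcont
  refine ⟨max C 0, le_max_right _ _, fun x hx => ?_⟩
  have hx' : 0 < ‖x‖ := norm_pos_iff.mpr hx
  have h0 : ‖x‖⁻¹ • x ≠ 0 := smul_ne_zero (inv_ne_zero hx'.ne') hx
  have h1 := hc.map_smul ‖x‖ hx' (‖x‖⁻¹ • x) h0
  rw [smul_smul, mul_inv_cancel₀ hx'.ne', one_smul] at h1
  rw [h1, norm_smul, mul_comm, norm_zpow, norm_norm]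
  gcongr
  refine (hC _ ?_).trans (le_max_left _ _)
  simp [norm_smul, hx'.ne']

end IsHomogeneous

/-- Coefficients which are smooth away from the origin and have at most a pole of order `d` at the
origin, in the sense that derivatives of order `m` have at most a pole of order `d + m`. -/
structure HasPoleLE (d : ℕ) (c : H → F) : Prop where
  contDiffOn : ContDiffOn ℝ ∞ c {0}ᶜ
  bound : ∀ m : ℕ, ∃ (C : ℝ) (N : ℕ), 0 ≤ C ∧ ∀ x : H, x ≠ 0 →
    ‖iteratedFDeriv ℝ m c x‖ * ‖x‖ ^ (d + m) ≤ C * (1 + ‖x‖) ^ N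

theorem IsHomogeneous.hasPoleLE [FiniteDimensional ℝ H] {e : ℤ} {d : ℕ} {c : H → F}
    (hc : IsHomogeneous e c) (h : -(d : ℤ) ≤ e) : HasPoleLE d c := by
  refine ⟨hc.contDiffOn, fun m => ?_⟩
  obtain ⟨C, hC0, hC⟩ := (hc.iteratedFDeriv m).exists_norm_le
  -- `N` is the surplus `e + d` of the degree over the admitted pole; it only affects growth at
  -- infinity.
  obtain ⟨N, hN⟩ : ∃ N : ℕ, e = N - d := ⟨(e + d).toNat, by omega⟩
  refine ⟨C, N, hC0, fun x hx => ?_⟩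
  have hx' : 0 < ‖x‖ := norm_pos_iff.mpr hx
  calc _ ≤ C * ‖x‖ ^ (e - m) * ‖x‖ ^ (d + m) := by gcongr; exact hC x hx
    _ = C * ‖x‖ ^ N := by
      rw [mul_assoc, ← zpow_natCast, ← zpow_natCast, ← zpow_add₀ hx'.ne']
      congr 2
      push_cast
      omega
    _ ≤ C * (1 + ‖x‖) ^ N := by gcongr; linarith

/-- The components of `fwd` and `bwd` are homogeneous of different degrees, so their sums are not
homogeneous; the pole bound is what survives addition. -/
theorem HasPoleLE.add {d : ℕ} {c₁ c₂ : H → F} (h₁ : HasPoleLE d c₁) (h₂ : HasPoleLE d c₂) :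
    HasPoleLE d (fun x => c₁ x + c₂ x) := by
  refine ⟨h₁.contDiffOn.add h₂.contDiffOn, fun m => ?_⟩
  obtain ⟨C₁, N₁, hC₁, hb₁⟩ := h₁.bound m
  obtain ⟨C₂, N₂, hC₂, hb₂⟩ := h₂.bound m
  refine ⟨C₁ + C₂, N₁ + N₂, by positivity, fun x hx => ?_⟩
  have hmem := isOpen_compl_singleton.mem_nhds (show x ∈ ({0}ᶜ : Set H) from hx)
  have hm : (m : ℕ∞ω) ≤ (⊤ : ℕ∞) := mod_cast le_top
  have h := iteratedFDeriv_add_apply (i := m) ((h₁.contDiffOn.contDiffAt hmem).of_le hm)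
    ((h₂.contDiffOn.contDiffAt hmem).of_le hm)
  have h' : iteratedFDeriv ℝ m (fun x => c₁ x + c₂ x) x = _ := h
  have h1x : (1 : ℝ) ≤ 1 + ‖x‖ := by linarith [norm_nonneg x]
  rw [h']
  calc _ ≤ (‖iteratedFDeriv ℝ m c₁ x‖ + ‖iteratedFDeriv ℝ m c₂ x‖) * ‖x‖ ^ (d + m) := by
        gcongr
        exact norm_add_le _ _
    _ ≤ C₁ * (1 + ‖x‖) ^ N₁ + C₂ * (1 + ‖x‖) ^ N₂ := by
        rw [add_mul]
        exact add_le_add (hb₁ x hx) (hb₂ x hx)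
    _ ≤ C₁ * (1 + ‖x‖) ^ (N₁ + N₂) + C₂ * (1 + ‖x‖) ^ (N₁ + N₂) := by
        gcongr <;> first | exact h1x | omega
    _ = _ := by ring

/-- Leibniz rule: `i` derivatives on the coefficient cost `‖x‖ ^ (d + i)`, which is exactly the
excess vanishing assumed of the derivative of `s` of order `m - i`. The constants do not depend on
`x`, `s`, `A` or `k`, so one bound serves all weights. -/
theorem HasPoleLE.norm_iteratedFDeriv_clm_apply_le {d : ℕ} {c : H → F →L[ℝ] G}
    (hc : HasPoleLE d c) (m : ℕ) : ∃ (C : ℝ) (N : ℕ), 0 ≤ C ∧ ∀ (x : H), x ≠ 0 →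
      ∀ (s : H → F), ContDiff ℝ ∞ s → ∀ (A : ℝ) (k : ℕ),
        (∀ i ≤ m, ‖iteratedFDeriv ℝ (m - i) s x‖ ≤ A * ‖x‖ ^ (k + d + i)) →
        ‖iteratedFDeriv ℝ m (fun y => c y (s y)) x‖ ≤ C * (1 + ‖x‖) ^ N * A * ‖x‖ ^ k := by
  choose C N hC hb using hc.bound
  refine ⟨∑ i ∈ Finset.range (m + 1), (m.choose i) * C i, ∑ i ∈ Finset.range (m + 1), N i,
    Finset.sum_nonneg fun i _ => by have := hC i; positivity, ?_⟩
  intro x hx s hs A k hA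
  have hopen : IsOpen ({0}ᶜ : Set H) := isOpen_compl_singleton
  have hx' : 0 < ‖x‖ := norm_pos_iff.mpr hx
  have h1x : (1 : ℝ) ≤ 1 + ‖x‖ := by linarith [norm_nonneg x]
  have hA0 : 0 ≤ A := by
    have := (norm_nonneg _).trans (hA m le_rfl)
    exact nonneg_of_mul_nonneg_left this (by positivity)
  have h := norm_iteratedFDerivWithin_clm_apply (n := m) hc.contDiffOn hs.contDiffOn
    hopen.uniqueDiffOn (show x ∈ ({0}ᶜ : Set H) from hx) (mod_cast le_top)
  rw [iteratedFDerivWithin_of_isOpen _ hopen hx] at h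
  refine h.trans ?_
  rw [Finset.sum_mul, Finset.sum_mul, Finset.sum_mul]
  refine Finset.sum_le_sum fun i hi => ?_
  have him : i ≤ m := by simpa [Nat.lt_succ_iff] using hi
  rw [iteratedFDerivWithin_of_isOpen _ hopen hx, iteratedFDerivWithin_of_isOpen _ hopen hx]
  calc _ ≤ (m.choose i) * ‖iteratedFDeriv ℝ i c x‖ * (A * ‖x‖ ^ (k + d + i)) := by
        gcongr
        exact hA i him
    _ = (m.choose i) * (‖iteratedFDeriv ℝ i c x‖ * ‖x‖ ^ (d + i)) * A * ‖x‖ ^ k := by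
        rw [add_assoc, pow_add]
        ring
    _ ≤ (m.choose i) * (C i * (1 + ‖x‖) ^ ∑ i ∈ Finset.range (m + 1), N i) * A * ‖x‖ ^ k := by
        have hN : (1 + ‖x‖) ^ N i ≤ (1 + ‖x‖) ^ ∑ i ∈ Finset.range (m + 1), N i :=
          pow_le_pow_right₀ h1x
            (Finset.single_le_sum (f := N) (fun _ _ => Nat.zero_le _) hi)
        have := (hb i x hx).trans (mul_le_mul_of_nonneg_left hN (hC i))
        exact mul_le_mul_of_nonneg_right (mul_le_mul_of_nonneg_right
          (mul_le_mul_of_nonneg_left this (Nat.cast_nonneg _)) hA0) (by positivity)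
    _ = _ := by ring

end Homogeneous

/-! ### Flat sections and coefficients with poles -/

section FlatEstimates

variable {H F G : Type*} [NormedAddCommGroup H] [NormedSpace ℝ H]
  [NormedAddCommGroup F] [NormedSpace ℝ F] [NormedAddCommGroup G] [NormedSpace ℝ G]

theorem apply_zero_of_mem_flatSections {s : H → F} (hs : s ∈ flatSections H F) : s 0 = 0 := by
  have := congrArg (fun f => f 0) (hs.2 0)
  simpa using this

theorem contDiff_of_mem_flatSections {s : H → F} (hs : s ∈ flatSections H F) : ContDiff ℝ ∞ s :=
  hs.1

theorem differentiable_of_mem_flatSections {s : H → F} (hs : s ∈ flatSections H F) :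
    Differentiable ℝ s := hs.1.differentiable (by simp)

theorem fderiv_mem_flatSections {s : H → F} (hs : s ∈ flatSections H F) :
    fderiv ℝ s ∈ flatSections H (H →L[ℝ] F) := by
  refine ⟨hs.1.fderiv_right (by simp), fun m => ?_⟩
  rw [← norm_eq_zero, norm_iteratedFDeriv_fderiv, hs.2, norm_zero]

/-- The mean value inequality from the origin, where all derivatives vanish, trades `i` derivatives
for `i` more orders of vanishing without changing the constant `A`. This is why no derivatives are
lost and the loss of weight does not grow with `n`, that is, why `a = b = 0` in property SLB. -/
theorem norm_iteratedFDeriv_le_of_mem_flatSections {s : H → F} (hs : s ∈ flatSections H F)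
    {r A : ℝ} {j K : ℕ} (i : ℕ)
    (h : ∀ x : H, ‖x‖ ≤ r → ‖iteratedFDeriv ℝ (j + i) s x‖ ≤ A * ‖x‖ ^ K) :
    ∀ x : H, ‖x‖ ≤ r → ‖iteratedFDeriv ℝ j s x‖ ≤ A * ‖x‖ ^ (K + i) := by
  induction i generalizing j with
  | zero => exact h
  | succ i ih =>
    have ih' := ih (j := j + 1) (by rwa [add_assoc, add_comm 1 i])
    intro x hx
    rcases eq_or_ne x 0 with rfl | hx0
    · rw [hs.2]
      simp
    have hA : 0 ≤ A := by
      have := (norm_nonneg _).trans (ih' x hx)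
      exact nonneg_of_mul_nonneg_left this (pow_pos (norm_pos_iff.mpr hx0) _)
    have hd : Differentiable ℝ (iteratedFDeriv ℝ j s) :=
      hs.1.differentiable_iteratedFDeriv (mod_cast ENat.natCast_lt_top j)
    -- The ball has radius `‖x‖`, so the bound at its points `y` is dominated by the one with `‖x‖`.
    have := (convex_closedBall (0 : H) ‖x‖).norm_image_sub_le_of_norm_fderiv_le (𝕜 := ℝ)
      (f := iteratedFDeriv ℝ j s) (C := A * ‖x‖ ^ (K + i)) (x := 0) (y := x)
      (fun y _ => hd y) (fun y hy => by
        have hy' : ‖y‖ ≤ ‖x‖ := by simpa using hy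
        rw [norm_fderiv_iteratedFDeriv]
        refine (ih' y (hy'.trans hx)).trans ?_
        gcongr) (by simp) (by simp)
    rw [hs.2, sub_zero, sub_zero] at this
    rw [← add_assoc, pow_succ, ← mul_assoc]
    exact this

theorem exists_norm_iteratedFDeriv_le [FiniteDimensional ℝ H] {s : H → F}
    (hs : s ∈ flatSections H F) (j K : ℕ) (r : ℝ) :
    ∃ A : ℝ, ∀ x : H, ‖x‖ ≤ r → ‖iteratedFDeriv ℝ j s x‖ ≤ A * ‖x‖ ^ K := by
  have := FiniteDimensional.proper ℝ H
  have hcont : Continuous (iteratedFDeriv ℝ (j + K) s) :=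
    hs.1.continuous_iteratedFDeriv (mod_cast le_top)
  obtain ⟨A, hA⟩ := (isCompact_closedBall (0 : H) r).exists_bound_of_continuousOn
    hcont.continuousOn
  refine ⟨A, ?_⟩
  have := norm_iteratedFDeriv_le_of_mem_flatSections hs (r := r) (A := A) (j := j) (K := 0) K
    (fun x hx => by simpa using hA x (by simpa using hx))
  simpa using this

/-- A quadratic bound near the origin makes every iterated derivative differentiable there with
derivative zero, once its value there is zero; induction on the order then propagates both
smoothness and vanishing across the origin. -/
theorem mem_flatSections_of_norm_le {g : H → F} (h0 : g 0 = 0) (hg : ContDiffOn ℝ ∞ g {0}ᶜ)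
    (hb : ∀ m : ℕ, ∃ C : ℝ, ∀ x : H, x ≠ 0 → ‖x‖ ≤ 1 →
      ‖iteratedFDeriv ℝ m g x‖ ≤ C * ‖x‖ ^ 2) : g ∈ flatSections H F := by
  have key : ∀ m : ℕ, iteratedFDeriv ℝ m g 0 = 0 →
      HasFDerivAt (iteratedFDeriv ℝ m g) (0 : H →L[ℝ] _) 0 := by
    intro m hm
    obtain ⟨C, hC⟩ := hb m
    refine HasFDerivAt.of_isLittleO ?_
    simp only [hm, sub_zero, zero_apply]
    have h1 : iteratedFDeriv ℝ m g =O[nhds 0] fun x : H => ‖x‖ ^ 2 := by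
      refine Asymptotics.IsBigO.of_bound C ?_
      filter_upwards [Metric.closedBall_mem_nhds (0 : H) one_pos] with x hx
      rcases eq_or_ne x 0 with rfl | hx0
      · simp [hm]
      · simpa using hC x hx0 (by simpa using hx)
    refine h1.trans_isLittleO ?_
    have := Asymptotics.isLittleO_norm_pow_id (E' := H) (n := 2) (by norm_num)
    exact this
  have hz : ∀ m : ℕ, iteratedFDeriv ℝ m g 0 = 0 := by
    intro m
    induction m with
    | zero => ext; simp [h0]
    | succ m ih =>
      rw [← norm_eq_zero, ← norm_fderiv_iteratedFDeriv, (key m ih).fderiv]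
      exact norm_zero (E := H →L[ℝ] H [×m]→L[ℝ] F)
  refine ⟨contDiff_of_differentiable_iteratedFDeriv (n := ⊤) fun m _ x => ?_, hz⟩
  rcases eq_or_ne x 0 with rfl | hx0
  · exact (key m (hz m)).differentiableAt
  · have hx := isOpen_compl_singleton.mem_nhds (show x ∈ ({0}ᶜ : Set H) from hx0)
    exact (hg.contDiffAt hx).differentiableAt_iteratedFDeriv (mod_cast ENat.natCast_lt_top m)

/-- Flat sections vanish to every order, so they absorb the pole with two orders to spare. The value
of `c` at the origin is irrelevant, since it is applied to `s 0 = 0`. -/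
theorem HasPoleLE.clm_apply_mem_flatSections [FiniteDimensional ℝ H] {d : ℕ}
    {c : H → F →L[ℝ] G} (hc : HasPoleLE d c) {s : H → F} (hs : s ∈ flatSections H F) :
    (fun x => c x (s x)) ∈ flatSections H G := by
  refine mem_flatSections_of_norm_le ?_ (hc.contDiffOn.clm_apply hs.1.contDiffOn) fun m => ?_
  · simp [apply_zero_of_mem_flatSections hs]
  obtain ⟨C, N, hC, hb⟩ := hc.norm_iteratedFDeriv_clm_apply_le m
  obtain ⟨A, hA⟩ := exists_norm_iteratedFDeriv_le hs m (2 + d) 1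
  refine ⟨C * 2 ^ N * A, fun x hx hx1 => ?_⟩
  have hx' : 0 < ‖x‖ := norm_pos_iff.mpr hx
  have hA0 : 0 ≤ A := by
    have := (norm_nonneg _).trans (hA x hx1)
    exact nonneg_of_mul_nonneg_left this (by positivity)
  refine (hb x hx s hs.1 A 2 fun i hi => ?_).trans ?_
  · exact norm_iteratedFDeriv_le_of_mem_flatSections hs (r := 1) i
      (by rwa [Nat.sub_add_cancel hi]) x hx1
  · gcongr
    linarith

theorem IsHomogeneous.clm_apply_mem_flatSections [FiniteDimensional ℝ H] {e : ℤ}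
    {c : H → F →L[ℝ] G} (hc : IsHomogeneous e c) {s : H → F} (hs : s ∈ flatSections H F) :
    (fun x => c x (s x)) ∈ flatSections H G :=
  (hc.hasPoleLE (d := (-e).toNat) (by omega)).clm_apply_mem_flatSections hs

end FlatEstimates

end FlatPoisson

end

noncomputable section

namespace FlatPoisson

/-! ### Property SLB for multiplication by coefficients with poles -/

section SLBCriterion

variable {ι : Type*} [Fintype ι] [DecidableEq ι]
  {V W : Type*} [NormedAddCommGroup V] [NormedSpace ℝ V] [NormedAddCommGroup W] [NormedSpace ℝ W]

/-- Expansion in the standard basis. It compares the partial derivatives in the flat norm with the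
operator norms used in the estimates. -/
theorem norm_le_of_forall_single {m : ℕ} (T : (EuclideanSpace ℝ ι) [×m]→L[ℝ] V) {M : ℝ}
    (hM : 0 ≤ M) (h : ∀ a : Fin m → ι, ‖T fun i => EuclideanSpace.single (a i) (1 : ℝ)‖ ≤ M) :
    ‖T‖ ≤ (Fintype.card ι : ℝ) ^ m * M := by
  refine T.opNorm_le_bound (by positivity) fun v => ?_
  have hv : v = fun i => ∑ j : ι, v i j • EuclideanSpace.single j (1 : ℝ) := by
    funext i
    ext k
    simp [Finset.sum_apply, Pi.single_apply]
  have h1 : T v = ∑ a : Fin m → ι,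
      (∏ i, v i (a i)) • T fun i => EuclideanSpace.single (a i) (1 : ℝ) := by
    conv_lhs => rw [hv]
    have := T.toMultilinearMap.map_sum (fun i (j : ι) => v i j • EuclideanSpace.single j (1 : ℝ))
    simp only [ContinuousMultilinearMap.coe_coe] at this
    rw [this]
    exact Finset.sum_congr rfl fun a _ => T.map_smul_univ _ _
  rw [h1]
  refine (norm_sum_le _ _).trans ?_
  calc _ ≤ ∑ _a : Fin m → ι, (∏ i, ‖v i‖) * M := by
        refine Finset.sum_le_sum fun a _ => ?_
        rw [norm_smul, norm_prod]
        refine mul_le_mul (Finset.prod_le_prod (fun _ _ => norm_nonneg _) fun i _ => ?_) (h a)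
          (norm_nonneg _) (Finset.prod_nonneg fun _ _ => norm_nonneg _)
        exact PiLp.norm_apply_le (v i) (a i)
    _ = _ := by
        simp
        ring

omit [DecidableEq ι] in
-- The closed ball is convex with nonempty interior, so derivatives within it are unique and agree
-- with those of any smooth extension.
theorem iteratedFDerivWithin_extend_restrictBall {s : EuclideanSpace ℝ ι → V}
    (hs : ContDiff ℝ ∞ s) {r : ℝ} (hr : 0 < r) (m : ℕ)
    (x : Metric.closedBall (0 : EuclideanSpace ℝ ι) r) :
    iteratedFDerivWithin ℝ m (Function.extend Subtype.val (restrictBall ι V r s) 0)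
      (Metric.closedBall (0 : EuclideanSpace ℝ ι) r) x = iteratedFDeriv ℝ m s x := by
  have h : Set.EqOn (Function.extend Subtype.val (restrictBall ι V r s) 0) s
      (Metric.closedBall (0 : EuclideanSpace ℝ ι) r) := by
    intro y hy
    exact Subtype.val_injective.extend_apply (restrictBall ι V r s) 0 ⟨y, hy⟩
  rw [iteratedFDerivWithin_congr h x.2]
  refine iteratedFDerivWithin_eq_iteratedFDeriv (uniqueDiffOn_convex (convex_closedBall _ _) ?_)
    (hs.of_le (mod_cast le_top)).contDiffAt x.2
  exact ⟨0, Metric.ball_subset_interior_closedBall (Metric.mem_ball_self hr)⟩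

theorem flatNorm_restrictBall_le {s : EuclideanSpace ℝ ι → V} (hs : ContDiff ℝ ∞ s) {r : ℝ}
    (hr : 0 < r) {n k : ℕ} {M : ℝ} (h : ∀ m ≤ n, ∀ x : EuclideanSpace ℝ ι, ‖x‖ ≤ r →
      ‖iteratedFDeriv ℝ m s x‖ ≤ M * ‖x‖ ^ k) :
    flatNorm n k r (restrictBall ι V r s) ≤ ENNReal.ofReal M := by
  refine iSup_le fun x => iSup_le fun m => iSup_le fun a => ?_
  rw [iteratedFDerivWithin_extend_restrictBall hs hr]
  refine ENNReal.div_le_of_le_mul ?_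
  have hx : ‖(x : EuclideanSpace ℝ ι)‖ ≤ r := mem_closedBall_zero_iff.mp x.2
  have h1 := h m (Nat.lt_succ_iff.mp m.2) x hx
  have h2 : ‖iteratedFDeriv ℝ m s x fun i => EuclideanSpace.single (a i) (1 : ℝ)‖
      ≤ ‖iteratedFDeriv ℝ m s x‖ := by
    refine (ContinuousMultilinearMap.le_opNorm _ _).trans_eq ?_
    simp
  have h3 : ‖(x : EuclideanSpace ℝ ι)‖ₑ ^ k = ENNReal.ofReal (‖(x : EuclideanSpace ℝ ι)‖ ^ k) := by
    rw [ENNReal.ofReal_pow (norm_nonneg _), ofReal_norm]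
  rw [h3, ← ENNReal.ofReal_mul' (by positivity), ← ofReal_norm]
  exact ENNReal.ofReal_le_ofReal (h2.trans h1)

theorem norm_iteratedFDeriv_le_flatNorm {s : EuclideanSpace ℝ ι → V}
    (hs : s ∈ flatSections (EuclideanSpace ℝ ι) V) {r : ℝ} (hr : 0 < r) {n k : ℕ}
    (hfin : flatNorm n k r (restrictBall ι V r s) ≠ ⊤) {m : ℕ} (hm : m ≤ n)
    {x : EuclideanSpace ℝ ι} (hx : ‖x‖ ≤ r) :
    ‖iteratedFDeriv ℝ m s x‖ ≤ (Fintype.card ι : ℝ) ^ m *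
      ((flatNorm n k r (restrictBall ι V r s)).toReal * ‖x‖ ^ k) := by
  refine norm_le_of_forall_single _ (by positivity) fun a => ?_
  -- At the origin the quotient in the flat norm carries no information; flatness gives the bound
  -- instead.
  rcases eq_or_ne x 0 with rfl | hx0
  · rw [hs.2]
    simp only [zero_apply, norm_zero]
    positivity
  have h1 : ‖iteratedFDeriv ℝ m s x fun i => EuclideanSpace.single (a i) (1 : ℝ)‖ₑ / ‖x‖ₑ ^ k ≤
      flatNorm n k r (restrictBall ι V r s) := by
    have hx' : x ∈ Metric.closedBall (0 : EuclideanSpace ℝ ι) r := by simpa using hx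
    have := iteratedFDerivWithin_extend_restrictBall hs.1 hr m ⟨x, hx'⟩
    rw [← this]
    refine le_iSup_of_le (⟨x, hx'⟩ : Metric.closedBall (0 : EuclideanSpace ℝ ι) r) ?_
    refine le_iSup_of_le (⟨m, Nat.lt_succ_of_le hm⟩ : Fin (n + 1)) ?_
    exact le_iSup_of_le a le_rfl
  have hxe : ‖x‖ₑ ^ k ≠ 0 := pow_ne_zero _ (by simpa using hx0)
  have hxt : ‖x‖ₑ ^ k ≠ ⊤ := ENNReal.pow_ne_top (by simp)
  rw [ENNReal.div_le_iff hxe hxt] at h1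
  have h2 := ENNReal.toReal_mono (ENNReal.mul_ne_top hfin hxt) h1
  simpa using h2

/-- Multiplication by a coefficient is pointwise, so it descends to restrictions. The bound combines
the Leibniz estimate for the coefficient with the trade of derivatives against vanishing order for
the section. -/
theorem propertySLB_of_hasPoleLE {𝒱 : Submodule ℝ (EuclideanSpace ℝ ι → V)}
    {𝒲 : Submodule ℝ (EuclideanSpace ℝ ι → W)}
    (h𝒱 : 𝒱 ≤ flatSections (EuclideanSpace ℝ ι) V) (ℓ : 𝒱 →ₗ[ℝ] 𝒲) {d : ℕ}
    {c : EuclideanSpace ℝ ι → V →L[ℝ] W} (hc : HasPoleLE d c)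
    (hℓ : ∀ (α : 𝒱) (x : EuclideanSpace ℝ ι),
      (ℓ α : EuclideanSpace ℝ ι → W) x = c x ((α : EuclideanSpace ℝ ι → V) x)) :
    PropertySLB ℓ 0 0 d := by
  have hℓ' : ∀ α : 𝒱, (ℓ α : EuclideanSpace ℝ ι → W) = fun x => c x (α.1 x) :=
    fun α => funext (hℓ α)
  let M (r : ℝ) : (Metric.closedBall (0 : EuclideanSpace ℝ ι) r → V) →ₗ[ℝ]
      (Metric.closedBall (0 : EuclideanSpace ℝ ι) r → W) :=
    { toFun := fun s x => c x (s x)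
      map_add' := fun s t => funext fun x => by simp
      map_smul' := fun a s => funext fun x => by simp }
  have hM : ∀ (r : ℝ) (α : 𝒱), M r (restrictBall ι V r α) = restrictBall ι W r (ℓ α) := by
    intro r α
    funext x
    exact (hℓ α x).symm
  refine ⟨fun r => (M r).restrict ?_, fun r _ α => hM r α, ?_⟩
  · rintro _ ⟨α, hα, rfl⟩
    rw [hM r ⟨α, hα⟩]
    exact Submodule.mem_map_of_mem (ℓ ⟨α, hα⟩).2
  choose C N hC hb using hc.norm_iteratedFDeriv_clm_apply_le
  -- The growth bound `(1 + ‖x‖) ^ N` makes the constant a polynomial in `|r|`, hence continuous;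
  -- the power of the dimension plus one converts partial derivatives into operator norms. The
  -- summand `1` keeps `B` positive, so that the estimate is also valid when the norm on the right
  -- is infinite.
  let B (n : ℕ) (r : ℝ) : ℝ :=
    1 + ∑ m ∈ Finset.range (n + 1), C m * (1 + |r|) ^ N m * (Fintype.card ι + 1 : ℝ) ^ n
  have hterm : ∀ (n m : ℕ) (r : ℝ),
      0 ≤ C m * (1 + |r|) ^ N m * (Fintype.card ι + 1 : ℝ) ^ n := fun n m r => by
    have := hC m
    positivity
  have hB : ∀ n r, 0 < B n r := fun n r =>
    add_pos_of_pos_of_nonneg one_pos (Finset.sum_nonneg fun m _ => hterm n m r)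
  refine ⟨fun n _ r => (B n r).toNNReal, fun n k => ?_, ?_⟩
  · refine Continuous.continuousOn (continuous_real_toNNReal.comp ?_)
    fun_prop
  rintro n k r hr ⟨_, α, hα, rfl⟩
  change flatNorm n k r (M r (restrictBall ι V r α)) ≤
    ((B n r).toNNReal : ℝ≥0∞) * flatNorm (n + 0) (k + 0 * n + d) r (restrictBall ι V r α)
  rw [hM r ⟨α, hα⟩, hℓ' ⟨α, hα⟩, zero_mul, add_zero, add_zero]
  have hflat := h𝒱 hα
  by_cases hfin : flatNorm n (k + d) r (restrictBall ι V r α) = ⊤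
  · rw [hfin, ENNReal.mul_top]
    · exact le_top
    · simpa using hB n r
  have hflat' := hc.clm_apply_mem_flatSections hflat
  set S := (flatNorm n (k + d) r (restrictBall ι V r α)).toReal with hS
  have hS0 : 0 ≤ S := ENNReal.toReal_nonneg
  refine (flatNorm_restrictBall_le (M := B n r * S) hflat'.1 hr ?_).trans_eq ?_
  · intro m hm x hx
    rcases eq_or_ne x 0 with rfl | hx0
    · rw [hflat'.2, norm_zero]
      have := hB n r
      positivity
    have hcard : (1 : ℝ) ≤ Fintype.card ι + 1 := by
      have : (0 : ℝ) ≤ Fintype.card ι := Nat.cast_nonneg _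
      linarith
    have h1 : ∀ y : EuclideanSpace ℝ ι, ‖y‖ ≤ r →
        ‖iteratedFDeriv ℝ m α y‖ ≤ (Fintype.card ι + 1 : ℝ) ^ n * S * ‖y‖ ^ (k + d) := by
      intro y hy
      refine (norm_iteratedFDeriv_le_flatNorm hflat hr hfin hm hy).trans ?_
      rw [← hS, ← mul_assoc]
      gcongr
      calc (Fintype.card ι : ℝ) ^ m ≤ (Fintype.card ι + 1 : ℝ) ^ m := by
            gcongr
            linarith
        _ ≤ _ := pow_le_pow_right₀ hcard hm
    have h2 := hb m x hx0 α hflat.1 ((Fintype.card ι + 1 : ℝ) ^ n * S) k fun i hi =>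
      norm_iteratedFDeriv_le_of_mem_flatSections hflat (r := r) i
        (by rwa [Nat.sub_add_cancel hi]) x hx
    refine h2.trans ?_
    have h3 : C m * (1 + ‖x‖) ^ N m * (Fintype.card ι + 1 : ℝ) ^ n ≤ B n r := by
      calc _ ≤ C m * (1 + |r|) ^ N m * (Fintype.card ι + 1 : ℝ) ^ n := by
            have := hC m
            have := hx.trans (le_abs_self r)
            gcongr
        _ ≤ ∑ m ∈ Finset.range (n + 1), C m * (1 + |r|) ^ N m * (Fintype.card ι + 1 : ℝ) ^ n :=
            Finset.single_le_sum
              (f := fun m => C m * (1 + |r|) ^ N m * (Fintype.card ι + 1 : ℝ) ^ n)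
              (fun m _ => hterm n m r) (Finset.mem_range.mpr (Nat.lt_succ_of_le hm))
        _ ≤ B n r := by simp [B]
    calc _ = C m * (1 + ‖x‖) ^ N m * (Fintype.card ι + 1 : ℝ) ^ n * S * ‖x‖ ^ k := by ring
      _ ≤ B n r * S * ‖x‖ ^ k := by gcongr
  · rw [ENNReal.ofReal_mul (hB n r).le, hS, ENNReal.ofReal_toReal hfin]
    rfl

end SLBCriterion

end FlatPoisson

end

noncomputable section

set_option maxSynthPendingDepth 3

namespace FlatPoisson

open ContinuousAlternatingMap (alternatizeUncurryFin alternatizeUncurryFinCLM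
  alternatizeUncurryFin_apply alternatizeUncurryFin_add alternatizeUncurryFin_smul curryLeftLI
  curryLeft_apply_apply curryLeft_add curryLeft_smul curryLeft_same
  curryLeft_compContinuousLinearMap compContinuousLinearMapCLM compContinuousLinearMap_apply
  alternatizeUncurryFin_alternatizeUncurryFinCLM_comp_of_symmetric)

/-! ### Exterior algebra -/

section Exterior

variable {E F : Type*} [NormedAddCommGroup E] [NormedSpace ℝ E]
  [NormedAddCommGroup F] [NormedSpace ℝ F] {n : ℕ}

/-- Interior multiplication as a bilinear map. -/
def interiorL (E : Type*) [NormedAddCommGroup E] [NormedSpace ℝ E] (n : ℕ) :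
    E →L[ℝ] (E [⋀^Fin (n + 1)]→L[ℝ] ℝ) →L[ℝ] E [⋀^Fin n]→L[ℝ] ℝ :=
  (curryLeftLI : (E [⋀^Fin (n + 1)]→L[ℝ] ℝ) →ₗᵢ[ℝ] _).toContinuousLinearMap.flip

@[simp]
theorem interiorL_apply (x : E) (η : E [⋀^Fin (n + 1)]→L[ℝ] ℝ) :
    interiorL E n x η = η.curryLeft x := rfl

/-- The exterior product with a form of degree one as a bilinear map. -/
def wedge1L (E : Type*) [NormedAddCommGroup E] [NormedSpace ℝ E] (n : ℕ) :
    (E →L[ℝ] ℝ) →L[ℝ] (E [⋀^Fin n]→L[ℝ] ℝ) →L[ℝ] E [⋀^Fin (n + 1)]→L[ℝ] ℝ :=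
  (ContinuousLinearMap.compL ℝ _ _ _ (alternatizeUncurryFinCLM ℝ E ℝ)) ∘L
    ContinuousLinearMap.smulRightL ℝ E (E [⋀^Fin n]→L[ℝ] ℝ)

@[simp]
theorem wedge1L_apply (a : E →L[ℝ] ℝ) (η : E [⋀^Fin n]→L[ℝ] ℝ) :
    wedge1L E n a η = wedge1 a η := rfl

/-- The total alternation of a bilinear map with values in alternating maps. -/
def alternatize₂ (f : E →L[ℝ] E →L[ℝ] E [⋀^Fin n]→L[ℝ] ℝ) : E [⋀^Fin (n + 2)]→L[ℝ] ℝ :=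
  alternatizeUncurryFin (alternatizeUncurryFinCLM ℝ E ℝ ∘L f)

/-- `alternatize₂` as a continuous linear map. -/
def alternatize₂CLM (E : Type*) [NormedAddCommGroup E] [NormedSpace ℝ E] (n : ℕ) :
    (E →L[ℝ] E →L[ℝ] E [⋀^Fin n]→L[ℝ] ℝ) →L[ℝ] E [⋀^Fin (n + 2)]→L[ℝ] ℝ :=
  alternatizeUncurryFinCLM ℝ E ℝ ∘L
    ContinuousLinearMap.compL ℝ _ _ _ (alternatizeUncurryFinCLM ℝ E ℝ)

theorem alternatize₂CLM_apply (f : E →L[ℝ] E →L[ℝ] E [⋀^Fin n]→L[ℝ] ℝ) :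
    alternatize₂CLM E n f = alternatize₂ f := rfl

theorem alternatize₂_add (f g : E →L[ℝ] E →L[ℝ] E [⋀^Fin n]→L[ℝ] ℝ) :
    alternatize₂ (f + g) = alternatize₂ f + alternatize₂ g := map_add (alternatize₂CLM E n) f g

theorem alternatize₂_neg (f : E →L[ℝ] E →L[ℝ] E [⋀^Fin n]→L[ℝ] ℝ) :
    alternatize₂ (-f) = -alternatize₂ f := map_neg (alternatize₂CLM E n) f

theorem alternatize₂_smul (c : ℝ) (f : E →L[ℝ] E →L[ℝ] E [⋀^Fin n]→L[ℝ] ℝ) :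
    alternatize₂ (c • f) = c • alternatize₂ f := map_smul (alternatize₂CLM E n) c f

theorem alternatize₂_sum {ι : Type*} (s : Finset ι)
    (f : ι → E →L[ℝ] E →L[ℝ] E [⋀^Fin n]→L[ℝ] ℝ) :
    alternatize₂ (∑ i ∈ s, f i) = ∑ i ∈ s, alternatize₂ (f i) :=
  map_sum (alternatize₂CLM E n) f s

theorem alternatize₂_of_symmetric {f : E →L[ℝ] E →L[ℝ] E [⋀^Fin n]→L[ℝ] ℝ}
    (hf : ∀ x y, f x y = f y x) : alternatize₂ f = 0 :=
  alternatizeUncurryFin_alternatizeUncurryFinCLM_comp_of_symmetric hf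

theorem alternatize₂_flip (f : E →L[ℝ] E →L[ℝ] E [⋀^Fin n]→L[ℝ] ℝ) :
    alternatize₂ f.flip = -alternatize₂ f := by
  rw [eq_neg_iff_add_eq_zero, ← alternatize₂_add]
  exact alternatize₂_of_symmetric fun x y => by simp [add_comm]

/-- `alternatize₂` only depends on the antisymmetric part. -/
theorem alternatize₂_congr {f g : E →L[ℝ] E →L[ℝ] E [⋀^Fin n]→L[ℝ] ℝ}
    (h : ∀ x y, f x y - f y x = g x y - g y x) : alternatize₂ f = alternatize₂ g := by
  have h1 := alternatize₂_flip f
  have h2 := alternatize₂_flip g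
  have h3 : f + -f.flip = g + -g.flip := by
    ext1 x
    ext1 y
    simpa [sub_eq_add_neg] using h x y
  have h4 := congrArg alternatize₂ h3
  rw [alternatize₂_add, alternatize₂_add, alternatize₂_neg, alternatize₂_neg, h1, h2, neg_neg,
    neg_neg, ← two_smul ℝ, ← two_smul ℝ] at h4
  exact smul_right_injective _ (two_ne_zero' ℝ) h4

theorem wedge2_eq (β : E [⋀^Fin 2]→L[ℝ] ℝ) (η : E [⋀^Fin n]→L[ℝ] ℝ) :
    wedge2 β η = (1 / 2 : ℝ) • alternatize₂ (bilinSMul β η) := rfl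

theorem alternatizeUncurryFin_neg (f : E →L[ℝ] E [⋀^Fin n]→L[ℝ] ℝ) :
    alternatizeUncurryFin (-f) = -alternatizeUncurryFin f :=
  map_neg (alternatizeUncurryFinCLM ℝ E ℝ) f

theorem alternatizeUncurryFin_sub (f g : E →L[ℝ] E [⋀^Fin n]→L[ℝ] ℝ) :
    alternatizeUncurryFin (f - g) = alternatizeUncurryFin f - alternatizeUncurryFin g :=
  map_sub (alternatizeUncurryFinCLM ℝ E ℝ) f g

theorem ext_curryLeft {η θ : E [⋀^Fin (n + 1)]→L[ℝ] ℝ} (h : ∀ x, η.curryLeft x = θ.curryLeft x) :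
    η = θ := by
  ext v
  have := congrArg (fun ζ => ζ (Fin.tail v)) (h (v 0))
  simp only [curryLeft_apply_apply] at this
  rwa [show Matrix.vecCons (v 0) (Fin.tail v) = v from Fin.cons_self_tail v] at this

/-- Polarization of the vanishing of a double contraction with `x + y`. -/
theorem curryLeft_curryLeft (η : E [⋀^Fin (n + 2)]→L[ℝ] ℝ) (x y : E) :
    (η.curryLeft x).curryLeft y = -(η.curryLeft y).curryLeft x := by
  have h := curryLeft_same η (x + y)
  simp only [map_add, curryLeft_add, add_apply, curryLeft_same, zero_add, add_zero] at h
  exact eq_neg_of_add_eq_zero_right (by simpa [add_comm] using h)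

theorem curryLeft_alternatizeUncurryFin_zero (f : E →L[ℝ] E [⋀^Fin 0]→L[ℝ] ℝ) (x : E) :
    (alternatizeUncurryFin f).curryLeft x = f x := by
  ext v
  simp only [curryLeft_apply_apply, alternatizeUncurryFin_apply]
  simp

/-- In the alternating sum, the term that feeds `x` to `f` gives `f x`; in all others `x` becomes
the first argument of a value of `f`, and the shift of the index produces the minus sign. Together
with `ext_curryLeft` this reduces identities between forms to induction on the degree. -/
theorem curryLeft_alternatizeUncurryFin (f : E →L[ℝ] E [⋀^Fin (n + 1)]→L[ℝ] ℝ) (x : E) :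
    (alternatizeUncurryFin f).curryLeft x =
      f x - alternatizeUncurryFin (interiorL E n x ∘L f) := by
  ext v
  simp only [curryLeft_apply_apply, alternatizeUncurryFin_apply, ContinuousAlternatingMap.sub_apply]
  rw [Fin.sum_univ_succ, sub_eq_add_neg, ← Finset.sum_neg_distrib]
  congr 1
  · simp
  · refine Finset.sum_congr rfl fun i _ => ?_
    simp only [Fin.val_succ, pow_succ, Matrix.cons_val_succ, ContinuousLinearMap.comp_apply,
      interiorL_apply, curryLeft_apply_apply]
    simp
    congr 1
    ext j
    refine Fin.cases ?_ (fun j => ?_) j <;> simp [Fin.removeNth]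

theorem curryLeft_wedge1_zero (a : E →L[ℝ] ℝ) (η : E [⋀^Fin 0]→L[ℝ] ℝ) (x : E) :
    (wedge1 a η).curryLeft x = a x • η := by
  rw [wedge1, curryLeft_alternatizeUncurryFin_zero]
  rfl

theorem curryLeft_wedge1 (a : E →L[ℝ] ℝ) (η : E [⋀^Fin (n + 1)]→L[ℝ] ℝ) (x : E) :
    (wedge1 a η).curryLeft x = a x • η - wedge1 a (η.curryLeft x) := by
  rw [wedge1, curryLeft_alternatizeUncurryFin, wedge1]
  congr 2

/-- Both sides are total alternations of tensor products, which differ by exchanging the first two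
arguments. -/
theorem wedge1_anticomm (a b : E →L[ℝ] ℝ) (η : E [⋀^Fin n]→L[ℝ] ℝ) :
    wedge1 a (wedge1 b η) = -wedge1 b (wedge1 a η) := by
  have key : ∀ a b : E →L[ℝ] ℝ, wedge1 a (wedge1 b η) =
      alternatize₂ (a.smulRight (b.smulRight η)) := by
    intro a b
    rw [wedge1, wedge1, alternatize₂]
    congr 1
    ext1 x
    simp
  rw [key, key, ← alternatize₂_flip]
  congr 1
  ext1 x
  ext1 y
  simp [smul_smul, mul_comm]

theorem wedge1_wedge1_self (a : E →L[ℝ] ℝ) (η : E [⋀^Fin n]→L[ℝ] ℝ) :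
    wedge1 a (wedge1 a η) = 0 := by
  have h := eq_neg_iff_add_eq_zero.mp (wedge1_anticomm a a η)
  rw [← two_smul ℝ] at h
  exact (smul_eq_zero.mp h).resolve_left two_ne_zero

/-- The antisymmetric part of `a ∧ b` is twice that of `a ⊗ b`, which cancels the factor `1 / 2` of
`wedge2`. This turns `φ ∧ η` into two successive products with one-forms. -/
theorem wedge2_wedge1_oneForm (a b : E →L[ℝ] ℝ) (η : E [⋀^Fin n]→L[ℝ] ℝ) :
    wedge2 (wedge1 a (oneForm b)) η = wedge1 a (wedge1 b η) := by
  have key : ∀ a b : E →L[ℝ] ℝ, wedge1 a (wedge1 b η) =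
      alternatize₂ (a.smulRight (b.smulRight η)) := by
    intro a b
    rw [wedge1, wedge1, alternatize₂]
    congr 1
    ext1 x
    simp
  rw [wedge2_eq, key, ← alternatize₂_smul]
  apply alternatize₂_congr
  intro x y
  have h : ∀ u v : E, wedge1 a (oneForm b) ![u, v] = a u * b v - a v * b u := by
    intro u v
    rw [wedge1_apply, Fin.sum_univ_two]
    simp [oneForm, Fin.removeNth]
    ring
  simp only [smul_apply, bilinSMul_apply, h, ContinuousLinearMap.smulRight_apply]
  module

theorem curryLeft_alternatize₂_zero (f : E →L[ℝ] E →L[ℝ] E [⋀^Fin 0]→L[ℝ] ℝ) (x : E) :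
    (alternatize₂ f).curryLeft x = alternatizeUncurryFin (f x) -
      alternatizeUncurryFin (f.flip x) := by
  rw [alternatize₂, curryLeft_alternatizeUncurryFin]
  have : interiorL E 0 x ∘L alternatizeUncurryFinCLM ℝ E ℝ ∘L f = f.flip x := by
    ext1 y
    simp [curryLeft_alternatizeUncurryFin_zero]
  rw [this]
  rfl

theorem curryLeft_alternatize₂ (f : E →L[ℝ] E →L[ℝ] E [⋀^Fin (n + 1)]→L[ℝ] ℝ) (x : E) :
    (alternatize₂ f).curryLeft x = alternatizeUncurryFin (f x) -
      alternatizeUncurryFin (f.flip x) +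
        alternatize₂ (ContinuousLinearMap.compL ℝ E _ _ (interiorL E n x) ∘L f) := by
  rw [alternatize₂, curryLeft_alternatizeUncurryFin]
  have : interiorL E (n + 1) x ∘L alternatizeUncurryFinCLM ℝ E ℝ ∘L f =
      f.flip x + -(alternatizeUncurryFinCLM ℝ E ℝ ∘L
        (ContinuousLinearMap.compL ℝ E _ _ (interiorL E n x) ∘L f)) := by
    ext1 y
    simp [curryLeft_alternatizeUncurryFin, sub_eq_add_neg]
  rw [this, alternatizeUncurryFin_add, alternatizeUncurryFin_neg, alternatize₂, sub_add_eq_sub_sub,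
    sub_neg_eq_add]
  rfl

theorem bilinSMul_flip (β : E [⋀^Fin 2]→L[ℝ] ℝ) (η : E [⋀^Fin n]→L[ℝ] ℝ) (x y : E) :
    bilinSMul β η x y = -bilinSMul β η y x := by
  have h : β ![x, y] = -β ![y, x] := by
    have := congrArg (fun ζ => ζ ![]) (curryLeft_curryLeft β x y)
    simpa [curryLeft_apply_apply] using this
  rw [bilinSMul_apply, bilinSMul_apply, h, neg_smul]

/-- The linear form `y ↦ β(x, y)`. -/
def contractLeft (β : E [⋀^Fin 2]→L[ℝ] ℝ) (x : E) : E →L[ℝ] ℝ :=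
  (ContinuousAlternatingMap.ofSubsingletonLIE (𝕜 := ℝ) (E := E) (F := ℝ)
      (0 : Fin 1)).symm (β.curryLeft x)

theorem contractLeft_apply (β : E [⋀^Fin 2]→L[ℝ] ℝ) (x y : E) :
    contractLeft β x y = β ![x, y] := by
  change β.curryLeft x (fun _ => y) = _
  rw [curryLeft_apply_apply]
  congr 1
  ext i
  fin_cases i <;> rfl

theorem alternatizeUncurryFin_bilinSMul (β : E [⋀^Fin 2]→L[ℝ] ℝ) (η : E [⋀^Fin n]→L[ℝ] ℝ) (x : E) :
    alternatizeUncurryFin (bilinSMul β η x) = wedge1 (contractLeft β x) η := by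
  rw [wedge1]
  congr 1

theorem alternatizeUncurryFin_bilinSMul_flip (β : E [⋀^Fin 2]→L[ℝ] ℝ) (η : E [⋀^Fin n]→L[ℝ] ℝ)
    (x : E) : alternatizeUncurryFin ((bilinSMul β η).flip x) = -wedge1 (contractLeft β x) η := by
  have : (bilinSMul β η).flip x = (-1 : ℝ) • bilinSMul β η x := by
    ext1 y
    simp [bilinSMul_flip β η y x]
  rw [this, alternatizeUncurryFin_smul, alternatizeUncurryFin_bilinSMul, neg_one_smul]

theorem curryLeft_wedge2_zero (β : E [⋀^Fin 2]→L[ℝ] ℝ) (η : E [⋀^Fin 0]→L[ℝ] ℝ) (x : E) :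
    (wedge2 β η).curryLeft x = wedge1 (contractLeft β x) η := by
  rw [wedge2_eq, curryLeft_smul, smul_apply,
    curryLeft_alternatize₂_zero, alternatizeUncurryFin_bilinSMul,
    alternatizeUncurryFin_bilinSMul_flip]
  module

/-- The two slots of `β` contribute equally, cancelling the factor `1 / 2`; passing `x` across the
even form `β` costs no sign. -/
theorem curryLeft_wedge2 (β : E [⋀^Fin 2]→L[ℝ] ℝ) (η : E [⋀^Fin (n + 1)]→L[ℝ] ℝ) (x : E) :
    (wedge2 β η).curryLeft x = wedge1 (contractLeft β x) η + wedge2 β (η.curryLeft x) := by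
  rw [wedge2_eq, curryLeft_smul, smul_apply,
    curryLeft_alternatize₂, alternatizeUncurryFin_bilinSMul,
    alternatizeUncurryFin_bilinSMul_flip, wedge2_eq]
  have : ContinuousLinearMap.compL ℝ E _ _ (interiorL E n x) ∘L bilinSMul β η =
      bilinSMul β (η.curryLeft x) := by
    ext1 u
    ext1 v
    simp [bilinSMul_apply]
  rw [this]
  module

theorem wedge1_add (a : E →L[ℝ] ℝ) (η θ : E [⋀^Fin n]→L[ℝ] ℝ) :
    wedge1 a (η + θ) = wedge1 a η + wedge1 a θ := map_add (wedge1L E n a) η θ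

theorem wedge1_sub (a : E →L[ℝ] ℝ) (η θ : E [⋀^Fin n]→L[ℝ] ℝ) :
    wedge1 a (η - θ) = wedge1 a η - wedge1 a θ := map_sub (wedge1L E n a) η θ

theorem wedge1_neg (a : E →L[ℝ] ℝ) (η : E [⋀^Fin n]→L[ℝ] ℝ) :
    wedge1 a (-η) = -wedge1 a η := map_neg (wedge1L E n a) η

theorem wedge1_zero (a : E →L[ℝ] ℝ) :
    wedge1 a (0 : E [⋀^Fin n]→L[ℝ] ℝ) = 0 := map_zero (wedge1L E n a)

theorem wedge2_zero (β : E [⋀^Fin 2]→L[ℝ] ℝ) : wedge2 β (0 : E [⋀^Fin n]→L[ℝ] ℝ) = 0 := by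
  simpa using wedge2_smul β 0 (0 : E [⋀^Fin n]→L[ℝ] ℝ)

theorem wedge2_neg (β : E [⋀^Fin 2]→L[ℝ] ℝ) (η : E [⋀^Fin n]→L[ℝ] ℝ) :
    wedge2 β (-η) = -wedge2 β η := by
  simpa using wedge2_smul β (-1) η

theorem wedge2_sub (β : E [⋀^Fin 2]→L[ℝ] ℝ) (η θ : E [⋀^Fin n]→L[ℝ] ℝ) :
    wedge2 β (η - θ) = wedge2 β η - wedge2 β θ := by
  rw [sub_eq_add_neg, wedge2_add, wedge2_neg, ← sub_eq_add_neg]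

/-- Induction on the degree: the contractions of both sides with every vector agree. This
commutation lets `γ_k ∧ ·` preserve the image of `φ ∧ ·`. -/
theorem wedge1_wedge2 (a : E →L[ℝ] ℝ) (β : E [⋀^Fin 2]→L[ℝ] ℝ) (η : E [⋀^Fin n]→L[ℝ] ℝ) :
    wedge1 a (wedge2 β η) = wedge2 β (wedge1 a η) := by
  induction n with
  | zero =>
    refine ext_curryLeft fun x => ?_
    rw [curryLeft_wedge1, curryLeft_wedge2, curryLeft_wedge2_zero, curryLeft_wedge1_zero,
      wedge2_smul, wedge1_anticomm]
    abel
  | succ n ih =>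
    refine ext_curryLeft fun x => ?_
    rw [curryLeft_wedge1, curryLeft_wedge2, curryLeft_wedge2, curryLeft_wedge1, wedge1_add, ih,
      wedge2_sub, wedge2_smul, wedge1_anticomm]
    abel

/-! ### Pullback -/

theorem comp_alternatizeUncurryFin (f : F →L[ℝ] F [⋀^Fin n]→L[ℝ] ℝ) (g : E →L[ℝ] F) :
    (alternatizeUncurryFin f).compContinuousLinearMap g =
      alternatizeUncurryFin (compContinuousLinearMapCLM g ∘L f ∘L g) := by
  ext v
  simp +unfoldPartialApp [alternatizeUncurryFin_apply, Fin.removeNth, Function.comp_def]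

theorem comp_wedge1 (a : F →L[ℝ] ℝ) (η : F [⋀^Fin n]→L[ℝ] ℝ) (g : E →L[ℝ] F) :
    (wedge1 a η).compContinuousLinearMap g = wedge1 (a ∘L g) (η.compContinuousLinearMap g) := by
  rw [wedge1, comp_alternatizeUncurryFin, wedge1]
  congr 1

theorem comp_alternatize₂ (f : F →L[ℝ] F →L[ℝ] F [⋀^Fin n]→L[ℝ] ℝ) (g : E →L[ℝ] F) :
    (alternatize₂ f).compContinuousLinearMap g =
      alternatize₂ (((ContinuousLinearMap.compL ℝ E F _).flip g ∘L
        ContinuousLinearMap.compL ℝ F _ _ (compContinuousLinearMapCLM g)) ∘L f ∘L g) := by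
  rw [alternatize₂, comp_alternatizeUncurryFin, alternatize₂]
  congr 1
  ext1 x
  simp [comp_alternatizeUncurryFin]
  rfl

theorem comp_wedge2 (β : F [⋀^Fin 2]→L[ℝ] ℝ) (η : F [⋀^Fin n]→L[ℝ] ℝ) (g : E →L[ℝ] F) :
    (wedge2 β η).compContinuousLinearMap g =
      wedge2 (β.compContinuousLinearMap g) (η.compContinuousLinearMap g) := by
  rw [wedge2_eq, wedge2_eq]
  change (1 / 2 : ℝ) • (alternatize₂ (bilinSMul β η)).compContinuousLinearMap g = _
  rw [comp_alternatize₂]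
  congr 2
  ext1 x
  ext1 y
  have h : (β.compContinuousLinearMap g) ![x, y] = β ![g x, g y] := by
    rw [compContinuousLinearMap_apply]
    congr 1
    ext i
    fin_cases i <;> rfl
  rw [bilinSMul_apply, h]
  change (bilinSMul β η (g x) (g y)).compContinuousLinearMap g = _
  rw [bilinSMul_apply]
  rfl

/-- A form annihilated by `x` does not notice multiples of `x` in its arguments, and its
contractions are again annihilated by `x`, so the induction continues. -/
theorem comp_eq_self_of_curryLeft_eq_zero {a : E →L[ℝ] ℝ} {x : E}
    (η : E [⋀^Fin (n + 1)]→L[ℝ] ℝ) (h : η.curryLeft x = 0) :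
    η.compContinuousLinearMap (ContinuousLinearMap.id ℝ E - a.smulRight x) = η := by
  induction n with
  | zero =>
    refine ext_curryLeft fun y => ?_
    rw [curryLeft_compContinuousLinearMap]
    simp only [sub_apply, ContinuousLinearMap.id_apply, ContinuousLinearMap.smulRight_apply,
      map_sub, map_smul, h, smul_zero, sub_zero]
    ext v
    rw [compContinuousLinearMap_apply]
    congr 1
    exact Subsingleton.elim _ _
  | succ n ih =>
    refine ext_curryLeft fun y => ?_
    rw [curryLeft_compContinuousLinearMap]
    simp only [sub_apply, ContinuousLinearMap.id_apply, ContinuousLinearMap.smulRight_apply,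
      map_sub, map_smul, h, smul_zero, sub_zero]
    refine ih _ ?_
    rw [curryLeft_curryLeft, h]
    simp

/-- The form `η - a ∧ i_x η` is annihilated by `x`, hence unchanged by the pullback, while the
pullback kills `a`. -/
theorem comp_id_sub_smulRight {a : E →L[ℝ] ℝ} {x : E} (hax : a x = 1)
    (η : E [⋀^Fin (n + 1)]→L[ℝ] ℝ) :
    η.compContinuousLinearMap (ContinuousLinearMap.id ℝ E - a.smulRight x) =
      η - wedge1 a (η.curryLeft x) := by
  have h0 : a ∘L (ContinuousLinearMap.id ℝ E - a.smulRight x) = 0 := by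
    ext y
    simp [hax]
  have h1 : (η - wedge1 a (η.curryLeft x)).curryLeft x = 0 := by
    have : (η - wedge1 a (η.curryLeft x)).curryLeft x =
      η.curryLeft x - (wedge1 a (η.curryLeft x)).curryLeft x := rfl
    rw [this]
    cases n with
    | zero => rw [curryLeft_wedge1_zero, hax, one_smul, sub_self]
    | succ n => rw [curryLeft_wedge1, hax, one_smul, curryLeft_same, wedge1_zero]; simp
  have h2 := comp_eq_self_of_curryLeft_eq_zero (a := a) _ h1
  have h3 : (η - wedge1 a (η.curryLeft x)).compContinuousLinearMap
      (ContinuousLinearMap.id ℝ E - a.smulRight x) = η.compContinuousLinearMap _ -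
        (wedge1 a (η.curryLeft x)).compContinuousLinearMap
          (ContinuousLinearMap.id ℝ E - a.smulRight x) := rfl
  rw [h3, comp_wedge1, h0] at h2
  have h4 : ∀ θ : E [⋀^Fin n]→L[ℝ] ℝ, wedge1 (0 : E →L[ℝ] ℝ) θ = 0 := fun θ => by
    rw [← wedge1L_apply, map_zero]
    rfl
  rw [h4, sub_zero] at h2
  exact h2

end Exterior

end FlatPoisson

end

noncomputable section

namespace FlatPoisson

set_option maxSynthPendingDepth 6

open ContinuousAlternatingMap (alternatizeUncurryFin alternatizeUncurryFinCLM
  alternatizeUncurryFin_apply alternatizeUncurryFin_add alternatizeUncurryFin_smul curryLeftLI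
  curryLeft_apply_apply curryLeft_add curryLeft_smul curryLeft_same
  curryLeft_compContinuousLinearMap compContinuousLinearMapCLM compContinuousLinearMap_apply
  alternatizeUncurryFin_alternatizeUncurryFinCLM_comp_of_symmetric)

/-! ### Iterated alternation -/

section Iterated

variable {E : Type*} [NormedAddCommGroup E] [NormedSpace ℝ E] {n : ℕ}

/-- The total alternation of a trilinear map with values in alternating maps. -/
def alternatize₃ (T : E →L[ℝ] E →L[ℝ] E →L[ℝ] E [⋀^Fin n]→L[ℝ] ℝ) : E [⋀^Fin (n + 3)]→L[ℝ] ℝ :=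
  alternatizeUncurryFin (alternatize₂CLM E n ∘L T)

theorem alternatize₃_eq (T : E →L[ℝ] E →L[ℝ] E →L[ℝ] E [⋀^Fin n]→L[ℝ] ℝ) :
    alternatize₃ T = alternatize₂
      (ContinuousLinearMap.compL ℝ E _ _ (alternatizeUncurryFinCLM ℝ E ℝ) ∘L T) := rfl

theorem alternatize₃_flip (T : E →L[ℝ] E →L[ℝ] E →L[ℝ] E [⋀^Fin n]→L[ℝ] ℝ) :
    alternatize₃ T.flip = -alternatize₃ T := by
  rw [alternatize₃_eq, alternatize₃_eq, ← alternatize₂_flip]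
  rfl

theorem alternatize₃_of_forall_eq_flip {T T' : E →L[ℝ] E →L[ℝ] E →L[ℝ] E [⋀^Fin n]→L[ℝ] ℝ}
    (h : ∀ x, T' x = (T x).flip) : alternatize₃ T' = -alternatize₃ T := by
  rw [alternatize₃, alternatize₃, ← alternatizeUncurryFin_neg]
  congr 1
  ext1 x
  simp [h, alternatize₂CLM_apply, alternatize₂_flip]

/-- Cyclic permutation of the arguments of a trilinear map. -/
def rotate₃ (T : E →L[ℝ] E →L[ℝ] E →L[ℝ] E [⋀^Fin n]→L[ℝ] ℝ) :
    E →L[ℝ] E →L[ℝ] E →L[ℝ] E [⋀^Fin n]→L[ℝ] ℝ :=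
  ((ContinuousLinearMap.flipₗᵢ ℝ E E (E [⋀^Fin n]→L[ℝ] ℝ)).toContinuousLinearEquiv :
    (E →L[ℝ] E →L[ℝ] E [⋀^Fin n]→L[ℝ] ℝ) →L[ℝ] _) ∘L T.flip

theorem alternatize₃_rotate₃ (T : E →L[ℝ] E →L[ℝ] E →L[ℝ] E [⋀^Fin n]→L[ℝ] ℝ) :
    alternatize₃ (rotate₃ T) = alternatize₃ T := by
  have h : ∀ x, rotate₃ T x = (T.flip x).flip := fun x => rfl
  rw [alternatize₃_of_forall_eq_flip h, alternatize₃_flip, neg_neg]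

/-- Cyclic permutations of three arguments are even, so three times the alternation of `T` is the
alternation of its cyclic sum. The Jacobi identity enters in this form. -/
theorem alternatize₃_eq_zero_of_cyclic {T : E →L[ℝ] E →L[ℝ] E →L[ℝ] E [⋀^Fin n]→L[ℝ] ℝ}
    (h : ∀ x y z, T x y z + T y z x + T z x y = 0) : alternatize₃ T = 0 := by
  have h1 : T + rotate₃ (rotate₃ T) + rotate₃ T = 0 := by
    ext1 x
    ext1 y
    ext1 z
    exact h x y z
  have h2 := congrArg (fun S => alternatizeUncurryFin (alternatize₂CLM E n ∘L S)) h1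
  simp only [ContinuousLinearMap.comp_add, alternatizeUncurryFin_add] at h2
  have h3 : alternatize₃ T + alternatize₃ (rotate₃ (rotate₃ T)) + alternatize₃ (rotate₃ T) = 0 := by
    refine h2.trans ?_
    rw [ContinuousLinearMap.comp_zero]
    exact map_zero (alternatizeUncurryFinCLM ℝ E ℝ)
  rw [alternatize₃_rotate₃, alternatize₃_rotate₃] at h3
  have h4 : (3 : ℝ) • alternatize₃ T = 0 := by
    rw [← h3]
    module
  exact (smul_eq_zero.mp h4).resolve_left three_ne_zero

/-- The total alternation of a map in four variables with values in alternating maps. -/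
def alternatize₄ (T : E →L[ℝ] E →L[ℝ] E →L[ℝ] E →L[ℝ] E [⋀^Fin n]→L[ℝ] ℝ) :
    E [⋀^Fin (n + 4)]→L[ℝ] ℝ :=
  alternatize₂ (ContinuousLinearMap.compL ℝ E _ _ (alternatize₂CLM E n) ∘L T)

theorem alternatize₄_flip (T : E →L[ℝ] E →L[ℝ] E →L[ℝ] E →L[ℝ] E [⋀^Fin n]→L[ℝ] ℝ) :
    alternatize₄ T.flip = -alternatize₄ T := by
  rw [alternatize₄, alternatize₄, ← alternatize₂_flip]
  rfl

theorem alternatize₄_of_forall_eq_rotate₃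
    {T T' : E →L[ℝ] E →L[ℝ] E →L[ℝ] E →L[ℝ] E [⋀^Fin n]→L[ℝ] ℝ}
    (h : ∀ x, T' x = rotate₃ (T x)) : alternatize₄ T' = alternatize₄ T := by
  rw [alternatize₄, alternatize₄, alternatize₂, alternatize₂]
  congr 1
  ext1 x
  change alternatize₃ (T' x) = alternatize₃ (T x)
  rw [h, alternatize₃_rotate₃]

/-- Cyclic permutation of the arguments of a map in four variables. -/
def rotate₄ (T : E →L[ℝ] E →L[ℝ] E →L[ℝ] E →L[ℝ] E [⋀^Fin n]→L[ℝ] ℝ) :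
    E →L[ℝ] E →L[ℝ] E →L[ℝ] E →L[ℝ] E [⋀^Fin n]→L[ℝ] ℝ :=
  (ContinuousLinearMap.compL ℝ E _ _
    ((ContinuousLinearMap.flipₗᵢ ℝ E E (E [⋀^Fin n]→L[ℝ] ℝ)).toContinuousLinearEquiv :
    (E →L[ℝ] E →L[ℝ] E [⋀^Fin n]→L[ℝ] ℝ) →L[ℝ] _)) ∘L
  ((ContinuousLinearMap.flipₗᵢ ℝ E E (E →L[ℝ] E [⋀^Fin n]→L[ℝ] ℝ)).toContinuousLinearEquiv :
    (E →L[ℝ] E →L[ℝ] E →L[ℝ] E [⋀^Fin n]→L[ℝ] ℝ) →L[ℝ] _) ∘L T.flip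

theorem alternatize₄_rotate₄ (T : E →L[ℝ] E →L[ℝ] E →L[ℝ] E →L[ℝ] E [⋀^Fin n]→L[ℝ] ℝ) :
    alternatize₄ (rotate₄ T) = -alternatize₄ T := by
  have h : ∀ x, rotate₄ T x = rotate₃ (T.flip x) := fun x => rfl
  rw [alternatize₄_of_forall_eq_rotate₃ h, alternatize₄_flip]

/-- Exchanging the first pair of arguments with the second is the square of a four-cycle, hence
even; a map that changes sign under it has zero alternation. This disposes of the terms of `d_P²`
containing two independent brackets. -/
theorem alternatize₄_eq_zero {T : E →L[ℝ] E →L[ℝ] E →L[ℝ] E →L[ℝ] E [⋀^Fin n]→L[ℝ] ℝ}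
    (h : ∀ x y z t, T z t x y = -T x y z t) : alternatize₄ T = 0 := by
  have h1 : rotate₄ (rotate₄ T) = -T := by
    ext1 x
    ext1 y
    ext1 z
    ext1 t
    exact h x y z t
  have h2 := congrArg alternatize₄ h1
  rw [alternatize₄_rotate₄, alternatize₄_rotate₄, neg_neg] at h2
  have h3 : alternatize₄ (-T) = -alternatize₄ T := by
    rw [alternatize₄, alternatize₄, ContinuousLinearMap.comp_neg, alternatize₂_neg]
  rw [h3, eq_neg_iff_add_eq_zero, ← two_smul ℝ] at h2
  exact (smul_eq_zero.mp h2).resolve_left two_ne_zero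

end Iterated

/-! ### Calculus of the Poisson differential -/

section PoissonCalculus

variable {H : Type*} [NormedAddCommGroup H] [NormedSpace ℝ H] {n : ℕ}

/-- The contraction `(ξ, η) ↦ i_{K(ξ, η)} w`, linear in `w`. -/
def contractBracket (n : ℕ) {D : Type*} [NormedAddCommGroup D] [NormedSpace ℝ D]
    (K : D →L[ℝ] D →L[ℝ] D) :
    (D [⋀^Fin (n + 1)]→L[ℝ] ℝ) →L[ℝ] D →L[ℝ] D →L[ℝ] D [⋀^Fin n]→L[ℝ] ℝ :=
  (ContinuousLinearMap.compL ℝ D _ _).flip K ∘L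
    (ContinuousLinearMap.compL ℝ D D (D [⋀^Fin n]→L[ℝ] ℝ)) ∘L
      (curryLeftLI : (D [⋀^Fin (n + 1)]→L[ℝ] ℝ) →ₗᵢ[ℝ] _).toContinuousLinearMap

theorem contractBracket_apply {D : Type*} [NormedAddCommGroup D] [NormedSpace ℝ D]
    (K : D →L[ℝ] D →L[ℝ] D) (w : D [⋀^Fin (n + 1)]→L[ℝ] ℝ) (ξ η : D) :
    contractBracket n K w ξ η = w.curryLeft (K ξ η) := rfl

theorem poissonDiff_zero_eq (P : H → (H →L[ℝ] ℝ) →L[ℝ] H) (w : H → MultiVec H 0) (x : H) :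
    poissonDiff P w x = alternatizeUncurryFin (fderiv ℝ w x ∘L P x) := rfl

theorem poissonDiff_succ_eq (P : H → (H →L[ℝ] ℝ) →L[ℝ] H) (w : H → MultiVec H (n + 1)) (x : H) :
    poissonDiff P w x = alternatizeUncurryFin (fderiv ℝ w x ∘L P x) -
      (1 / 2 : ℝ) • alternatize₂ (contractBracket n (koszulBracket P x) (w x)) := rfl

theorem fderiv_curryLeft {E : Type*} [NormedAddCommGroup E] [NormedSpace ℝ E]
    {w : H → E [⋀^Fin (n + 1)]→L[ℝ] ℝ} {α : H → E} {x : H} (hw : DifferentiableAt ℝ w x)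
    (hα : DifferentiableAt ℝ α x) (v : H) :
    fderiv ℝ (fun y => (w y).curryLeft (α y)) x v =
      (fderiv ℝ w x v).curryLeft (α x) + (w x).curryLeft (fderiv ℝ α x v) := by
  have := (interiorL E n).fderiv_of_bilinear hα hw
  have h := congrArg (fun L => L v) this
  exact h

/-! ### Pointwise algebra of the bracket terms in the Poisson differential -/

section BracketAlgebra

variable {D : Type*} [NormedAddCommGroup D] [NormedSpace ℝ D] {K : D →L[ℝ] D →L[ℝ] D}

theorem contractBracket_flip (hK : ∀ ξ η, K ξ η = -K η ξ)
    (w : D [⋀^Fin (n + 1)]→L[ℝ] ℝ) (ξ : D) :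
    (contractBracket n K w).flip ξ = -contractBracket n K w ξ := by
  ext1 η
  change w.curryLeft (K η ξ) = -w.curryLeft (K ξ η)
  rw [hK, map_neg]

theorem curryLeft_sub_alternatize₂_zero (hK : ∀ ξ η, K ξ η = -K η ξ)
    (A : D →L[ℝ] D [⋀^Fin 1]→L[ℝ] ℝ) (w : D [⋀^Fin 1]→L[ℝ] ℝ) (α : D) :
    (alternatizeUncurryFin A - (1 / 2 : ℝ) • alternatize₂ (contractBracket 0 K w)).curryLeft α =
      A α - alternatizeUncurryFin (interiorL D 0 α ∘L A + contractBracket 0 K w α) := by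
  rw [sub_eq_add_neg, ← neg_smul, curryLeft_add,
    curryLeft_smul, add_apply, smul_apply, curryLeft_alternatizeUncurryFin,
    curryLeft_alternatize₂_zero, contractBracket_flip hK, alternatizeUncurryFin_neg,
    alternatizeUncurryFin_add]
  module

theorem interiorL_comp_contractBracket (w : D [⋀^Fin (n + 2)]→L[ℝ] ℝ) (α : D) :
    ContinuousLinearMap.compL ℝ D _ _ (interiorL D n α) ∘L contractBracket (n + 1) K w =
        -contractBracket n K (w.curryLeft α) := by
  ext1 ξ
  ext1 η
  exact curryLeft_curryLeft w (K ξ η) α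

/-- Here `A` plays the role of the derivative of `w` along `P`. Antisymmetry of `K` makes its two
slots contribute equally, cancelling the factor `1 / 2`; what remains in parentheses has the shape
of the differential of `i_α w`. -/
theorem curryLeft_sub_alternatize₂ (hK : ∀ ξ η, K ξ η = -K η ξ)
    (A : D →L[ℝ] D [⋀^Fin (n + 2)]→L[ℝ] ℝ) (w : D [⋀^Fin (n + 2)]→L[ℝ] ℝ) (α : D) :
    (alternatizeUncurryFin A -
      (1 / 2 : ℝ) • alternatize₂ (contractBracket (n + 1) K w)).curryLeft α =
      A α - (alternatizeUncurryFin
        (interiorL D (n + 1) α ∘L A + contractBracket (n + 1) K w α) -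
          (1 / 2 : ℝ) • alternatize₂ (contractBracket n K (w.curryLeft α))) := by
  rw [sub_eq_add_neg, ← neg_smul, curryLeft_add,
    curryLeft_smul, add_apply, smul_apply, curryLeft_alternatizeUncurryFin,
    curryLeft_alternatize₂, contractBracket_flip hK, alternatizeUncurryFin_neg,
    alternatizeUncurryFin_add, interiorL_comp_contractBracket, alternatize₂_neg]
  module

theorem curryLeft_sub_alternatize₂_zero_eq_add (hK : ∀ ξ η, K ξ η = -K η ξ)
    (A : D →L[ℝ] D [⋀^Fin 1]→L[ℝ] ℝ) (w : D [⋀^Fin 1]→L[ℝ] ℝ) (α : D) :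
    (alternatizeUncurryFin A - (1 / 2 : ℝ) • alternatize₂ (contractBracket 0 K w)).curryLeft α =
      A α + -alternatizeUncurryFin (interiorL D 0 α ∘L A) +
        -alternatizeUncurryFin (contractBracket 0 K w α) := by
  rw [curryLeft_sub_alternatize₂_zero hK]
  have h := alternatizeUncurryFin_add (interiorL D 0 α ∘L A) (contractBracket 0 K w α)
  rw [h]
  module

theorem curryLeft_sub_alternatize₂_eq_add (hK : ∀ ξ η, K ξ η = -K η ξ)
    (A : D →L[ℝ] D [⋀^Fin (n + 2)]→L[ℝ] ℝ) (w : D [⋀^Fin (n + 2)]→L[ℝ] ℝ) (α : D) :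
    (alternatizeUncurryFin A -
      (1 / 2 : ℝ) • alternatize₂ (contractBracket (n + 1) K w)).curryLeft α =
      A α + -alternatizeUncurryFin (interiorL D (n + 1) α ∘L A) +
        -alternatizeUncurryFin (contractBracket (n + 1) K w α) +
          (1 / 2 : ℝ) • alternatize₂ (contractBracket n K (w.curryLeft α)) := by
  rw [curryLeft_sub_alternatize₂ hK]
  have h := alternatizeUncurryFin_add (interiorL D (n + 1) α ∘L A) (contractBracket (n + 1) K w α)
  rw [h]
  module

theorem alternatize₂_add_neg_add_neg_add_smul (f g h k : D →L[ℝ] D →L[ℝ] D [⋀^Fin n]→L[ℝ] ℝ)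
    (c : ℝ) : alternatize₂ (f + -g + -h + c • k) =
      alternatize₂ f - alternatize₂ g - alternatize₂ h + c • alternatize₂ k := by
  rw [alternatize₂_add, alternatize₂_add, alternatize₂_add, alternatize₂_neg, alternatize₂_neg,
    alternatize₂_smul, sub_eq_add_neg, sub_eq_add_neg]

theorem alternatize₃_jacobi (hK : ∀ ξ η ζ, K (K ξ η) ζ + K (K η ζ) ξ + K (K ζ ξ) η = 0)
    (w : D [⋀^Fin (n + 1)]→L[ℝ] ℝ) :
    alternatize₃ (ContinuousLinearMap.compL ℝ D _ _ (contractBracket n K w) ∘L K) = 0 := by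
  refine alternatize₃_eq_zero_of_cyclic fun ξ η ζ => ?_
  change w.curryLeft (K (K ξ η) ζ) + w.curryLeft (K (K η ζ) ξ) + w.curryLeft (K (K ζ ξ) η) = 0
  rw [← map_add, ← map_add, hK, map_zero]

theorem alternatize₂_contractBracket_zero (hK : ∀ ξ η, K ξ η = -K η ξ)
    (hJ : ∀ ξ η ζ, K (K ξ η) ζ + K (K η ζ) ξ + K (K ζ ξ) η = 0)
    (A : D →L[ℝ] D [⋀^Fin 1]→L[ℝ] ℝ) (w : D [⋀^Fin 1]→L[ℝ] ℝ) :
    alternatize₂ (contractBracket 1 K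
      (alternatizeUncurryFin A - (1 / 2 : ℝ) • alternatize₂ (contractBracket 0 K w))) =
    alternatize₂ (ContinuousLinearMap.compL ℝ D _ _ A ∘L K) -
      alternatize₃ (contractBracket 0 K ∘L A) := by
  have h : contractBracket 1 K
      (alternatizeUncurryFin A - (1 / 2 : ℝ) • alternatize₂ (contractBracket 0 K w)) =
      ContinuousLinearMap.compL ℝ D _ _ A ∘L K +
        -(ContinuousLinearMap.compL ℝ D _ _ (alternatizeUncurryFinCLM ℝ D ℝ) ∘L
          rotate₃ (contractBracket 0 K ∘L A)) +
        -(ContinuousLinearMap.compL ℝ D _ _ (alternatizeUncurryFinCLM ℝ D ℝ) ∘L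
          (ContinuousLinearMap.compL ℝ D _ _ (contractBracket 0 K w) ∘L K)) := by
    ext1 ξ
    ext1 η
    exact curryLeft_sub_alternatize₂_zero_eq_add hK A w (K ξ η)
  rw [h, alternatize₂_add, alternatize₂_add, alternatize₂_neg, alternatize₂_neg, ← alternatize₃_eq,
    ← alternatize₃_eq, alternatize₃_rotate₃, alternatize₃_jacobi hJ, neg_zero, add_zero,
    sub_eq_add_neg]

/-- Contracting the differential of `w` with `K ξ η` gives four terms. One differentiates along the
bracket, one is a cyclic rotation of `contractBracket (n + 1) K ∘L A`, one contains nested brackets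
and vanishes by Jacobi, and the one with two separate brackets vanishes by `alternatize₄_eq_zero`.
-/
theorem alternatize₂_contractBracket (hK : ∀ ξ η, K ξ η = -K η ξ)
    (hJ : ∀ ξ η ζ, K (K ξ η) ζ + K (K η ζ) ξ + K (K ζ ξ) η = 0)
    (A : D →L[ℝ] D [⋀^Fin (n + 2)]→L[ℝ] ℝ) (w : D [⋀^Fin (n + 2)]→L[ℝ] ℝ) :
    alternatize₂ (contractBracket (n + 2) K
      (alternatizeUncurryFin A - (1 / 2 : ℝ) • alternatize₂ (contractBracket (n + 1) K w))) =
    alternatize₂ (ContinuousLinearMap.compL ℝ D _ _ A ∘L K) -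
      alternatize₃ (contractBracket (n + 1) K ∘L A) := by
  let S : D →L[ℝ] D →L[ℝ] D →L[ℝ] D →L[ℝ] D [⋀^Fin n]→L[ℝ] ℝ :=
    ContinuousLinearMap.compL ℝ D _ _ (contractBracket n K ∘L w.curryLeft) ∘L K
  have hS : alternatize₂ (ContinuousLinearMap.compL ℝ D _ _ (alternatize₂CLM D n) ∘L S) = 0 :=
    alternatize₄_eq_zero (T := S) fun x y z t => curryLeft_curryLeft w (K z t) (K x y)
  have h : contractBracket (n + 2) K
      (alternatizeUncurryFin A - (1 / 2 : ℝ) • alternatize₂ (contractBracket (n + 1) K w)) =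
      ContinuousLinearMap.compL ℝ D _ _ A ∘L K +
        -(ContinuousLinearMap.compL ℝ D _ _ (alternatizeUncurryFinCLM ℝ D ℝ) ∘L
          rotate₃ (contractBracket (n + 1) K ∘L A)) +
        -(ContinuousLinearMap.compL ℝ D _ _ (alternatizeUncurryFinCLM ℝ D ℝ) ∘L
          (ContinuousLinearMap.compL ℝ D _ _ (contractBracket (n + 1) K w) ∘L K)) +
        (1 / 2 : ℝ) • (ContinuousLinearMap.compL ℝ D _ _ (alternatize₂CLM D n) ∘L S) := by
    ext1 ξ
    ext1 η
    exact curryLeft_sub_alternatize₂_eq_add hK A w (K ξ η)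
  rw [h, alternatize₂_add_neg_add_neg_add_smul, hS, ← alternatize₃_eq, ← alternatize₃_eq,
    alternatize₃_rotate₃, alternatize₃_jacobi hJ, smul_zero, add_zero, sub_zero]

end BracketAlgebra

/-! ### Contraction with covector fields annihilated by the Poisson structure -/

section Casimir

variable {P : H → (H →L[ℝ] ℝ) →L[ℝ] H} {α : H → H →L[ℝ] ℝ} {x : H}

theorem curryLeft_poissonDiff_zero (hPα : P x (α x) = 0) (w : H → MultiVec H 0) :
    (poissonDiff P w x).curryLeft (α x) = 0 := by
  rw [poissonDiff_zero_eq, curryLeft_alternatizeUncurryFin_zero, ContinuousLinearMap.comp_apply,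
    hPα, map_zero]

/-- The product rule, with the derivative of `α` along `P ξ` rewritten as the bracket of `α` and
`ξ`. -/
theorem fderiv_curryLeft_comp (hα : ∀ ξ, koszulBracket P x (α x) ξ = fderiv ℝ α x (P x ξ))
    {w : H → MultiVec H (n + 1)} (hw : DifferentiableAt ℝ w x) (hαd : DifferentiableAt ℝ α x) :
    fderiv ℝ (fun y => (w y).curryLeft (α y)) x ∘L P x =
      interiorL _ n (α x) ∘L (fderiv ℝ w x ∘L P x) +
        contractBracket n (koszulBracket P x) (w x) (α x) := by
  ext1 ξ
  refine (fderiv_curryLeft hw hαd (P x ξ)).trans ?_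
  rw [← hα]
  rfl

theorem curryLeft_poissonDiff_one (hPα : P x (α x) = 0)
    (hK : ∀ ξ η, koszulBracket P x ξ η = -koszulBracket P x η ξ)
    (hα : ∀ ξ, koszulBracket P x (α x) ξ = fderiv ℝ α x (P x ξ))
    {w : H → MultiVec H 1} (hw : DifferentiableAt ℝ w x) (hαd : DifferentiableAt ℝ α x) :
    (poissonDiff P w x).curryLeft (α x) =
      -poissonDiff P (fun y => (w y).curryLeft (α y)) x := by
  rw [poissonDiff_zero_eq, fderiv_curryLeft_comp hα hw hαd, poissonDiff_succ_eq,
    curryLeft_sub_alternatize₂_zero hK, ContinuousLinearMap.comp_apply, hPα, map_zero, zero_sub]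

/-- A Cartan formula in which the Lie derivative drops out: the derivative in the direction `P α`
vanishes, and the bracket terms with `α` are absorbed by differentiating `α` in `i_α w`. -/
theorem curryLeft_poissonDiff (hPα : P x (α x) = 0)
    (hK : ∀ ξ η, koszulBracket P x ξ η = -koszulBracket P x η ξ)
    (hα : ∀ ξ, koszulBracket P x (α x) ξ = fderiv ℝ α x (P x ξ))
    {w : H → MultiVec H (n + 2)} (hw : DifferentiableAt ℝ w x) (hαd : DifferentiableAt ℝ α x) :
    (poissonDiff P w x).curryLeft (α x) =
      -poissonDiff P (fun y => (w y).curryLeft (α y)) x := by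
  rw [poissonDiff_succ_eq, poissonDiff_succ_eq, fderiv_curryLeft_comp hα hw hαd,
    curryLeft_sub_alternatize₂ hK, ContinuousLinearMap.comp_apply, hPα, map_zero, zero_sub]

end Casimir

/-! ### The square of the differential of a linear Poisson structure -/

section Square

variable {L : H →L[ℝ] (H →L[ℝ] ℝ) →L[ℝ] H} {K : (H →L[ℝ] ℝ) →L[ℝ] (H →L[ℝ] ℝ) →L[ℝ] H →L[ℝ] ℝ}

theorem fderiv_fderiv_comp_clm (L : H →L[ℝ] (H →L[ℝ] ℝ) →L[ℝ] H) {w : H → MultiVec H n}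
    (hw : ContDiff ℝ ∞ w) (x v : H) :
    fderiv ℝ (fun y => fderiv ℝ w y ∘L L y) x v =
      fderiv ℝ (fderiv ℝ w) x v ∘L L x + fderiv ℝ w x ∘L L v := by
  have h1 : DifferentiableAt ℝ (fderiv ℝ w) x :=
    ((hw.fderiv_right (m := ∞) (by simp)).differentiable (by simp)) x
  have := (ContinuousLinearMap.compL ℝ (H →L[ℝ] ℝ) H (MultiVec H n)).fderiv_of_bilinear h1
    (L.differentiableAt (x := x))
  have h := congrArg (fun L => L v) this
  rw [ContinuousLinearMap.fderiv] at h
  refine h.trans ?_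
  rw [add_comm]
  rfl

/-- Second derivatives of `w` are symmetric and cancel under alternation. The surviving
antisymmetric part is the commutator of Hamiltonian vector fields, which by `hK1` is the Hamiltonian
vector field of the bracket. -/
theorem alternatize₂_hessian (hK1 : ∀ x ξ η, L (L x ξ) η - L (L x η) ξ = L x (K ξ η))
    (hK : ∀ ξ η, K ξ η = -K η ξ)
    {w : H → MultiVec H n} (hw : ContDiff ℝ ∞ w) (x : H)
    {G F : (H →L[ℝ] ℝ) →L[ℝ] (H →L[ℝ] ℝ) →L[ℝ] MultiVec H n}
    (hG : ∀ ξ η, G ξ η = fderiv ℝ (fderiv ℝ w) x (L x ξ) (L x η) + fderiv ℝ w x (L (L x ξ) η))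
    (hF : ∀ ξ η, F ξ η = fderiv ℝ w x (L x (K ξ η))) :
    alternatize₂ G = (1 / 2 : ℝ) • alternatize₂ F := by
  rw [← alternatize₂_smul]
  apply alternatize₂_congr
  intro ξ η
  have hsymm := (hw.contDiffAt (x := x)).isSymmSndFDerivAt
    (by simpa using WithTop.coe_le_coe.mpr (le_top : (2 : ℕ∞) ≤ ⊤))
  have h2 : F η ξ = -F ξ η := by rw [hF, hF, hK, map_neg, map_neg]
  have h3 : fderiv ℝ w x (L (L x ξ) η) - fderiv ℝ w x (L (L x η) ξ) = F ξ η := by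
    rw [hF, ← hK1, map_sub]
  simp only [smul_apply, h2, hG, hsymm (L x ξ) (L x η)]
  rw [← h3]
  module

theorem poissonDiff_contDiff (L : H →L[ℝ] (H →L[ℝ] ℝ) →L[ℝ] H) {w : H → MultiVec H n}
    (hw : ContDiff ℝ ∞ w) : ContDiff ℝ ∞ fun y => fderiv ℝ w y ∘L L y :=
  (hw.fderiv_right (by simp)).clm_comp L.contDiff

theorem koszulBracket_clm (L : H →L[ℝ] (H →L[ℝ] ℝ) →L[ℝ] H) (x y : H) :
    koszulBracket L x = koszulBracket L y := by
  rw [koszulBracket, koszulBracket, ContinuousLinearMap.fderiv, ContinuousLinearMap.fderiv]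

theorem poissonDiff_poissonDiff_zero (hLK : ∀ x, koszulBracket L x = K)
    (hK1 : ∀ x ξ η, L (L x ξ) η - L (L x η) ξ = L x (K ξ η)) (hK : ∀ ξ η, K ξ η = -K η ξ)
    {w : H → MultiVec H 0} (hw : ContDiff ℝ ∞ w) (x : H) :
    poissonDiff L (poissonDiff L w) x = 0 := by
  have h1 : ∀ v, fderiv ℝ (poissonDiff L w) x v = alternatizeUncurryFin
      (fderiv ℝ (fderiv ℝ w) x v ∘L L x + fderiv ℝ w x ∘L L v) := by
    intro v
    have := (alternatizeUncurryFinCLM ℝ (H →L[ℝ] ℝ) ℝ (n := 0)).hasFDerivAt.comp x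
      ((poissonDiff_contDiff L hw).differentiable (by simp) x).hasFDerivAt
    have h := congrArg (fun L => L v) this.fderiv
    refine h.trans ?_
    rw [ContinuousLinearMap.comp_apply, fderiv_fderiv_comp_clm L hw]
    rfl
  let G : (H →L[ℝ] ℝ) →L[ℝ] (H →L[ℝ] ℝ) →L[ℝ] MultiVec H 0 :=
    ((ContinuousLinearMap.compL ℝ _ _ _).flip (L x) ∘L fderiv ℝ (fderiv ℝ w) x +
      ContinuousLinearMap.compL ℝ _ _ _ (fderiv ℝ w x) ∘L L) ∘L L x
  rw [poissonDiff_succ_eq, hLK, ← alternatize₂_hessian hK1 hK hw x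
    (F := contractBracket 0 K (poissonDiff L w x)) (G := G) (fun ξ η => rfl), sub_eq_zero,
    alternatize₂]
  · congr 1
    ext1 ξ
    rw [ContinuousLinearMap.comp_apply, h1]
    rfl
  · intro ξ η
    rw [contractBracket_apply, poissonDiff_zero_eq, curryLeft_alternatizeUncurryFin_zero]
    rfl

theorem fderiv_poissonDiff_succ (hLK : ∀ x, koszulBracket L x = K)
    {w : H → MultiVec H (n + 1)} (hw : ContDiff ℝ ∞ w) (x v : H) :
    fderiv ℝ (poissonDiff L w) x v = alternatizeUncurryFin
      (fderiv ℝ (fderiv ℝ w) x v ∘L L x + fderiv ℝ w x ∘L L v) -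
        (1 / 2 : ℝ) • alternatize₂ (contractBracket n K (fderiv ℝ w x v)) := by
  have h0 : poissonDiff L w = fun y => alternatizeUncurryFinCLM ℝ (H →L[ℝ] ℝ) ℝ
      (fderiv ℝ w y ∘L L y) - ((1 / 2 : ℝ) • (alternatize₂CLM _ n ∘L contractBracket n K)) (w y) := by
    funext y
    rw [poissonDiff_succ_eq, hLK]
    rfl
  have h1 := (alternatizeUncurryFinCLM ℝ (H →L[ℝ] ℝ) ℝ (n := n + 1)).hasFDerivAt.comp x
      ((poissonDiff_contDiff L hw).differentiable (by simp) x).hasFDerivAt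
  have h2 := ((1 / 2 : ℝ) • (alternatize₂CLM _ n ∘L contractBracket n K)).hasFDerivAt.comp x
      (hw.differentiable (by simp) x).hasFDerivAt
  have h := congrArg (fun L => L v) (h1.sub h2).fderiv
  rw [h0]
  refine h.trans ?_
  rw [sub_apply, ContinuousLinearMap.comp_apply, fderiv_fderiv_comp_clm L hw]
  rfl

theorem alternatizeUncurryFin_fderiv_poissonDiff (hLK : ∀ x, koszulBracket L x = K)
    (hK1 : ∀ x ξ η, L (L x ξ) η - L (L x η) ξ = L x (K ξ η)) (hK : ∀ ξ η, K ξ η = -K η ξ)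
    {w : H → MultiVec H (n + 1)} (hw : ContDiff ℝ ∞ w) (x : H) :
    alternatizeUncurryFin (fderiv ℝ (poissonDiff L w) x ∘L L x) =
      (1 / 2 : ℝ) • (alternatize₂ (ContinuousLinearMap.compL ℝ _ _ _ (fderiv ℝ w x ∘L L x) ∘L K) -
        alternatize₃ (contractBracket n K ∘L fderiv ℝ w x ∘L L x)) := by
  let G : (H →L[ℝ] ℝ) →L[ℝ] (H →L[ℝ] ℝ) →L[ℝ] MultiVec H (n + 1) :=
    ((ContinuousLinearMap.compL ℝ _ _ _).flip (L x) ∘L fderiv ℝ (fderiv ℝ w) x +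
      ContinuousLinearMap.compL ℝ _ _ _ (fderiv ℝ w x) ∘L L) ∘L L x
  rw [smul_sub, ← alternatize₂_hessian hK1 hK hw x
    (F := ContinuousLinearMap.compL ℝ _ _ _ (fderiv ℝ w x ∘L L x) ∘L K) (G := G)
    (fun ξ η => rfl) (fun ξ η => rfl), alternatize₃, ← alternatizeUncurryFin_smul, alternatize₂,
    ← alternatizeUncurryFin_sub]
  congr 1
  ext1 ξ
  rw [ContinuousLinearMap.comp_apply, fderiv_poissonDiff_succ hLK hw]
  rfl

/-- The derivative part and the bracket part of the outer differential both produce half of the same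
difference, so they cancel. The low degrees are separate because fewer contractions of `w` are
available there. -/
theorem poissonDiff_poissonDiff (hLK : ∀ x, koszulBracket L x = K)
    (hK1 : ∀ x ξ η, L (L x ξ) η - L (L x η) ξ = L x (K ξ η)) (hK : ∀ ξ η, K ξ η = -K η ξ)
    (hK2 : ∀ ξ η ζ, K (K ξ η) ζ + K (K η ζ) ξ + K (K ζ ξ) η = 0)
    {w : H → MultiVec H n} (hw : ContDiff ℝ ∞ w) (x : H) :
    poissonDiff L (poissonDiff L w) x = 0 := by
  match n, w with
  | 0, w => exact poissonDiff_poissonDiff_zero hLK hK1 hK hw x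
  | 1, w =>
    rw [poissonDiff_succ_eq, alternatizeUncurryFin_fderiv_poissonDiff hLK hK1 hK hw, hLK,
      poissonDiff_succ_eq, hLK, alternatize₂_contractBracket_zero hK hK2, sub_self]
  | n + 2, w =>
    rw [poissonDiff_succ_eq, alternatizeUncurryFin_fderiv_poissonDiff hLK hK1 hK hw, hLK,
      poissonDiff_succ_eq, hLK, alternatize₂_contractBracket hK hK2, sub_self]

end Square

end PoissonCalculus

end FlatPoisson

end

open scoped Topology

noncomputable section

namespace FlatPoisson

set_option maxSynthPendingDepth 6

open ContinuousAlternatingMap (alternatizeUncurryFin alternatizeUncurryFinCLM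
  alternatizeUncurryFin_apply alternatizeUncurryFin_add alternatizeUncurryFin_smul
  compContinuousLinearMapCLM compContinuousLinearMap_apply
  fderivCompContinuousLinearMap_eq_alternatizeUncurryFin
  fderivCompContinuousLinearMap_of_isEmpty)

/-! ### Pullback along a field of linear maps -/

section PullbackField

variable {H D : Type*} [NormedAddCommGroup H] [NormedSpace ℝ H] [NormedAddCommGroup D]
  [NormedSpace ℝ D] {n : ℕ}

theorem extDeriv_comp_zero {w : H → D [⋀^Fin 0]→L[ℝ] ℝ} {W : H → H →L[ℝ] D} {u : H}
    (hw : DifferentiableAt ℝ w u) (hW : DifferentiableAt ℝ W u) :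
    extDeriv (fun y => (w y).compContinuousLinearMap (W y)) u =
      alternatizeUncurryFin (compContinuousLinearMapCLM (W u) ∘L fderiv ℝ w u) := by
  rw [extDeriv, fderiv_continuousAlternatingMapCompContinuousLinearMap hw hW,
    fderivCompContinuousLinearMap_of_isEmpty]
  simp

theorem extDeriv_comp_succ {w : H → D [⋀^Fin (n + 1)]→L[ℝ] ℝ} {W : H → H →L[ℝ] D} {u : H}
    (hw : DifferentiableAt ℝ w u) (hW : DifferentiableAt ℝ W u) :
    extDeriv (fun y => (w y).compContinuousLinearMap (W y)) u =
      alternatizeUncurryFin (compContinuousLinearMapCLM (W u) ∘L fderiv ℝ w u) +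
        alternatize₂ (ContinuousLinearMap.compL ℝ H _ _
          (compContinuousLinearMapCLM (W u) ∘L (w u).curryLeft) ∘L fderiv ℝ W u) := by
  rw [extDeriv, fderiv_continuousAlternatingMapCompContinuousLinearMap hw hW,
    alternatizeUncurryFin_add, fderivCompContinuousLinearMap_eq_alternatizeUncurryFin]
  rfl

/-! ### Pointwise comparison of alternations before and after pullback -/

section Algebra

variable {A : H →L[ℝ] D [⋀^Fin n]→L[ℝ] ℝ} {g : H →L[ℝ] D} {Q : H →L[ℝ] H}

theorem comp_alternatizeUncurryFin_comp (hgQ : g ∘L Q = g) (R : D →L[ℝ] H) (hR : R ∘L g = Q) :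
    (alternatizeUncurryFin (compContinuousLinearMapCLM g ∘L A)).compContinuousLinearMap Q =
      (alternatizeUncurryFin (A ∘L R)).compContinuousLinearMap g := by
  rw [comp_alternatizeUncurryFin, comp_alternatizeUncurryFin]
  congr 1
  ext1 v
  have h : ∀ η : D [⋀^Fin n]→L[ℝ] ℝ, (η.compContinuousLinearMap g).compContinuousLinearMap Q =
      η.compContinuousLinearMap g := fun η => by
    conv_rhs => rw [← hgQ]
    rfl
  refine (h _).trans ?_
  rw [← hR]
  rfl

/-- For `g = W u` and `B` the derivative of `W`, the hypothesis `h` says that the antisymmetrized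
derivative along the leaves cancels the bracket up to multiples of the transverse covectors `α k`.
Comparing antisymmetric parts turns these multiples into wedge products with `γ k`. -/
theorem comp_alternatize₂_add_eq {ι : Type*} [Fintype ι] (hgQ : g ∘L Q = g)
    {B : H →L[ℝ] H →L[ℝ] D}
    {K : D →L[ℝ] D →L[ℝ] D} (hK : ∀ ξ η, K ξ η = -K η ξ)
    {γ : ι → H [⋀^Fin 2]→L[ℝ] ℝ} {α : ι → D}
    (h : ∀ v x, B (Q v) (Q x) - B (Q x) (Q v) + K (g v) (g x) =
      ∑ k, γ k ![Q v, Q x] • α k) (w : D [⋀^Fin (n + 1)]→L[ℝ] ℝ) :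
    (alternatize₂ (ContinuousLinearMap.compL ℝ H _ _
      (compContinuousLinearMapCLM g ∘L w.curryLeft) ∘L B)).compContinuousLinearMap Q =
      -((1 / 2 : ℝ) • alternatize₂ (contractBracket n K w)).compContinuousLinearMap g +
        ∑ k, wedge2 ((γ k).compContinuousLinearMap Q)
          ((w.curryLeft (α k)).compContinuousLinearMap g) := by
  rw [eq_neg_add_iff_add_eq]
  change (1 / 2 : ℝ) • (alternatize₂ (contractBracket n K w)).compContinuousLinearMap g + _ = _
  simp only [wedge2_eq]
  rw [← Finset.smul_sum, ← alternatize₂_sum, ← alternatize₂_smul, comp_alternatize₂,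
    comp_alternatize₂, ← alternatize₂_smul, ← alternatize₂_add]
  apply alternatize₂_congr
  intro v x
  have hγ : ∀ k v x, ((γ k).compContinuousLinearMap Q) ![v, x] = γ k ![Q v, Q x] := by
    intro k v x
    rw [compContinuousLinearMap_apply]
    congr 1
    ext i
    fin_cases i <;> rfl
  have hγ' : ∀ k, γ k ![Q x, Q v] = -γ k ![Q v, Q x] := by
    intro k
    have h := (γ k).toAlternatingMap.map_swap ![Q v, Q x] (i := 0) (j := 1) (by decide)
    have h2 : (![Q v, Q x] ∘ Equiv.swap (0 : Fin 2) 1) = ![Q x, Q v] := by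
      ext i
      fin_cases i <;> rfl
    rw [h2] at h
    exact h
  have hpull : ∀ η : D [⋀^Fin n]→L[ℝ] ℝ, (η.compContinuousLinearMap g).compContinuousLinearMap Q =
      η.compContinuousLinearMap g := fun η => by
    conv_rhs => rw [← hgQ]
    rfl
  let M : D →L[ℝ] H [⋀^Fin n]→L[ℝ] ℝ := compContinuousLinearMapCLM g ∘L w.curryLeft
  have hT : ∀ v x, (M (B (Q v) (Q x))).compContinuousLinearMap Q = M (B (Q v) (Q x)) :=
    fun v x => hpull _
  have hM := congrArg M (h v x)
  rw [map_add, map_sub, map_sum] at hM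
  simp only [map_smul] at hM
  have hS : ∀ v x, (∑ k, bilinSMul ((γ k).compContinuousLinearMap Q)
      ((w.curryLeft (α k)).compContinuousLinearMap g)) v x = ∑ k, γ k ![Q v, Q x] • M (α k) := by
    intro v x
    rw [sum_apply, sum_apply]
    refine Finset.sum_congr rfl fun k _ => ?_
    rw [bilinSMul_apply, hγ]
    rfl
  change (1 / 2 : ℝ) • M (K (g v) (g x)) + (M (B (Q v) (Q x))).compContinuousLinearMap Q -
    ((1 / 2 : ℝ) • M (K (g x) (g v)) + (M (B (Q x) (Q v))).compContinuousLinearMap Q) =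
      (1 / 2 : ℝ) • (∑ k, bilinSMul ((γ k).compContinuousLinearMap Q)
        ((w.curryLeft (α k)).compContinuousLinearMap g)) v x -
      (1 / 2 : ℝ) • (∑ k, bilinSMul ((γ k).compContinuousLinearMap Q)
        ((w.curryLeft (α k)).compContinuousLinearMap g)) x v
  rw [hS, hS, hT, hT, hK (g x) (g v), map_neg]
  simp only [hγ', neg_smul, Finset.sum_neg_distrib]
  rw [← hM]
  module

end Algebra

variable {P : H → (H →L[ℝ] ℝ) →L[ℝ] H} {W : H → H →L[ℝ] H →L[ℝ] ℝ} {Q : H →L[ℝ] H} {u : H}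

theorem comp_extDeriv_zero {w : H → MultiVec H 0} (hw : DifferentiableAt ℝ w u)
    (hW : DifferentiableAt ℝ W u) (hPW : P u ∘L W u = Q) (hWQ : W u ∘L Q = W u) :
    (extDeriv (fun y => (w y).compContinuousLinearMap (W y)) u).compContinuousLinearMap Q =
      (poissonDiff P w u).compContinuousLinearMap (W u) := by
  rw [extDeriv_comp_zero hw hW, poissonDiff_zero_eq]
  exact comp_alternatizeUncurryFin_comp hWQ (P u) hPW

/-- The derivative falling on `w` gives the principal part of `d_P w`, since `P ∘ W = Q`; the
derivative falling on `W` gives its bracket part and the correction terms with `γ k`. -/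
theorem comp_extDeriv_succ {ι : Type*} [Fintype ι] {w : H → MultiVec H (n + 1)}
    (hw : DifferentiableAt ℝ w u) (hW : DifferentiableAt ℝ W u) (hPW : P u ∘L W u = Q)
    (hWQ : W u ∘L Q = W u) (hK : ∀ ξ η, koszulBracket P u ξ η = -koszulBracket P u η ξ)
    {γ : ι → H [⋀^Fin 2]→L[ℝ] ℝ} {α : ι → H →L[ℝ] ℝ}
    (h : ∀ v x, fderiv ℝ W u (Q v) (Q x) - fderiv ℝ W u (Q x) (Q v) +
      koszulBracket P u (W u v) (W u x) = ∑ k, γ k ![Q v, Q x] • α k) :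
    (extDeriv (fun y => (w y).compContinuousLinearMap (W y)) u).compContinuousLinearMap Q =
      (poissonDiff P w u).compContinuousLinearMap (W u) +
        ∑ k, wedge2 ((γ k).compContinuousLinearMap Q)
          (((w u).curryLeft (α k)).compContinuousLinearMap (W u)) := by
  rw [extDeriv_comp_succ hw hW, poissonDiff_succ_eq]
  refine (congrArg₂ (· + ·) (comp_alternatizeUncurryFin_comp hWQ (P u) hPW)
    (comp_alternatize₂_add_eq hWQ hK h (w u))).trans ?_
  rw [← add_assoc, sub_eq_add_neg]
  rfl

end PullbackField

/-! ### The exterior derivative of a wedge product -/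

section ExtDeriv

variable {H : Type*} [NormedAddCommGroup H] [NormedSpace ℝ H] {n : ℕ}

theorem extDeriv_smul_field {f : H → ℝ} {η : H → H [⋀^Fin n]→L[ℝ] ℝ} {x : H}
    (hf : DifferentiableAt ℝ f x) (hη : DifferentiableAt ℝ η x) :
    extDeriv (fun y => f y • η y) x = f x • extDeriv η x + wedge1 (fderiv ℝ f x) (η x) := by
  rw [extDeriv, fderiv_fun_smul hf hη, alternatizeUncurryFin_add, alternatizeUncurryFin_smul]
  rfl

theorem contDiffAt_extDeriv {η : H → H [⋀^Fin n]→L[ℝ] ℝ} {x : H} (hη : ContDiffAt ℝ ∞ η x) :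
    ContDiffAt ℝ ∞ (extDeriv η) x :=
  (alternatizeUncurryFinCLM ℝ H ℝ).contDiff.contDiffAt.comp x
    (hη.fderiv_right (m := ∞) (by simp))

theorem contDiffAt_wedge1 {a : H → H →L[ℝ] ℝ} {η : H → H [⋀^Fin n]→L[ℝ] ℝ} {x : H}
    (ha : ContDiffAt ℝ ∞ a x) (hη : ContDiffAt ℝ ∞ η x) :
    ContDiffAt ℝ ∞ (fun y => wedge1 (a y) (η y)) x :=
  (((wedge1L H n).contDiff.contDiffAt.comp x ha).clm_apply hη)

/-- Writing `df ∧ η = d(f η) - f dη` and applying `d² = 0` twice avoids a general Leibniz rule for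
wedge products. -/
theorem extDeriv_wedge1_fderiv {f : H → ℝ} {η : H → H [⋀^Fin n]→L[ℝ] ℝ} {x : H}
    (hf : ContDiff ℝ ∞ f) (hη : ContDiffAt ℝ ∞ η x) :
    extDeriv (fun y => wedge1 (fderiv ℝ f y) (η y)) x = -wedge1 (fderiv ℝ f x) (extDeriv η x) := by
  have hdf : Differentiable ℝ f := hf.differentiable (by simp)
  have h1 : (fun y => wedge1 (fderiv ℝ f y) (η y)) =ᶠ[𝓝 x]
      fun y => extDeriv (fun z => f z • η z) y + -(f y • extDeriv η y) := by
    have : ∀ᶠ y in 𝓝 x, ContDiffAt ℝ 1 η y :=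
      (hη.of_le (by exact_mod_cast le_top)).eventually (by simp)
    filter_upwards [this] with y hy
    rw [extDeriv_smul_field (hdf y) (hy.differentiableAt (by simp))]
    abel
  have h2 : ContDiffAt ℝ ∞ (fun z => f z • η z) x := hf.contDiffAt.smul hη
  have h3 := contDiffAt_extDeriv hη
  have h4 := contDiffAt_extDeriv h2
  have hs : minSmoothness ℝ 2 ≤ (∞ : WithTop ℕ∞) := by
    rw [minSmoothness_of_isRCLikeNormedField]
    exact WithTop.coe_le_coe.mpr (le_top : (2 : ℕ∞) ≤ ⊤)
  rw [h1.extDeriv_eq, extDeriv_fun_add (ω₂ := fun y => -(f y • extDeriv η y))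
    (h4.differentiableAt (by simp)) ((hf.contDiffAt.smul h3).neg.differentiableAt (by simp)),
    extDeriv_extDeriv_apply h2 hs, zero_add]
  have h5 : extDeriv (fun y => -(f y • extDeriv η y)) x =
      -extDeriv (fun y => f y • extDeriv η y) x := by
    have := extDeriv_fun_smul (-1 : ℝ) (fun y => f y • extDeriv η y) (x := x)
    simp only [neg_smul, one_smul] at this
    exact this
  rw [h5, extDeriv_smul_field (hdf x) (h3.differentiableAt (by simp)),
    extDeriv_extDeriv_apply hη hs, smul_zero,
    zero_add]

theorem extDeriv_wedge1_wedge1_fderiv {f g : H → ℝ} {η : H → H [⋀^Fin n]→L[ℝ] ℝ} {x : H}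
    (hf : ContDiff ℝ ∞ f) (hg : ContDiff ℝ ∞ g) (hη : ContDiffAt ℝ ∞ η x) :
    extDeriv (fun y => wedge1 (fderiv ℝ f y) (wedge1 (fderiv ℝ g y) (η y))) x =
      wedge1 (fderiv ℝ f x) (wedge1 (fderiv ℝ g x) (extDeriv η x)) := by
  rw [extDeriv_wedge1_fderiv hf (contDiffAt_wedge1 (hg.fderiv_right (m := ∞) (by simp)).contDiffAt
    hη), extDeriv_wedge1_fderiv hg hη, wedge1_neg, neg_neg]

end ExtDeriv

end FlatPoisson

end

open scoped Topology

noncomputable section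

namespace FlatPoisson

set_option maxSynthPendingDepth 6

open ContinuousAlternatingMap (alternatizeUncurryFin alternatizeUncurryFinCLM curryLeftLI
  alternatizeUncurryFin_apply compContinuousLinearMapCLM compContinuousLinearMap_apply
  curryLeft_apply_apply)

/-! ### Two-forms as linear maps into the dual -/

section Flatten

variable {E : Type*} [NormedAddCommGroup E] [NormedSpace ℝ E]

/-- The linear map sending a two-form `β` to `x ↦ β(x, ·)`. -/
def formFlat (E : Type*) [NormedAddCommGroup E] [NormedSpace ℝ E] :
    (E [⋀^Fin 2]→L[ℝ] ℝ) →L[ℝ] E →L[ℝ] E →L[ℝ] ℝ :=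
  ContinuousLinearMap.compL ℝ E _ _
      ((ContinuousAlternatingMap.ofSubsingletonLIE (𝕜 := ℝ) (E := E) (F := ℝ)
        (0 : Fin 1)).symm.toContinuousLinearEquiv :
        (E [⋀^Fin 1]→L[ℝ] ℝ) →L[ℝ] (E →L[ℝ] ℝ)) ∘L
    (curryLeftLI : (E [⋀^Fin 2]→L[ℝ] ℝ) →ₗᵢ[ℝ] _).toContinuousLinearMap

theorem formFlat_apply (β : E [⋀^Fin 2]→L[ℝ] ℝ) (x y : E) : formFlat E β x y = β ![x, y] :=
  contractLeft_apply β x y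

theorem formFlat_antisymm (β : E [⋀^Fin 2]→L[ℝ] ℝ) (x y : E) :
    formFlat E β x y = -formFlat E β y x := by
  rw [formFlat_apply, formFlat_apply]
  have h := β.toAlternatingMap.map_swap ![y, x] (i := 0) (j := 1) (by decide)
  have h2 : (![y, x] ∘ Equiv.swap (0 : Fin 2) 1) = ![x, y] := by
    ext i
    fin_cases i <;> rfl
  rw [h2] at h
  exact h

theorem formFlat_wedge1_oneForm (a b : E →L[ℝ] ℝ) :
    formFlat E (wedge1 a (oneForm b)) = a.smulRight b - b.smulRight a := by
  ext x y
  rw [formFlat_apply, wedge1_apply, Fin.sum_univ_two]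
  simp [oneForm, Fin.removeNth]
  ring

theorem extDeriv_two_form_curryLeft {Ω : E → E [⋀^Fin 2]→L[ℝ] ℝ} {u : E}
    (hΩ : DifferentiableAt ℝ Ω u) (v a b : E) :
    (extDeriv Ω u).curryLeft v ![a, b] =
      fderiv ℝ (fun y => formFlat E (Ω y)) u v a b - fderiv ℝ (fun y => formFlat E (Ω y)) u a v b +
        fderiv ℝ (fun y => formFlat E (Ω y)) u b v a := by
  have h : fderiv ℝ (fun y => formFlat E (Ω y)) u = formFlat E ∘L fderiv ℝ Ω u :=
    ((formFlat E).hasFDerivAt.comp u hΩ.hasFDerivAt).fderiv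
  simp only [h, ContinuousLinearMap.comp_apply, formFlat_apply]
  rw [curryLeft_apply_apply, extDeriv, alternatizeUncurryFin_apply, Fin.sum_univ_three]
  have h0 : (0 : Fin 3).removeNth (Matrix.vecCons v ![a, b]) = ![a, b] := by
    ext i
    fin_cases i <;> rfl
  have h1 : (1 : Fin 3).removeNth (Matrix.vecCons v ![a, b]) = ![v, b] := by
    ext i
    fin_cases i <;> rfl
  have h2 : (2 : Fin 3).removeNth (Matrix.vecCons v ![a, b]) = ![v, a] := by
    ext i
    fin_cases i <;> rfl
  rw [h0, h1, h2]
  simp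
  ring

end Flatten

/-! ### Regular Poisson structures with a transverse frame -/

section Leafwise

variable {H : Type*} [NormedAddCommGroup H] [NormedSpace ℝ H] {ι : Type*} [Fintype ι]
  {P : H → (H →L[ℝ] ℝ) →L[ℝ] H} {W : H → H →L[ℝ] H →L[ℝ] ℝ}
  {α : ι → H → H →L[ℝ] ℝ} {V : ι → H → H} {u : H}

/-- The projection along the span of `V k` onto the common kernel of the `α k`, for dual systems. -/
def leafProj (α : ι → H →L[ℝ] ℝ) (V : ι → H) : H →L[ℝ] H :=
  ContinuousLinearMap.id ℝ H - ∑ k, (α k).smulRight (V k)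

theorem leafProj_apply (α : ι → H →L[ℝ] ℝ) (V : ι → H) (v : H) :
    leafProj α V v = v - ∑ k, α k v • V k := by
  simp [leafProj, sum_apply]

theorem leafProj_of_forall_eq_zero {α : ι → H →L[ℝ] ℝ} (V : ι → H) {v : H} (h : ∀ k, α k v = 0) :
    leafProj α V v = v := by
  simp [leafProj_apply, h]

theorem apply_leafProj [DecidableEq ι] {α : ι → H →L[ℝ] ℝ} {V : ι → H}
    (h : ∀ j k, α j (V k) = if j = k then 1 else 0) (j : ι) (v : H) : α j (leafProj α V v) = 0 := by
  simp [leafProj_apply, h, map_sub, map_sum]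

theorem koszulBracket_eq (ξ η : H →L[ℝ] ℝ) (c : H) :
    koszulBracket P u ξ η c = η (fderiv ℝ P u c ξ) := rfl

/-- Differentiate `P (W a) = Q a` in the direction `c` and pair with `W b`. As `a` is leafwise, the
derivative of `Q a` lies in the span of the `V k`, which `W b` kills; antisymmetry of `P` and `P (W
b) = b` turn the rest into the two sides. -/
theorem koszulBracket_eq_fderiv (hP : DifferentiableAt ℝ P u) (hW : DifferentiableAt ℝ W u)
    (hα : ∀ k, DifferentiableAt ℝ (α k) u) (hV : ∀ k, DifferentiableAt ℝ (V k) u)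
    (hPW : ∀ᶠ y in 𝓝 u, P y ∘L W y = leafProj (fun k => α k y) (fun k => V k y))
    (hPanti : ∀ ξ η : H →L[ℝ] ℝ, η (P u ξ) = -ξ (P u η)) (hWV : ∀ v k, W u v (V k u) = 0)
    {a b : H} (ha : ∀ k, α k u a = 0) (hb : ∀ k, α k u b = 0) (c : H) :
    koszulBracket P u (W u a) (W u b) c = fderiv ℝ W u c a b := by
  have h1 := (hP.hasFDerivAt.clm_comp hW.hasFDerivAt).fderiv
  have h2 : HasFDerivAt (fun y => a - ∑ k, α k y a • V k y)
      (0 - ∑ k, (α k u a • fderiv ℝ (V k) u + ((fderiv ℝ (α k) u).flip a).smulRight (V k u))) u := by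
    refine (hasFDerivAt_const a u).sub (HasFDerivAt.fun_sum fun k _ => ?_)
    have h3 : HasFDerivAt (fun y => α k y a) ((fderiv ℝ (α k) u).flip a) u := by
      have := (hα k).hasFDerivAt.clm_apply (hasFDerivAt_const a u)
      simpa using this
    exact h3.smul (hV k).hasFDerivAt
  have h3 : HasFDerivAt (fun y => P y (W y a)) (P u ∘L (fderiv ℝ W u).flip a +
      (fderiv ℝ P u).flip (W u a)) u := by
    have := hP.hasFDerivAt.clm_apply (hW.hasFDerivAt.clm_apply (hasFDerivAt_const a u))
    simpa using this
  have h4 : (fun y => P y (W y a)) =ᶠ[𝓝 u] fun y => a - ∑ k, α k y a • V k y := by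
    filter_upwards [hPW] with y hy
    rw [← leafProj_apply, ← hy]
    rfl
  have h5 := congrArg (fun L => W u b (L c)) ((h2.congr_of_eventuallyEq h4).unique h3)
  have hb' : P u (W u b) = b := by
    have := congrArg (fun L => L b) hPW.self_of_nhds
    refine this.trans (leafProj_of_forall_eq_zero _ hb)
  simp only [ha, zero_smul, zero_add, zero_sub, neg_apply, sum_apply,
    ContinuousLinearMap.smulRight_apply, map_neg, map_sum, map_smul, hWV, smul_zero,
    Finset.sum_const_zero, neg_zero, add_apply, ContinuousLinearMap.comp_apply, map_add,
    ContinuousLinearMap.flip_apply] at h5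
  rw [koszulBracket_eq]
  rw [hPanti, hb'] at h5
  linarith

/-- By `koszulBracket_eq_fderiv` the left side, evaluated on `c`, is the exterior derivative of the
two-form `W` on `Q v, Q x, c`. On leafwise `c` it vanishes by the Jacobi identity; the transverse
part of `c` is a combination of the `V k` with coefficients `α k c`, and there it is `γ k` by
definition. -/
theorem fderiv_sub_fderiv_add_koszulBracket [DecidableEq ι]
    (hP : DifferentiableAt ℝ P u) (hW : DifferentiableAt ℝ W u)
    (hα : ∀ k, DifferentiableAt ℝ (α k) u) (hV : ∀ k, DifferentiableAt ℝ (V k) u)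
    (hPW : ∀ᶠ y in 𝓝 u, P y ∘L W y = leafProj (fun k => α k y) (fun k => V k y))
    (hPanti : ∀ ξ η : H →L[ℝ] ℝ, η (P u ξ) = -ξ (P u η)) (hWV : ∀ v k, W u v (V k u) = 0)
    (hDW : ∀ c a b, fderiv ℝ W u c a b = -fderiv ℝ W u c b a)
    (hαV : ∀ j k, α j u (V k u) = if j = k then 1 else 0)
    (hWanti : ∀ v x, W u v x = -W u x v)
    (hJ : ∀ ξ η ζ, koszulBracket P u ξ η (P u ζ) + koszulBracket P u η ζ (P u ξ) +
      koszulBracket P u ζ ξ (P u η) = 0)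
    {γ : ι → H [⋀^Fin 2]→L[ℝ] ℝ}
    (hγ : ∀ k a b, γ k ![a, b] =
      fderiv ℝ W u (V k u) a b - fderiv ℝ W u a (V k u) b + fderiv ℝ W u b (V k u) a)
    (v x : H) :
    let Q := leafProj (fun k => α k u) (fun k => V k u)
    fderiv ℝ W u (Q v) (Q x) - fderiv ℝ W u (Q x) (Q v) + koszulBracket P u (W u v) (W u x) =
      ∑ k, γ k ![Q v, Q x] • α k u := by
  intro Q
  have hQ : ∀ v k, α k u (Q v) = 0 := fun v k => apply_leafProj hαV k v
  have hWQ : ∀ v, W u (Q v) = W u v := by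
    intro v
    ext x
    rw [leafProj_apply, hWanti, hWanti v]
    simp [map_sub, map_sum, hWV]
  have key : ∀ a b c, (∀ k, α k u a = 0) → (∀ k, α k u b = 0) →
      koszulBracket P u (W u a) (W u b) c = fderiv ℝ W u c a b := fun a b c ha hb =>
    koszulBracket_eq_fderiv hP hW hα hV hPW hPanti hWV ha hb c
  have hPWQ : ∀ v, P u (W u v) = Q v := fun v => congrArg (fun L => L v) hPW.self_of_nhds
  have hclosed : ∀ a b c, (∀ k, α k u a = 0) → (∀ k, α k u b = 0) → (∀ k, α k u c = 0) →
      fderiv ℝ W u c a b + fderiv ℝ W u a b c + fderiv ℝ W u b c a = 0 := by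
    intro a b c ha hb hc
    have h := hJ (W u a) (W u b) (W u c)
    rw [hPWQ, hPWQ, hPWQ] at h
    have e : ∀ d, (∀ k, α k u d = 0) → Q d = d := fun d hd => leafProj_of_forall_eq_zero _ hd
    rwa [e a ha, e b hb, e c hc, key a b c ha hb, key b c a hb hc, key c a b hc ha] at h
  ext c
  have hc : c = Q c + ∑ k, α k u c • V k u := by
    rw [leafProj_apply]
    abel
  rw [← hWQ v, ← hWQ x]
  simp only [add_apply, sub_apply, sum_apply, smul_apply, smul_eq_mul]
  rw [key _ _ _ (hQ v) (hQ x)]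
  simp only [hγ]
  have h1 := hclosed (Q v) (Q x) (Q c) (hQ v) (hQ x) (hQ c)
  conv_lhs => rw [hc]
  simp only [map_add, map_sum, map_smul, add_apply, sum_apply, smul_apply, smul_eq_mul]
  rw [hDW (Q x) (Q v) (Q c)]
  have h2 : ∀ k, fderiv ℝ W u (Q x) (Q v) (V k u) = -fderiv ℝ W u (Q x) (V k u) (Q v) :=
    fun k => hDW _ _ _
  have h3 : ∀ k, fderiv ℝ W u (Q v) (Q x) (V k u) = -fderiv ℝ W u (Q v) (V k u) (Q x) :=
    fun k => hDW _ _ _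
  simp only [h2, h3]
  have h4 : ∑ k, (fderiv ℝ W u (V k u) (Q v) (Q x) - fderiv ℝ W u (Q v) (V k u) (Q x) +
      fderiv ℝ W u (Q x) (V k u) (Q v)) * α k u c =
      ∑ k, α k u c * fderiv ℝ W u (V k u) (Q v) (Q x) +
        ∑ k, α k u c * -fderiv ℝ W u (Q v) (V k u) (Q x) -
        ∑ k, α k u c * -fderiv ℝ W u (Q x) (V k u) (Q v) := by
    rw [← Finset.sum_add_distrib, ← Finset.sum_sub_distrib]
    refine Finset.sum_congr rfl fun k _ => ?_
    ring
  rw [h4]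
  linarith

/-- Differentiate `P θ = 0`, pair with `ξ`, and use that `θ` is closed, expressed by `hsymm`. -/
theorem koszulBracket_casimir {θ : H → H →L[ℝ] ℝ} (hP : DifferentiableAt ℝ P u)
    (hθ : DifferentiableAt ℝ θ u) (hPθ : ∀ y, P y (θ y) = 0)
    (hPanti : ∀ ξ η : H →L[ℝ] ℝ, η (P u ξ) = -ξ (P u η))
    (hsymm : ∀ v x, fderiv ℝ θ u v x = fderiv ℝ θ u x v) (ξ : H →L[ℝ] ℝ) :
    koszulBracket P u (θ u) ξ = fderiv ℝ θ u (P u ξ) := by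
  ext c
  have h1 := hP.hasFDerivAt.clm_apply hθ.hasFDerivAt
  have h2 : (fun y => P y (θ y)) = fun _ => 0 := funext hPθ
  rw [h2] at h1
  have h3 := congrArg (fun L => ξ (L c)) (h1.unique (hasFDerivAt_const (0 : H) u))
  simp only [add_apply, ContinuousLinearMap.comp_apply, map_add, ContinuousLinearMap.flip_apply,
    zero_apply, map_zero] at h3
  rw [koszulBracket_eq, hsymm]
  rw [hPanti] at h3
  linarith

end Leafwise

end FlatPoisson

end

open scoped Topology

noncomputable section

namespace FlatPoisson

set_option maxSynthPendingDepth 6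

/-! ### The linear Poisson structure of `sl₂(ℂ)` in coordinates -/

section Coordinates

theorem fin_three_one_add_one : (1 : Fin 3) + 1 = 2 := rfl
theorem fin_three_one_add_two : (1 : Fin 3) + 2 = 0 := rfl
theorem fin_three_two_add_one : (2 : Fin 3) + 1 = 0 := rfl
theorem fin_three_two_add_two : (2 : Fin 3) + 2 = 1 := rfl

theorem ext_coord {v w : Sl2} (hx : ∀ j, v (Sum.inl j) = w (Sum.inl j))
    (hy : ∀ j, v (Sum.inr j) = w (Sum.inr j)) : v = w := by
  ext i
  rcases i with j | j
  · exact hx j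
  · exact hy j

theorem apply_piSharp (u : Sl2) (ξ η : Sl2 →L[ℝ] ℝ) :
    η (piSharp u ξ) = ∑ j : Fin 3,
      (u (Sum.inl j) * (ξ (eX (j + 1)) * η (eX (j + 2)) - ξ (eX (j + 2)) * η (eX (j + 1)) -
          (ξ (eY (j + 1)) * η (eY (j + 2)) - ξ (eY (j + 2)) * η (eY (j + 1)))) +
        u (Sum.inr j) * (ξ (eX (j + 1)) * η (eY (j + 2)) - ξ (eY (j + 2)) * η (eX (j + 1)) +
          (ξ (eY (j + 1)) * η (eX (j + 2)) - ξ (eX (j + 2)) * η (eY (j + 1))))) := by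
  simp [piSharp, sum_apply, bivec, map_sum, mul_add]

theorem piSharp_antisymm (u : Sl2) (ξ η : Sl2 →L[ℝ] ℝ) : η (piSharp u ξ) = -ξ (piSharp u η) := by
  rw [apply_piSharp, apply_piSharp, ← Finset.sum_neg_distrib]
  exact Finset.sum_congr rfl fun j _ => by ring

theorem ext_forall_clm {v w : Sl2} (h : ∀ η : Sl2 →L[ℝ] ℝ, η v = η w) : v = w :=
  ext_coord (fun j => h (dX j)) fun j => h (dY j)

theorem dX_piSharp (u : Sl2) (ξ : Sl2 →L[ℝ] ℝ) (i : Fin 3) : piSharp u ξ (Sum.inl i) =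
    u (Sum.inl (i + 1)) * ξ (eX (i + 2)) - u (Sum.inl (i + 2)) * ξ (eX (i + 1)) +
      (u (Sum.inr (i + 1)) * ξ (eY (i + 2)) - u (Sum.inr (i + 2)) * ξ (eY (i + 1))) := by
  have h := apply_piSharp u ξ (dX i)
  refine Eq.trans h ?_
  fin_cases i <;> simp [Fin.sum_univ_three, fin_three_one_add_one, fin_three_one_add_two,
    fin_three_two_add_one, fin_three_two_add_two, dX, eX, eY] <;> ring

theorem dY_piSharp (u : Sl2) (ξ : Sl2 →L[ℝ] ℝ) (i : Fin 3) : piSharp u ξ (Sum.inr i) =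
    -(u (Sum.inl (i + 1)) * ξ (eY (i + 2))) + u (Sum.inl (i + 2)) * ξ (eY (i + 1)) +
      (u (Sum.inr (i + 1)) * ξ (eX (i + 2)) - u (Sum.inr (i + 2)) * ξ (eX (i + 1))) := by
  have h := apply_piSharp u ξ (dY i)
  refine Eq.trans h ?_
  fin_cases i <;> simp [Fin.sum_univ_three, fin_three_one_add_one, fin_three_one_add_two,
    fin_three_two_add_one, fin_three_two_add_two, dY, eX, eY] <;> ring

/-- `π` as a linear map of the base point. -/
def piSharpL : Sl2 →L[ℝ] (Sl2 →L[ℝ] ℝ) →L[ℝ] Sl2 :=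
  ∑ j : Fin 3,
    ((dX j).smulRight (bivec (eX (j + 1)) (eX (j + 2)) - bivec (eY (j + 1)) (eY (j + 2))) +
      (dY j).smulRight (bivec (eX (j + 1)) (eY (j + 2)) + bivec (eY (j + 1)) (eX (j + 2))))

theorem piSharpL_apply (u : Sl2) : piSharpL u = piSharp u := by
  rw [piSharpL, piSharp, sum_apply]
  rfl

theorem coe_piSharpL : (piSharpL : Sl2 → (Sl2 →L[ℝ] ℝ) →L[ℝ] Sl2) = piSharp :=
  funext piSharpL_apply

theorem fderiv_piSharp (u : Sl2) : fderiv ℝ piSharp u = piSharpL := by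
  rw [← coe_piSharpL, ContinuousLinearMap.fderiv]

theorem differentiableAt_piSharp (u : Sl2) : DifferentiableAt ℝ piSharp u := by
  rw [← coe_piSharpL]
  exact piSharpL.differentiableAt

theorem koszulBracket_piSharp_apply (u : Sl2) (ξ η : Sl2 →L[ℝ] ℝ) (c : Sl2) :
    koszulBracket piSharp u ξ η c = η (piSharp c ξ) := by
  rw [koszulBracket_eq, fderiv_piSharp, piSharpL_apply]

theorem koszulBracket_piSharp_antisymm (u : Sl2) (ξ η : Sl2 →L[ℝ] ℝ) :
    koszulBracket piSharp u ξ η = -koszulBracket piSharp u η ξ := by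
  ext c
  rw [neg_apply, koszulBracket_piSharp_apply, koszulBracket_piSharp_apply, piSharp_antisymm]

/-- A polynomial identity in coordinates; the Jacobi statements below are rearrangements of it by
antisymmetry. -/
theorem piSharp_jacobi (u : Sl2) (ξ η ζ : Sl2 →L[ℝ] ℝ) :
    η (piSharp (piSharp u ζ) ξ) + ζ (piSharp (piSharp u ξ) η) + ξ (piSharp (piSharp u η) ζ) = 0 := by
  rw [apply_piSharp, apply_piSharp, apply_piSharp]
  simp only [dX_piSharp, dY_piSharp, Fin.sum_univ_three, fin_three_one_add_one,
    fin_three_one_add_two, fin_three_two_add_one, fin_three_two_add_two, zero_add]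
  ring

theorem piSharp_piSharp_sub (u : Sl2) (ξ η : Sl2 →L[ℝ] ℝ) :
    piSharp (piSharp u ξ) η - piSharp (piSharp u η) ξ = piSharp u (koszulBracket piSharp 0 ξ η) := by
  refine ext_forall_clm fun ζ => ?_
  rw [map_sub, piSharp_antisymm u _ ζ, koszulBracket_piSharp_apply,
    piSharp_antisymm (piSharp u η) ξ ζ]
  have h := piSharp_jacobi u ξ η ζ
  linarith

theorem koszulBracket_koszulBracket (ξ η ζ : Sl2 →L[ℝ] ℝ) :
    koszulBracket piSharp 0 (koszulBracket piSharp 0 ξ η) ζ +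
      koszulBracket piSharp 0 (koszulBracket piSharp 0 η ζ) ξ +
        koszulBracket piSharp 0 (koszulBracket piSharp 0 ζ ξ) η = 0 := by
  ext u
  simp only [add_apply, koszulBracket_piSharp_apply, ← piSharp_piSharp_sub, map_sub, zero_apply]
  have h := piSharp_jacobi u ξ η ζ
  rw [piSharp_antisymm (piSharp u η) ξ ζ, piSharp_antisymm (piSharp u ζ) η ξ,
    piSharp_antisymm (piSharp u ξ) ζ η]
  linarith

/-- The Casimir functions `f₁` and `f₂`. -/
def fC : Fin 2 → Sl2 → ℝ := ![f1, f2]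

/-- The differentials of the Casimir functions, as linear maps of the base point. -/
def dfL : Fin 2 → Sl2 →L[ℝ] Sl2 →L[ℝ] ℝ :=
  ![(2 : ℝ) • ∑ j : Fin 3, ((dX j).smulRight (dX j) - (dY j).smulRight (dY j)),
    (2 : ℝ) • ∑ j : Fin 3, ((dX j).smulRight (dY j) + (dY j).smulRight (dX j))]

theorem hasFDerivAt_fC (k : Fin 2) (u : Sl2) : HasFDerivAt (fC k) (dfL k u) u := by
  have hx : ∀ j, HasFDerivAt (fun u : Sl2 => u (Sum.inl j)) (dX j) u :=
    fun j => (dX j).hasFDerivAt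
  have hy : ∀ j, HasFDerivAt (fun u : Sl2 => u (Sum.inr j)) (dY j) u :=
    fun j => (dY j).hasFDerivAt
  fin_cases k
  · have h : HasFDerivAt f1 (∑ j : Fin 3, ((2 * u (Sum.inl j) ^ (2 - 1)) • dX j -
        (2 * u (Sum.inr j) ^ (2 - 1)) • dY j)) u :=
      HasFDerivAt.fun_sum fun j _ => by
        simpa using ((hx j).pow 2).fun_sub ((hy j).pow 2)
    refine h.congr_fderiv ?_
    ext v
    simp [dfL, dX, dY, Fin.sum_univ_three]
    ring
  · have h : HasFDerivAt f2 (∑ j : Fin 3, ((2 * u (Sum.inl j)) • dY j +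
        u (Sum.inr j) • ((2 : ℝ) • dX j))) u :=
      HasFDerivAt.fun_sum fun j _ => ((hx j).const_mul 2).mul (hy j)
    refine h.congr_fderiv ?_
    ext v
    simp [dfL, dX, dY, Fin.sum_univ_three]
    ring

theorem fderiv_fC (k : Fin 2) (u : Sl2) : fderiv ℝ (fC k) u = dfL k u := (hasFDerivAt_fC k u).fderiv

theorem coe_dfL (k : Fin 2) : (dfL k : Sl2 → Sl2 →L[ℝ] ℝ) = fderiv ℝ (fC k) :=
  funext fun u => (fderiv_fC k u).symm

theorem contDiff_fC (k : Fin 2) : ContDiff ℝ ∞ (fC k) :=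
  contDiff_infty_iff_fderiv.mpr ⟨fun u => (hasFDerivAt_fC k u).differentiableAt, by
    rw [← coe_dfL]
    exact (dfL k).contDiff⟩

theorem dfL_symm (k : Fin 2) (u v : Sl2) : dfL k u v = dfL k v u := by
  fin_cases k <;> simp [dfL, dX, dY, Fin.sum_univ_three] <;> ring

theorem piSharp_dfL (k : Fin 2) (u : Sl2) : piSharp u (dfL k u) = 0 := by
  refine ext_coord (fun i => ?_) fun i => ?_
  · rw [dX_piSharp]
    fin_cases k <;> fin_cases i <;> simp [dfL, dX, dY, Fin.sum_univ_three, eX, eY,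
      fin_three_one_add_one, fin_three_one_add_two, fin_three_two_add_one,
      fin_three_two_add_two] <;> ring
  · rw [dY_piSharp]
    fin_cases k <;> fin_cases i <;> simp [dfL, dX, dY, Fin.sum_univ_three, eX, eY,
      fin_three_one_add_one, fin_three_one_add_two, fin_three_two_add_one,
      fin_three_two_add_two] <;> ring

theorem RSq_eq (u : Sl2) : RSq u = 2 * ‖u‖ ^ 2 := by
  rw [RSq, EuclideanSpace.norm_sq_eq, Fintype.sum_sum_type, Finset.sum_add_distrib]
  simp

theorem RSq_ne_zero {u : Sl2} (hu : u ≠ 0) : RSq u ≠ 0 := by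
  rw [RSq_eq]
  have := norm_ne_zero_iff.mpr hu
  positivity

theorem dfL_V {u : Sl2} (hu : u ≠ 0) (j k : Fin 2) : dfL j u (V k u) = if j = k then 1 else 0 := by
  have h := RSq_ne_zero hu
  have h' : RSq u = 2 * ∑ j : Fin 3, (u (Sum.inl j) ^ 2 + u (Sum.inr j) ^ 2) := rfl
  rw [Fin.sum_univ_three] at h'
  fin_cases j <;> fin_cases k <;> simp [dfL, V, dX, dY, Fin.sum_univ_three, eX, eY]
  all_goals field_simp
  · rw [h']
    ring
  · ring
  · right
    ring
  · rw [h']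

/-- The form `ω̃₁` as a map into the dual, up to the factor `2 / R²`, linear in the base point. -/
def omegaL : Sl2 →L[ℝ] Sl2 →L[ℝ] Sl2 →L[ℝ] ℝ :=
  formFlat Sl2 ∘L ∑ j : Fin 3,
    ((dX j).smulRight (wedge1 (dY (j + 1)) (oneForm (dY (j + 2))) -
        wedge1 (dX (j + 1)) (oneForm (dX (j + 2)))) -
      (dY j).smulRight (wedge1 (dX (j + 1)) (oneForm (dY (j + 2))) +
        wedge1 (dY (j + 1)) (oneForm (dX (j + 2)))))

theorem formFlat_omegaTilde (u : Sl2) : formFlat Sl2 (omegaTilde u) = (2 / RSq u) • omegaL u := by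
  rw [omegaTilde, map_smul, omegaL, ContinuousLinearMap.comp_apply, sum_apply]
  rfl

theorem omegaL_apply (u v x : Sl2) : omegaL u v x = ∑ j : Fin 3,
    (u (Sum.inl j) * ((v (Sum.inr (j + 1)) * x (Sum.inr (j + 2)) -
          v (Sum.inr (j + 2)) * x (Sum.inr (j + 1))) -
        (v (Sum.inl (j + 1)) * x (Sum.inl (j + 2)) - v (Sum.inl (j + 2)) * x (Sum.inl (j + 1)))) -
      u (Sum.inr j) * ((v (Sum.inl (j + 1)) * x (Sum.inr (j + 2)) -
          v (Sum.inr (j + 2)) * x (Sum.inl (j + 1))) +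
        (v (Sum.inr (j + 1)) * x (Sum.inl (j + 2)) -
          v (Sum.inl (j + 2)) * x (Sum.inr (j + 1))))) := by
  rw [omegaL, ContinuousLinearMap.comp_apply, sum_apply, map_sum, sum_apply, sum_apply]
  refine Finset.sum_congr rfl fun j _ => ?_
  simp only [sub_apply, ContinuousLinearMap.smulRight_apply, map_sub, map_smul, map_add,
    formFlat_wedge1_oneForm, smul_apply, add_apply, smul_eq_mul]
  simp [dX, dY]

/-- A coordinate computation, valid once the denominators `R²` are cleared; it makes `ω̃₁` the
inverse of `π` along the leaves. -/
theorem piSharp_omegaTilde {u : Sl2} (hu : u ≠ 0) :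
    piSharp u ∘L formFlat Sl2 (omegaTilde u) = leafProj (fun k => dfL k u) (fun k => V k u) := by
  have h := RSq_ne_zero hu
  have h' : RSq u = 2 * ∑ j : Fin 3, (u (Sum.inl j) ^ 2 + u (Sum.inr j) ^ 2) := rfl
  rw [Fin.sum_univ_three] at h'
  refine ContinuousLinearMap.ext fun v => ?_
  rw [ContinuousLinearMap.comp_apply, formFlat_omegaTilde, leafProj_apply]
  refine ext_coord (fun i => ?_) fun i => ?_
  · rw [dX_piSharp]
    simp only [smul_apply, omegaL_apply, Fin.sum_univ_three, Fin.sum_univ_two, smul_eq_mul]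
    fin_cases i <;> simp [dfL, V, dX, dY, Fin.sum_univ_three, eX, eY,
      fin_three_one_add_one, fin_three_one_add_two, fin_three_two_add_one,
      fin_three_two_add_two]
    all_goals field_simp
    all_goals rw [h']
    all_goals ring
  · rw [dY_piSharp]
    simp only [smul_apply, omegaL_apply, Fin.sum_univ_three, Fin.sum_univ_two, smul_eq_mul]
    fin_cases i <;> simp [dfL, V, dX, dY, Fin.sum_univ_three, eX, eY,
      fin_three_one_add_one, fin_three_one_add_two, fin_three_two_add_one,
      fin_three_two_add_two]
    all_goals field_simp
    all_goals rw [h']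
    all_goals ring

theorem omegaTilde_V (u v : Sl2) (k : Fin 2) : formFlat Sl2 (omegaTilde u) v (V k u) = 0 := by
  rw [formFlat_omegaTilde, smul_apply, smul_apply, omegaL_apply]
  fin_cases k <;> simp [V, Fin.sum_univ_three, eX, eY,
      fin_three_one_add_one, fin_three_one_add_two, fin_three_two_add_one,
      fin_three_two_add_two] <;> right <;> ring

theorem phi_eq (u : Sl2) {n : ℕ} (η : Form n) :
    wedge2 (phi u) η = wedge1 (dfL 0 u) (wedge1 (dfL 1 u) η) := by
  rw [phi, wedge2_wedge1_oneForm, ← fderiv_fC, ← fderiv_fC]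
  rfl

end Coordinates

end FlatPoisson

end

open scoped Topology

noncomputable section

namespace FlatPoisson

set_option maxSynthPendingDepth 6

open ContinuousAlternatingMap (alternatizeUncurryFin alternatizeUncurryFinCLM curryLeftLI
  alternatizeUncurryFin_apply compContinuousLinearMapCLM compContinuousLinearMap_apply
  curryLeft_apply_apply curryLeft_add curryLeft_same curryLeft_compContinuousLinearMap
  alternatizeUncurryFin_curryLeft)

/-! ### Decomposition of forms along a dual pair -/

section DualPair

variable {E : Type*} [NormedAddCommGroup E] [NormedSpace ℝ E] {n : ℕ}
  {a : Fin 2 → E →L[ℝ] ℝ} {x : Fin 2 → E}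

theorem comp_of_degree_zero {F : Type*} [NormedAddCommGroup F] [NormedSpace ℝ F]
    (η : E [⋀^Fin 0]→L[ℝ] ℝ) (g h : F →L[ℝ] E) :
    η.compContinuousLinearMap g = η.compContinuousLinearMap h := by
  ext v
  rw [compContinuousLinearMap_apply, compContinuousLinearMap_apply]
  congr 1
  exact Subsingleton.elim _ _

theorem comp_id_of_degree_zero (η : E [⋀^Fin 0]→L[ℝ] ℝ) (g : E →L[ℝ] E) :
    η.compContinuousLinearMap g = η :=
  (comp_of_degree_zero η g (ContinuousLinearMap.id ℝ E)).trans rfl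

theorem comp_comp {F G : Type*} [NormedAddCommGroup F] [NormedSpace ℝ F] [NormedAddCommGroup G]
    [NormedSpace ℝ G] (η : E [⋀^Fin n]→L[ℝ] ℝ) (g : F →L[ℝ] E) (h : G →L[ℝ] F) :
    η.compContinuousLinearMap (g ∘L h) =
      (η.compContinuousLinearMap g).compContinuousLinearMap h := rfl

theorem wedge1_comp_id_sub_smulRight {b : E →L[ℝ] ℝ} {y : E} (h : b y = 1)
    (η : E [⋀^Fin n]→L[ℝ] ℝ) :
    wedge1 b (η.compContinuousLinearMap (ContinuousLinearMap.id ℝ E - b.smulRight y)) =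
      wedge1 b η := by
  cases n with
  | zero => rw [comp_id_of_degree_zero]
  | succ n => rw [comp_id_sub_smulRight h, wedge1_sub, wedge1_wedge1_self, sub_zero]

theorem leafProj_eq_comp (h : ∀ j k, a j (x k) = if j = k then 1 else 0) :
    leafProj a x = (ContinuousLinearMap.id ℝ E - (a 0).smulRight (x 0)) ∘L
      (ContinuousLinearMap.id ℝ E - (a 1).smulRight (x 1)) := by
  ext1 v
  simp [leafProj_apply, Fin.sum_univ_two, h]
  abel

theorem leafProj_eq_comp' (h : ∀ j k, a j (x k) = if j = k then 1 else 0) :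
    leafProj a x = (ContinuousLinearMap.id ℝ E - (a 1).smulRight (x 1)) ∘L
      (ContinuousLinearMap.id ℝ E - (a 0).smulRight (x 0)) := by
  ext1 v
  simp [leafProj_apply, Fin.sum_univ_two, h]
  abel

theorem wedge1_zero_comp_leafProj (h : ∀ j k, a j (x k) = if j = k then 1 else 0)
    (η : E [⋀^Fin n]→L[ℝ] ℝ) :
    wedge1 (a 0) (η.compContinuousLinearMap (leafProj a x)) =
      wedge1 (a 0) (η.compContinuousLinearMap
        (ContinuousLinearMap.id ℝ E - (a 1).smulRight (x 1))) := by
  rw [leafProj_eq_comp' h, comp_comp, wedge1_comp_id_sub_smulRight (by simp [h])]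

theorem wedge1_one_comp_leafProj (h : ∀ j k, a j (x k) = if j = k then 1 else 0)
    (η : E [⋀^Fin n]→L[ℝ] ℝ) :
    wedge1 (a 1) (η.compContinuousLinearMap (leafProj a x)) =
      wedge1 (a 1) (η.compContinuousLinearMap
        (ContinuousLinearMap.id ℝ E - (a 0).smulRight (x 0))) := by
  rw [leafProj_eq_comp h, comp_comp, wedge1_comp_id_sub_smulRight (by simp [h])]

/-- Wedging with `a k` absorbs the projection along `x k`, since the two pullbacks differ by a
multiple of `a k`. Hence the product of both one-forms sees only the leafwise part. -/
theorem wedge1_wedge1_comp_leafProj (h : ∀ j k, a j (x k) = if j = k then 1 else 0)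
    (η : E [⋀^Fin n]→L[ℝ] ℝ) :
    wedge1 (a 0) (wedge1 (a 1) (η.compContinuousLinearMap (leafProj a x))) =
      wedge1 (a 0) (wedge1 (a 1) η) := by
  rw [wedge1_one_comp_leafProj h, wedge1_anticomm, wedge1_comp_id_sub_smulRight (by simp [h]),
    ← wedge1_anticomm]

theorem sub_curryLeft (η θ : E [⋀^Fin (n + 1)]→L[ℝ] ℝ) (y : E) :
    (η - θ).curryLeft y = η.curryLeft y - θ.curryLeft y := rfl

theorem decomposition_one (h : ∀ j k, a j (x k) = if j = k then 1 else 0)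
    (η : E [⋀^Fin 1]→L[ℝ] ℝ) :
    η = η.compContinuousLinearMap (leafProj a x) +
      ∑ k, wedge1 (a k) ((η.curryLeft (x k)).compContinuousLinearMap (leafProj a x)) := by
  rw [Fin.sum_univ_two, comp_id_of_degree_zero, comp_id_of_degree_zero, leafProj_eq_comp h]
  have h0 := comp_id_sub_smulRight (a := a 0) (x := x 0) (by simp [h]) η
  have h1 := comp_id_sub_smulRight (a := a 1) (x := x 1) (by simp [h])
    (η.compContinuousLinearMap (ContinuousLinearMap.id ℝ E - (a 0).smulRight (x 0)))
  rw [← comp_comp] at h1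
  have h2 : (η.compContinuousLinearMap
      (ContinuousLinearMap.id ℝ E - (a 0).smulRight (x 0))).curryLeft (x 1) =
      η.curryLeft (x 1) := by
    rw [h0, sub_curryLeft, curryLeft_wedge1_zero]
    simp [h]
  rw [h2, h0] at h1
  rw [h1]
  abel

/-- Splitting off one vector, `η = (id - a ⊗ x)^* η + a ∧ i_x η`, is applied for `x 0` and then for
`x 1`; the double contraction collects the terms containing both covectors. -/
theorem decomposition (h : ∀ j k, a j (x k) = if j = k then 1 else 0)
    (η : E [⋀^Fin (n + 2)]→L[ℝ] ℝ) :
    η = η.compContinuousLinearMap (leafProj a x) +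
      ∑ k, wedge1 (a k) ((η.curryLeft (x k)).compContinuousLinearMap (leafProj a x)) +
      wedge1 (a 0) (wedge1 (a 1)
        (((η.curryLeft (x 0)).curryLeft (x 1)).compContinuousLinearMap (leafProj a x))) := by
  rw [Fin.sum_univ_two, wedge1_wedge1_comp_leafProj h, wedge1_zero_comp_leafProj h,
    wedge1_one_comp_leafProj h, comp_id_sub_smulRight (by simp [h]),
    comp_id_sub_smulRight (by simp [h]), leafProj_eq_comp h]
  have h0 := comp_id_sub_smulRight (a := a 0) (x := x 0) (by simp [h]) η
  have h1 := comp_id_sub_smulRight (a := a 1) (x := x 1) (by simp [h])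
    (η.compContinuousLinearMap (ContinuousLinearMap.id ℝ E - (a 0).smulRight (x 0)))
  rw [← comp_comp] at h1
  have h2 : (η.compContinuousLinearMap
      (ContinuousLinearMap.id ℝ E - (a 0).smulRight (x 0))).curryLeft (x 1) =
      η.curryLeft (x 1) + wedge1 (a 0) ((η.curryLeft (x 0)).curryLeft (x 1)) := by
    rw [h0, sub_curryLeft, curryLeft_wedge1]
    simp [h]
  rw [h2, h0, wedge1_add] at h1
  rw [h1, wedge1_sub, wedge1_sub, curryLeft_curryLeft η (x 1) (x 0), wedge1_anticomm (a 1) (a 0),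
    wedge1_anticomm (a 1) (a 0), wedge1_neg, wedge1_neg]
  abel

theorem curryLeft_comp_leafProj (h : ∀ j k, a j (x k) = if j = k then 1 else 0)
    (η : E [⋀^Fin (n + 1)]→L[ℝ] ℝ) (k : Fin 2) :
    (η.compContinuousLinearMap (leafProj a x)).curryLeft (x k) = 0 := by
  rw [curryLeft_compContinuousLinearMap]
  have : leafProj a x (x k) = 0 := by simp [leafProj_apply, h]
  rw [this, map_zero]
  rfl

theorem curryLeft_curryLeft_wedge1_wedge1 (h : ∀ j k, a j (x k) = if j = k then 1 else 0)
    (η : E [⋀^Fin n]→L[ℝ] ℝ) :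
    ((wedge1 (a 0) (wedge1 (a 1) η)).curryLeft (x 0)).curryLeft (x 1) =
      η.compContinuousLinearMap (leafProj a x) := by
  rw [← wedge1_wedge1_comp_leafProj h, curryLeft_wedge1]
  cases n with
  | zero =>
    rw [curryLeft_wedge1_zero, sub_curryLeft, h, h]
    simp only [if_true, one_smul, curryLeft_wedge1_zero, h]
    simp
  | succ n =>
    rw [curryLeft_wedge1, sub_curryLeft, curryLeft_comp_leafProj h, h, h, wedge1_zero]
    simp only [if_true, one_smul, curryLeft_wedge1, h, curryLeft_comp_leafProj h, wedge1_zero]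
    simp [wedge1_zero]

end DualPair

/-! ### Homogeneity of pullbacks -/

section PullbackHomogeneous

variable {H E F : Type*} [NormedAddCommGroup H] [NormedSpace ℝ H]
  [NormedAddCommGroup E] [NormedSpace ℝ E] [NormedAddCommGroup F] [NormedSpace ℝ F]

/-- Alternating the contraction of an `(n + 1)`-form returns `n + 1` times the form. The resulting
recursion shows that pullback depends smoothly and homogeneously on `g`. -/
theorem compContinuousLinearMapCLM_succ (n : ℕ) (g : E →L[ℝ] F) :
    (compContinuousLinearMapCLM g : (F [⋀^Fin (n + 1)]→L[ℝ] ℝ) →L[ℝ] _) =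
      ((n + 1 : ℝ)⁻¹) • (alternatizeUncurryFinCLM ℝ E ℝ ∘L
        (ContinuousLinearMap.compL ℝ E F _).flip g ∘L
        ContinuousLinearMap.compL ℝ F _ _ (compContinuousLinearMapCLM g) ∘L
        (curryLeftLI : (F [⋀^Fin (n + 1)]→L[ℝ] ℝ) →ₗᵢ[ℝ] _).toContinuousLinearMap) := by
  ext1 η
  have hn : (n + 1 : ℝ) ≠ 0 := by positivity
  rw [smul_apply, eq_inv_smul_iff₀ hn]
  have h1 := comp_alternatizeUncurryFin η.curryLeft g
  rw [alternatizeUncurryFin_curryLeft] at h1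
  refine Eq.trans ?_ h1
  ext v
  simp

theorem IsHomogeneous.pullbackCLM {e : ℤ} {W : H → E →L[ℝ] F}
    (hW : IsHomogeneous e W) (n : ℕ) :
    IsHomogeneous (n * e) fun u =>
      (compContinuousLinearMapCLM (W u) : (F [⋀^Fin n]→L[ℝ] ℝ) →L[ℝ] _) := by
  induction n with
  | zero =>
    refine ((IsHomogeneous.const (H := H) (compContinuousLinearMapCLM 0 :
      (F [⋀^Fin 0]→L[ℝ] ℝ) →L[ℝ] E [⋀^Fin 0]→L[ℝ] ℝ)).congr fun u _ => ?_).degree_congr (by simp)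
    ext1 η
    exact comp_of_degree_zero η _ _
  | succ n ih =>
    simp only [compContinuousLinearMapCLM_succ n]
    have h1 := hW.comp_clm (ContinuousLinearMap.compL ℝ E F (E [⋀^Fin n]→L[ℝ] ℝ)).flip
    have h2 := ih.comp_clm (ContinuousLinearMap.compL ℝ F (F [⋀^Fin n]→L[ℝ] ℝ) (E [⋀^Fin n]→L[ℝ] ℝ))
    have h3 := h2.clm_comp (IsHomogeneous.const
      (curryLeftLI : (F [⋀^Fin (n + 1)]→L[ℝ] ℝ) →ₗᵢ[ℝ] _).toContinuousLinearMap)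
    refine (((IsHomogeneous.const (alternatizeUncurryFinCLM ℝ E ℝ)).clm_comp
      (h1.clm_comp h3)).const_smul _).degree_congr ?_
    push_cast
    ring

end PullbackHomogeneous

/-! ### The symplectic foliation of `sl₂(ℂ) ∖ {0}` -/

section Foliation

/-- The leafwise symplectic form as a map `v ↦ i_v ω̃₁`. -/
def omegaFlat (u : Sl2) : Sl2 →L[ℝ] Sl2 →L[ℝ] ℝ := formFlat Sl2 (omegaTilde u)

theorem isHomogeneous_RSq_inv : IsHomogeneous (-2) fun u => (RSq u)⁻¹ := by
  refine ⟨?_, fun t ht u hu => ?_⟩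
  · have h : (fun u : Sl2 => (RSq u)⁻¹) = fun u => (2 * ‖u‖ ^ 2)⁻¹ := funext fun u => by rw [RSq_eq]
    rw [h]
    exact (contDiff_const.mul (contDiff_norm_sq ℝ)).contDiffOn.inv fun u hu => by
      rw [← RSq_eq]
      exact RSq_ne_zero hu
  · rw [RSq_eq, RSq_eq, norm_smul, Real.norm_of_nonneg ht.le, zpow_neg, smul_eq_mul, ← mul_inv]
    congr 1
    norm_cast
    ring

theorem isHomogeneous_omegaFlat : IsHomogeneous (-1) omegaFlat := by
  have h := (isHomogeneous_RSq_inv.const_smul 2).smul (IsHomogeneous.clm omegaL)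
  refine (h.congr fun u _ => ?_).degree_congr (by norm_num)
  rw [omegaFlat, formFlat_omegaTilde, div_eq_mul_inv, smul_eq_mul]

theorem isHomogeneous_omegaTilde : IsHomogeneous (-1) omegaTilde := by
  have h := (isHomogeneous_RSq_inv.const_smul 2).smul (IsHomogeneous.clm
    (∑ j : Fin 3, ((dX j).smulRight (wedge1 (dY (j + 1)) (oneForm (dY (j + 2))) -
        wedge1 (dX (j + 1)) (oneForm (dX (j + 2)))) -
      (dY j).smulRight (wedge1 (dX (j + 1)) (oneForm (dY (j + 2))) +
        wedge1 (dY (j + 1)) (oneForm (dX (j + 2)))))))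
  refine (h.congr fun u _ => ?_).degree_congr (by norm_num)
  rw [omegaTilde, div_eq_mul_inv, smul_eq_mul, sum_apply]
  rfl

theorem isHomogeneous_V (k : Fin 2) : IsHomogeneous (-1) (V k) := by
  let L : Fin 2 → Sl2 →L[ℝ] Sl2 :=
    ![∑ j : Fin 3, ((dX j).smulRight (eX j) - (dY j).smulRight (eY j)),
      ∑ j : Fin 3, ((dX j).smulRight (eY j) + (dY j).smulRight (eX j))]
  have h := isHomogeneous_RSq_inv.smul (IsHomogeneous.clm (L k))
  refine (h.congr fun u _ => ?_).degree_congr (by norm_num)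
  fin_cases k <;> simp [V, L, sum_apply, dX, dY]

theorem isHomogeneous_piSharp : IsHomogeneous 1 piSharp := by
  rw [← coe_piSharpL]
  exact IsHomogeneous.clm piSharpL

theorem isHomogeneous_gamma (k : Fin 2) : IsHomogeneous (-3) (gamma k) := by
  have h1 := isHomogeneous_omegaTilde.fderiv.comp_clm (alternatizeUncurryFinCLM ℝ Sl2 ℝ)
  exact ((isHomogeneous_V k).bilin (interiorL Sl2 2) h1).degree_congr (by norm_num)

theorem piSharp_comp_omegaFlat {u : Sl2} (hu : u ≠ 0) :
    piSharp u ∘L omegaFlat u = leafProj (fun k => dfL k u) (fun k => V k u) :=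
  piSharp_omegaTilde hu

theorem omegaFlat_antisymm (u v w : Sl2) : omegaFlat u v w = -omegaFlat u w v :=
  formFlat_antisymm _ _ _

theorem omegaFlat_V (u : Sl2) (k : Fin 2) : omegaFlat u (V k u) = 0 := by
  ext v
  rw [omegaFlat_antisymm]
  exact neg_eq_zero.mpr (omegaTilde_V u v k)

theorem omegaFlat_comp_leafProj (u : Sl2) :
    omegaFlat u ∘L leafProj (fun k => dfL k u) (fun k => V k u) = omegaFlat u := by
  ext1 v
  simp [leafProj_apply, omegaFlat_V]

/-- Evaluation of covectors at `V k u`. -/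
def evV (k : Fin 2) (u : Sl2) : (Sl2 →L[ℝ] ℝ) →L[ℝ] ℝ := ContinuousLinearMap.apply ℝ ℝ (V k u)

theorem evV_apply (k : Fin 2) (u : Sl2) (ξ : Sl2 →L[ℝ] ℝ) : evV k u ξ = ξ (V k u) := rfl

theorem isHomogeneous_evV (k : Fin 2) : IsHomogeneous (-1) (evV k) :=
  (isHomogeneous_V k).comp_clm (ContinuousLinearMap.apply ℝ ℝ)

theorem evV_dfL {u : Sl2} (hu : u ≠ 0) (j k : Fin 2) :
    evV j u (dfL k u) = if j = k then 1 else 0 := by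
  rw [evV_apply, dfL_V hu]
  simp only [eq_comm]

/-- The transpose of `piSharp_comp_omegaFlat`, as both maps are antisymmetric. -/
theorem omegaFlat_comp_piSharp {u : Sl2} (hu : u ≠ 0) :
    omegaFlat u ∘L piSharp u = leafProj (fun k => evV k u) (fun k => dfL k u) := by
  ext ξ v
  have h := congrArg (fun L => ξ (L v)) (piSharp_comp_omegaFlat hu)
  simp only [ContinuousLinearMap.comp_apply, leafProj_apply, map_sub, map_sum, map_smul] at h ⊢
  rw [omegaFlat_antisymm, ← piSharp_antisymm, h, sub_apply, sum_apply]
  simp [evV_apply, mul_comm]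

theorem evV_comp_omegaFlat (u : Sl2) (k : Fin 2) : evV k u ∘L omegaFlat u = 0 := by
  ext v
  exact omegaTilde_V u v k

theorem koszulBracket_dfL (u : Sl2) (k : Fin 2) (ξ : Sl2 →L[ℝ] ℝ) :
    koszulBracket piSharp u (dfL k u) ξ = fderiv ℝ (dfL k) u (piSharp u ξ) :=
  koszulBracket_casimir (differentiableAt_piSharp u) (dfL k).differentiableAt
    (fun y => piSharp_dfL k y) (piSharp_antisymm u)
    (fun v x => by rw [ContinuousLinearMap.fderiv, dfL_symm]) ξ

theorem fderiv_omegaFlat_sub {u : Sl2} (hu : u ≠ 0) (v x : Sl2) :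
    let Q := leafProj (fun k => dfL k u) (fun k => V k u)
    fderiv ℝ omegaFlat u (Q v) (Q x) - fderiv ℝ omegaFlat u (Q x) (Q v) +
      koszulBracket piSharp u (omegaFlat u v) (omegaFlat u x) =
        ∑ k, gamma k u ![Q v, Q x] • dfL k u := by
  have hD : fderiv ℝ omegaFlat u = formFlat Sl2 ∘L fderiv ℝ omegaTilde u :=
    ((formFlat Sl2).hasFDerivAt.comp u
      (isHomogeneous_omegaTilde.differentiableAt hu).hasFDerivAt).fderiv
  refine fderiv_sub_fderiv_add_koszulBracket (α := fun k y => dfL k y) (differentiableAt_piSharp u)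
    (isHomogeneous_omegaFlat.differentiableAt hu) (fun k => (dfL k).differentiableAt)
    (fun k => (isHomogeneous_V k).differentiableAt hu) ?_ (piSharp_antisymm u)
    (fun v k => omegaTilde_V u v k) (fun c a b => ?_) (fun j k => dfL_V hu j k)
    (omegaFlat_antisymm u) (fun ξ η ζ => ?_) (fun k a b => ?_) v x
  · filter_upwards [isOpen_compl_singleton.mem_nhds hu] with y hy
    exact piSharp_comp_omegaFlat hy
  · rw [hD]
    exact formFlat_antisymm _ _ _
  · simp only [koszulBracket_piSharp_apply]
    exact piSharp_jacobi u ξ η ζ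
  · exact extDeriv_two_form_curryLeft (isHomogeneous_omegaTilde.differentiableAt hu) _ _ _

/-- The kernel of `ω̃₁` contains the two independent vectors `V k`, so its range has dimension at
most four and five covectors in it are dependent. This caps the pole of the pullback, whose degree
`-n` is otherwise unbounded. -/
theorem comp_omegaFlat_eq_zero {u : Sl2} (hu : u ≠ 0) {n : ℕ} (hn : 5 ≤ n) (w : MultiVec Sl2 n) :
    w.compContinuousLinearMap (omegaFlat u) = 0 := by
  ext v
  rw [compContinuousLinearMap_apply]
  refine w.toAlternatingMap.map_linearDependent _ fun hli => ?_
  have hV : LinearIndependent ℝ fun k => (⟨V k u, omegaFlat_V u k⟩ :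
      LinearMap.ker (omegaFlat u : Sl2 →ₗ[ℝ] Sl2 →L[ℝ] ℝ)) := by
    rw [Fintype.linearIndependent_iff]
    intro g hg j
    have := congrArg
      (fun y : LinearMap.ker (omegaFlat u : Sl2 →ₗ[ℝ] Sl2 →L[ℝ] ℝ) => dfL j u (y : Sl2)) hg
    simp only [AddSubmonoidClass.coe_finsetSum, Submodule.coe_smul, map_sum, map_smul, dfL_V hu,
      smul_eq_mul, mul_ite, mul_one, mul_zero, Finset.sum_ite_eq, Finset.mem_univ, if_true,
      ZeroMemClass.coe_zero, map_zero] at this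
    exact this
  have h1 := hV.fintype_card_le_finrank
  have h2 : LinearIndependent ℝ fun i => (⟨omegaFlat u (v i), ⟨v i, rfl⟩⟩ :
      LinearMap.range (omegaFlat u : Sl2 →ₗ[ℝ] Sl2 →L[ℝ] ℝ)) :=
    LinearIndependent.of_comp (Submodule.subtype _) hli
  have h3 := h2.fintype_card_le_finrank
  have h4 := LinearMap.finrank_range_add_finrank_ker (omegaFlat u : Sl2 →ₗ[ℝ] Sl2 →L[ℝ] ℝ)
  have h5 : Module.finrank ℝ Sl2 = 6 := by simp
  simp only [Fintype.card_fin] at h1 h3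
  omega

end Foliation

end FlatPoisson

end

open scoped Topology

noncomputable section

namespace FlatPoisson

set_option maxSynthPendingDepth 6

open ContinuousAlternatingMap (alternatizeUncurryFinCLM compContinuousLinearMapCLM)

/-! ### The operators between multivector fields and forms -/

section Operators

/-- The operator `η ↦ φ ∧ η` at the point `u`. -/
def wedgePhi (n : ℕ) (u : Sl2) : Form n →L[ℝ] Form (n + 2) :=
  wedge1L Sl2 (n + 1) (dfL 0 u) ∘L wedge1L Sl2 n (dfL 1 u)

theorem wedgePhi_apply {n : ℕ} (u : Sl2) (η : Form n) :
    wedgePhi n u η = wedge1 (dfL 0 u) (wedge1 (dfL 1 u) η) := rfl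

theorem wedge2_phi {n : ℕ} (u : Sl2) (η : Form n) : wedge2 (phi u) η = wedgePhi n u η :=
  phi_eq u η

theorem isHomogeneous_wedgePhi (n : ℕ) : IsHomogeneous 2 (wedgePhi n) :=
  ((IsHomogeneous.clm (dfL 0)).comp_clm (wedge1L Sl2 (n + 1))).clm_comp
    ((IsHomogeneous.clm (dfL 1)).comp_clm (wedge1L Sl2 n))

/-- The bilinear map `(η, f) ↦ ½ alt (x ↦ f(x) ∧ η)`. -/
def alternatizeWedge1L (E : Type*) [NormedAddCommGroup E] [NormedSpace ℝ E] (n : ℕ) :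
    (E [⋀^Fin n]→L[ℝ] ℝ) →L[ℝ] (E →L[ℝ] E →L[ℝ] ℝ) →L[ℝ] E [⋀^Fin (n + 2)]→L[ℝ] ℝ :=
  ContinuousLinearMap.compL ℝ (E →L[ℝ] E →L[ℝ] ℝ) (E →L[ℝ] E [⋀^Fin (n + 1)]→L[ℝ] ℝ) _
      ((1 / 2 : ℝ) • alternatizeUncurryFinCLM ℝ E ℝ) ∘L
    ContinuousLinearMap.compL ℝ E (E →L[ℝ] ℝ) (E [⋀^Fin (n + 1)]→L[ℝ] ℝ) ∘L (wedge1L E n).flip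

/-- The exterior product with a two-form as a bilinear map. -/
def wedge2L (E : Type*) [NormedAddCommGroup E] [NormedSpace ℝ E] (n : ℕ) :
    (E [⋀^Fin 2]→L[ℝ] ℝ) →L[ℝ] (E [⋀^Fin n]→L[ℝ] ℝ) →L[ℝ] E [⋀^Fin (n + 2)]→L[ℝ] ℝ :=
  (alternatizeWedge1L E n).flip ∘L formFlat E

theorem wedge2L_apply {E : Type*} [NormedAddCommGroup E] [NormedSpace ℝ E] {n : ℕ}
    (β : E [⋀^Fin 2]→L[ℝ] ℝ) (η : E [⋀^Fin n]→L[ℝ] ℝ) : wedge2L E n β η = wedge2 β η := rfl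

theorem wedge2_wedgePhi {n : ℕ} (β : Form 2) (u : Sl2) (η : Form n) :
    wedge2 β (wedgePhi n u η) = wedgePhi (n + 2) u (wedge2 β η) := by
  rw [wedgePhi_apply, wedgePhi_apply, wedge1_wedge2, wedge1_wedge2]

/-- The pullback of multivectors to forms by `ω̃₁`. -/
def pullOmega (n : ℕ) (u : Sl2) : MultiVec Sl2 n →L[ℝ] Form n :=
  compContinuousLinearMapCLM (omegaFlat u)

/-- The pullback of forms to multivectors by `π`. -/
def pullPi (n : ℕ) (u : Sl2) : Form n →L[ℝ] MultiVec Sl2 n :=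
  compContinuousLinearMapCLM (piSharp u)

theorem pullOmega_apply {n : ℕ} (u : Sl2) (w : MultiVec Sl2 n) :
    pullOmega n u w = w.compContinuousLinearMap (omegaFlat u) := rfl

theorem pullPi_apply {n : ℕ} (u : Sl2) (η : Form n) :
    pullPi n u η = η.compContinuousLinearMap (piSharp u) := rfl

theorem isHomogeneous_pullOmega (n : ℕ) : IsHomogeneous (-n) (pullOmega n) :=
  (isHomogeneous_omegaFlat.pullbackCLM n).degree_congr (by ring)

theorem isHomogeneous_pullPi (n : ℕ) : IsHomogeneous n (pullPi n) :=
  (isHomogeneous_piSharp.pullbackCLM n).degree_congr (by ring)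

/-- The operator `w ↦ φ ∧ ω̃₁^* w`. -/
def fwd₀ (n : ℕ) (u : Sl2) : MultiVec Sl2 n →L[ℝ] Form (n + 2) := wedgePhi n u ∘L pullOmega n u

/-- The operator `w ↦ φ ∧ ω̃₁^* (i_{df_k} w)`. -/
def fwd₁ (k : Fin 2) : (n : ℕ) → Sl2 → MultiVec Sl2 n →L[ℝ] Form (n + 1)
  | 0, _ => 0
  | n + 1, u => fwd₀ n u ∘L interiorL (Sl2 →L[ℝ] ℝ) n (dfL k u)

/-- The operator `w ↦ φ ∧ ω̃₁^* (i_{df_2} i_{df_1} w)`. -/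
def fwd₂ : (n : ℕ) → Sl2 → MultiVec Sl2 n →L[ℝ] Form n
  | 0, _ => 0
  | n + 1, u => fwd₁ 1 n u ∘L interiorL (Sl2 →L[ℝ] ℝ) n (dfL 0 u)

end Operators

/-! ### Compatibility with the differentials -/

section ChainMap

variable {n : ℕ}

theorem contDiff_curryLeft_dfL (k : Fin 2) {w : Sl2 → MultiVec Sl2 (n + 1)} (hw : ContDiff ℝ ∞ w) :
    ContDiff ℝ ∞ fun y => (w y).curryLeft (dfL k y) :=
  ((interiorL (Sl2 →L[ℝ] ℝ) n).contDiff.comp (dfL k).contDiff).clm_apply hw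

theorem curryLeft_poissonDiff_dfL (k : Fin 2) {w : Sl2 → MultiVec Sl2 (n + 1)}
    (hw : ContDiff ℝ ∞ w) (u : Sl2) :
    (poissonDiff piSharp w u).curryLeft (dfL k u) =
      -poissonDiff piSharp (fun y => (w y).curryLeft (dfL k y)) u := by
  cases n with
  | zero =>
    exact curryLeft_poissonDiff_one (α := dfL k) (piSharp_dfL k u)
      (koszulBracket_piSharp_antisymm u) (koszulBracket_dfL u k)
      (hw.differentiable (by simp) u) (dfL k).differentiableAt
  | succ n =>
    exact curryLeft_poissonDiff (α := dfL k) (piSharp_dfL k u)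
      (koszulBracket_piSharp_antisymm u) (koszulBracket_dfL u k)
      (hw.differentiable (by simp) u) (dfL k).differentiableAt

theorem wedgePhi_comp_leafProj {u : Sl2} (hu : u ≠ 0) (η : Form n) :
    wedgePhi n u (η.compContinuousLinearMap (leafProj (fun k => dfL k u) (fun k => V k u))) =
      wedgePhi n u η :=
  wedge1_wedge1_comp_leafProj (a := fun k => dfL k u) (x := fun k => V k u)
    (fun j k => dfL_V hu j k) η

theorem pullOmega_comp_leafProj (u : Sl2) (w : MultiVec Sl2 n) :
    (pullOmega n u w).compContinuousLinearMap (leafProj (fun k => dfL k u) (fun k => V k u)) =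
      pullOmega n u w := by
  rw [pullOmega_apply, ← comp_comp, omegaFlat_comp_leafProj]

theorem contDiffAt_pullOmega {w : Sl2 → MultiVec Sl2 n} (hw : ContDiff ℝ ∞ w) {u : Sl2}
    (hu : u ≠ 0) : ContDiffAt ℝ ∞ (fun v => pullOmega n v (w v)) u :=
  ((isHomogeneous_pullOmega n).contDiffAt hu).clm_apply hw.contDiffAt

theorem extDeriv_wedgePhi {η : Sl2 → Form n} {u : Sl2} (hη : ContDiffAt ℝ ∞ η u) :
    extDeriv (fun v => wedgePhi n v (η v)) u = wedgePhi (n + 1) u (extDeriv η u) := by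
  have h := extDeriv_wedge1_wedge1_fderiv (contDiff_fC 0) (contDiff_fC 1) hη
  simp only [fderiv_fC] at h
  exact h

/-- As `φ` is closed and of even degree, `d` passes through `φ ∧ ·`. The wedge with `φ` permits
inserting the leafwise projection, after which the comparison of `d` with `d_π` along the leaves
applies. -/
theorem extDeriv_fwd₀ {w : Sl2 → MultiVec Sl2 n} (hw : ContDiff ℝ ∞ w) {u : Sl2} (hu : u ≠ 0) :
    extDeriv (fun v => fwd₀ n v (w v)) u = fwd₀ (n + 1) u (poissonDiff piSharp w u) +
      ∑ k, wedge2 (gamma k u) (fwd₁ k n u (w u)) := by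
  have h0 : extDeriv (fun v => fwd₀ n v (w v)) u =
      wedgePhi (n + 1) u (extDeriv (fun v => pullOmega n v (w v)) u) :=
    extDeriv_wedgePhi (contDiffAt_pullOmega hw hu)
  have hwd : DifferentiableAt ℝ w u := hw.differentiable (by simp) u
  have hWd := isHomogeneous_omegaFlat.differentiableAt hu
  rw [h0, ← wedgePhi_comp_leafProj hu]
  cases n with
  | zero =>
    have h := comp_extDeriv_zero hwd hWd (piSharp_comp_omegaFlat hu) (omegaFlat_comp_leafProj u)
    refine (congrArg (wedgePhi 1 u) h).trans ?_
    have h1 : ∑ k, wedge2 (gamma k u) (fwd₁ k 0 u (w u)) = 0 :=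
      Finset.sum_eq_zero fun k _ => wedge2_zero _
    rw [h1, add_zero]
    rfl
  | succ n =>
    have h := comp_extDeriv_succ (γ := fun k => gamma k u) (α := fun k => dfL k u) hwd hWd
      (piSharp_comp_omegaFlat hu) (omegaFlat_comp_leafProj u) (koszulBracket_piSharp_antisymm u)
      (fderiv_omegaFlat_sub hu)
    refine (congrArg (wedgePhi (n + 2) u) h).trans ?_
    rw [map_add, map_sum]
    refine congrArg₂ (· + ·) rfl (Finset.sum_congr rfl fun k _ => ?_)
    have h1 := pullOmega_comp_leafProj u ((w u).curryLeft (dfL k u))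
    rw [pullOmega_apply] at h1
    rw [← h1, ← comp_wedge2, wedgePhi_comp_leafProj hu, ← wedge2_wedgePhi]
    rfl

theorem fwd₁_curryLeft_self (k : Fin 2) (u : Sl2) (w : MultiVec Sl2 (n + 1)) :
    fwd₁ k n u (w.curryLeft (dfL k u)) = 0 := by
  cases n with
  | zero => rfl
  | succ n =>
    change fwd₀ n u ((w.curryLeft (dfL k u)).curryLeft (dfL k u)) = 0
    rw [ContinuousAlternatingMap.curryLeft_same, map_zero]

theorem fwd₁_zero_curryLeft (u : Sl2) (w : MultiVec Sl2 (n + 1)) :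
    fwd₁ 0 n u (w.curryLeft (dfL 1 u)) = -fwd₂ (n + 1) u w := by
  cases n with
  | zero => exact neg_zero.symm
  | succ n =>
    change fwd₀ n u ((w.curryLeft (dfL 1 u)).curryLeft (dfL 0 u)) =
      -fwd₀ n u ((w.curryLeft (dfL 0 u)).curryLeft (dfL 1 u))
    rw [curryLeft_curryLeft, map_neg]

theorem extDeriv_zero (u : Sl2) : extDeriv (fun _ => (0 : Form n)) u = 0 := by
  rw [extDeriv, fderiv_fun_const]
  exact map_zero (alternatizeUncurryFinCLM ℝ Sl2 ℝ)

/-- This is `extDeriv_fwd₀` for `i_{df_k} w`, with `d_π` anticommuting past the contraction. Of the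
two correction terms, the one repeating `df_k` vanishes and the other is `fwd₂` up to sign. -/
theorem extDeriv_fwd₁ {w : Sl2 → MultiVec Sl2 n} (hw : ContDiff ℝ ∞ w) {u : Sl2} (hu : u ≠ 0)
    (k : Fin 2) :
    extDeriv (fun v => fwd₁ k n v (w v)) u = -fwd₁ k (n + 1) u (poissonDiff piSharp w u) +
      ![wedge2 (gamma 1 u) (fwd₂ n u (w u)), -wedge2 (gamma 0 u) (fwd₂ n u (w u))] k := by
  cases n with
  | zero =>
    have h1 : (poissonDiff piSharp w u).curryLeft (dfL k u) = 0 :=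
      curryLeft_poissonDiff_zero (α := dfL k) (piSharp_dfL k u) w
    have h2 : fwd₁ k 1 u (poissonDiff piSharp w u) = 0 := by
      change fwd₀ 0 u ((poissonDiff piSharp w u).curryLeft (dfL k u)) = 0
      rw [h1, map_zero]
    have h3 : fwd₂ 0 u (w u) = 0 := rfl
    rw [h2, h3, wedge2_zero, wedge2_zero, neg_zero]
    refine (extDeriv_zero u).trans ?_
    fin_cases k <;> exact (zero_add (0 : Form 2)).symm
  | succ n =>
    refine (extDeriv_fwd₀ (contDiff_curryLeft_dfL k hw) hu).trans ?_
    have h1 : fwd₁ k (n + 2) u (poissonDiff piSharp w u) =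
        -fwd₀ (n + 1) u (poissonDiff piSharp (fun y => (w y).curryLeft (dfL k y)) u) := by
      rw [← map_neg, ← curryLeft_poissonDiff_dfL k hw]
      rfl
    rw [h1, neg_neg, Fin.sum_univ_two]
    congr 1
    fin_cases k
    · have h2 := fwd₁_curryLeft_self 0 u (w u)
      change wedge2 (gamma 0 u) (fwd₁ 0 n u ((w u).curryLeft (dfL 0 u))) + _ = _
      rw [h2, wedge2_zero, zero_add]
      rfl
    · have h2 := fwd₁_curryLeft_self 1 u (w u)
      have h3 := fwd₁_zero_curryLeft u (w u)
      change wedge2 (gamma 0 u) (fwd₁ 0 n u ((w u).curryLeft (dfL 1 u))) +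
        wedge2 (gamma 1 u) (fwd₁ 1 n u ((w u).curryLeft (dfL 1 u))) = _
      rw [h2, h3, wedge2_zero, add_zero, wedge2_neg]
      rfl

/-- The correction term would need a third contraction, which repeats `df₁` and therefore vanishes.
-/
theorem extDeriv_fwd₂ {w : Sl2 → MultiVec Sl2 n} (hw : ContDiff ℝ ∞ w) {u : Sl2} (hu : u ≠ 0) :
    extDeriv (fun v => fwd₂ n v (w v)) u = fwd₂ (n + 1) u (poissonDiff piSharp w u) := by
  cases n with
  | zero => exact extDeriv_zero u
  | succ n =>
    refine (extDeriv_fwd₁ (contDiff_curryLeft_dfL 0 hw) hu 1).trans ?_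
    have h1 : fwd₂ n u ((w u).curryLeft (dfL 0 u)) = 0 := by
      cases n with
      | zero => rfl
      | succ n =>
        change fwd₁ 1 n u (((w u).curryLeft (dfL 0 u)).curryLeft (dfL 0 u)) = 0
        rw [ContinuousAlternatingMap.curryLeft_same, map_zero]
    have h2 : fwd₂ (n + 2) u (poissonDiff piSharp w u) =
        -fwd₁ 1 (n + 1) u (poissonDiff piSharp (fun y => (w y).curryLeft (dfL 0 y)) u) := by
      rw [← map_neg, ← curryLeft_poissonDiff_dfL 0 hw]
      rfl
    rw [h1, h2]
    change -_ + -wedge2 (gamma 0 u) 0 = _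
    rw [wedge2_zero, neg_zero, add_zero]

end ChainMap

/-! ### Inversion of the operators -/

section Inverse

variable {n : ℕ}

/-- The contraction `η ↦ i_{V_2} i_{V_1} η`. -/
def contractV (n : ℕ) (u : Sl2) : Form (n + 2) →L[ℝ] Form n :=
  interiorL Sl2 n (V 1 u) ∘L interiorL Sl2 (n + 1) (V 0 u)

/-- The operator `η ↦ π^* (i_{V_2} i_{V_1} η)`. -/
def bwd₀ (n : ℕ) (u : Sl2) : Form (n + 2) →L[ℝ] MultiVec Sl2 n := pullPi n u ∘L contractV n u

/-- The operator `η ↦ V_k ∧ π^* (i_{V_2} i_{V_1} η)`. -/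
def bwd₁ (k : Fin 2) : (n : ℕ) → Sl2 → Form (n + 1) →L[ℝ] MultiVec Sl2 n
  | 0, _ => 0
  | n + 1, u => wedge1L (Sl2 →L[ℝ] ℝ) n (evV k u) ∘L bwd₀ n u

/-- The operator `η ↦ V_1 ∧ V_2 ∧ π^* (i_{V_2} i_{V_1} η)`. -/
def bwd₂ : (n : ℕ) → Sl2 → Form n →L[ℝ] MultiVec Sl2 n
  | 0, _ => 0
  | n + 1, u => wedge1L (Sl2 →L[ℝ] ℝ) n (evV 0 u) ∘L bwd₁ 1 n u

theorem contractV_wedgePhi {u : Sl2} (hu : u ≠ 0) (η : Form n) :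
    contractV n u (wedgePhi n u η) =
      η.compContinuousLinearMap (leafProj (fun k => dfL k u) (fun k => V k u)) :=
  curryLeft_curryLeft_wedge1_wedge1 (a := fun k => dfL k u) (x := fun k => V k u)
    (fun j k => dfL_V hu j k) η

theorem bwd₀_fwd₀ {u : Sl2} (hu : u ≠ 0) (w : MultiVec Sl2 n) :
    bwd₀ n u (fwd₀ n u w) =
      w.compContinuousLinearMap (leafProj (fun k => evV k u) (fun k => dfL k u)) := by
  change pullPi n u (contractV n u (wedgePhi n u (pullOmega n u w))) = _
  rw [contractV_wedgePhi hu, pullOmega_comp_leafProj, pullPi_apply, pullOmega_apply, ← comp_comp,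
    omegaFlat_comp_piSharp hu]

/-- Each composite `bwd₀ ∘ fwd₀` is the projection to multivectors annihilated by the `df_k`, so the
sum is the decomposition along the dual pair of `evV` and `dfL`. -/
theorem bwd_fwd {u : Sl2} (hu : u ≠ 0) (w : MultiVec Sl2 n) :
    bwd₀ n u (fwd₀ n u w) + ∑ k, bwd₁ k n u (fwd₁ k n u w) + bwd₂ n u (fwd₂ n u w) = w := by
  have h : ∀ j k, evV j u (dfL k u) = if j = k then 1 else 0 := fun j k => evV_dfL hu j k
  match n with
  | 0 =>
    have h1 : ∑ k, bwd₁ k 0 u (fwd₁ k 0 u w) = 0 := Finset.sum_eq_zero fun k _ => rfl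
    have h2 : bwd₂ 0 u (fwd₂ 0 u w) = 0 := rfl
    rw [h1, h2, bwd₀_fwd₀ hu, add_zero, add_zero, comp_id_of_degree_zero]
  | 1 =>
    have h1 : ∀ k, bwd₁ k 1 u (fwd₁ k 1 u w) = wedge1 (evV k u)
        (bwd₀ 0 u (fwd₀ 0 u (w.curryLeft (dfL k u)))) := fun k => rfl
    have h2 : bwd₂ 1 u (fwd₂ 1 u w) = 0 := wedge1_zero _
    simp only [h1, h2, bwd₀_fwd₀ hu, add_zero]
    exact (decomposition_one (a := fun k => evV k u) (x := fun k => dfL k u) h w).symm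
  | n + 2 =>
    have h1 : ∀ k, bwd₁ k (n + 2) u (fwd₁ k (n + 2) u w) = wedge1 (evV k u)
        (bwd₀ (n + 1) u (fwd₀ (n + 1) u (w.curryLeft (dfL k u)))) := fun k => rfl
    have h2 : bwd₂ (n + 2) u (fwd₂ (n + 2) u w) = wedge1 (evV 0 u) (wedge1 (evV 1 u)
        (bwd₀ n u (fwd₀ n u ((w.curryLeft (dfL 0 u)).curryLeft (dfL 1 u))))) := rfl
    simp only [h1, h2, bwd₀_fwd₀ hu]
    exact (decomposition (a := fun k => evV k u) (x := fun k => dfL k u) h w).symm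

/-- Only on the image of `φ ∧ ·` is this the identity: `contractV` recovers the leafwise part, and
`φ ∧ ·` forgets the remainder. -/
theorem fwd₀_bwd₀ {u : Sl2} (hu : u ≠ 0) (η : Form n) :
    fwd₀ n u (bwd₀ n u (wedgePhi n u η)) = wedgePhi n u η := by
  change wedgePhi n u (pullOmega n u (pullPi n u (contractV n u (wedgePhi n u η)))) = _
  rw [contractV_wedgePhi hu, pullPi_apply, pullOmega_apply, ← comp_comp,
    piSharp_comp_omegaFlat hu, wedgePhi_comp_leafProj hu, wedgePhi_comp_leafProj hu]

theorem wedge1_zero_left {E : Type*} [NormedAddCommGroup E] [NormedSpace ℝ E]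
    (η : E [⋀^Fin n]→L[ℝ] ℝ) : wedge1 (0 : E →L[ℝ] ℝ) η = 0 := by
  rw [← wedge1L_apply, map_zero]
  rfl

/-- Pullback by `ω̃₁` sends the vector `V_k` to zero. This and `π df_k = 0` in `curryLeft_bwd₀`
remove the off-diagonal composites. -/
theorem fwd₀_wedge1 (u : Sl2) (k : Fin 2) (w : MultiVec Sl2 n) :
    fwd₀ (n + 1) u (wedge1 (evV k u) w) = 0 := by
  change wedgePhi (n + 1) u ((wedge1 (evV k u) w).compContinuousLinearMap (omegaFlat u)) = 0
  rw [comp_wedge1, evV_comp_omegaFlat, wedge1_zero_left, map_zero]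

theorem curryLeft_bwd₀ (u : Sl2) (k : Fin 2) (η : Form (n + 3)) :
    (bwd₀ (n + 1) u η).curryLeft (dfL k u) = 0 := by
  change ((contractV (n + 1) u η).compContinuousLinearMap (piSharp u)).curryLeft (dfL k u) = 0
  rw [ContinuousAlternatingMap.curryLeft_compContinuousLinearMap, piSharp_dfL, map_zero]
  rfl

theorem fwd₁_bwd₀ (u : Sl2) (k : Fin 2) (η : Form (n + 2)) : fwd₁ k n u (bwd₀ n u η) = 0 := by
  cases n with
  | zero => rfl
  | succ n =>
    change fwd₀ n u ((bwd₀ (n + 1) u η).curryLeft (dfL k u)) = 0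
    rw [curryLeft_bwd₀, map_zero]

theorem fwd₀_bwd₁ (u : Sl2) (k : Fin 2) (η : Form (n + 1)) : fwd₀ n u (bwd₁ k n u η) = 0 := by
  cases n with
  | zero => exact map_zero _
  | succ n => exact fwd₀_wedge1 u k _

theorem fwd₀_bwd₂ (u : Sl2) (η : Form n) : fwd₀ n u (bwd₂ n u η) = 0 := by
  cases n with
  | zero => exact map_zero _
  | succ n => exact fwd₀_wedge1 u 0 _

theorem curryLeft_wedge1_bwd₀ {u : Sl2} (hu : u ≠ 0) (j k : Fin 2) (η : Form (n + 2)) :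
    (wedge1 (evV k u) (bwd₀ n u η)).curryLeft (dfL j u) =
      if j = k then bwd₀ n u η else 0 := by
  have h : evV k u (dfL j u) • bwd₀ n u η = if j = k then bwd₀ n u η else 0 := by
    rw [evV_dfL hu, ite_smul, one_smul, zero_smul]
    simp only [eq_comm]
  cases n with
  | zero => rw [curryLeft_wedge1_zero, h]
  | succ n => rw [curryLeft_wedge1, h, curryLeft_bwd₀, wedge1_zero, sub_zero]

theorem fwd₁_bwd₁ {u : Sl2} (hu : u ≠ 0) (j k : Fin 2) (η : Form (n + 2)) :
    fwd₁ j (n + 1) u (bwd₁ k (n + 1) u η) = if j = k then fwd₀ n u (bwd₀ n u η) else 0 := by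
  change fwd₀ n u ((wedge1 (evV k u) (bwd₀ n u η)).curryLeft (dfL j u)) = _
  rw [curryLeft_wedge1_bwd₀ hu]
  split_ifs
  · rfl
  · exact map_zero _

theorem curryLeft_bwd₂ {u : Sl2} (hu : u ≠ 0) (j : Fin 2) (η : Form (n + 2)) :
    (bwd₂ (n + 2) u η).curryLeft (dfL j u) =
      ![bwd₁ 1 (n + 1) u η, -bwd₁ 0 (n + 1) u η] j := by
  change (wedge1 (evV 0 u) (wedge1 (evV 1 u) (bwd₀ n u η))).curryLeft (dfL j u) = _
  rw [curryLeft_wedge1, curryLeft_wedge1_bwd₀ hu, evV_dfL hu]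
  fin_cases j
  · simp [wedge1_zero]
    rfl
  · simp
    rfl

theorem fwd₁_bwd₂ {u : Sl2} (hu : u ≠ 0) (j : Fin 2) (η : Form n) :
    fwd₁ j n u (bwd₂ n u η) = 0 := by
  match n with
  | 0 => rfl
  | 1 =>
    have h : bwd₂ 1 u η = 0 := wedge1_zero _
    rw [h, map_zero]
  | n + 2 =>
    change fwd₀ (n + 1) u ((bwd₂ (n + 2) u η).curryLeft (dfL j u)) = 0
    rw [curryLeft_bwd₂ hu]
    fin_cases j
    · exact fwd₀_bwd₁ u 1 η
    · change fwd₀ (n + 1) u (-bwd₁ 0 (n + 1) u η) = 0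
      rw [map_neg, fwd₀_bwd₁ u 0 η, neg_zero]

theorem fwd₂_bwd₀ (u : Sl2) (η : Form (n + 2)) : fwd₂ n u (bwd₀ n u η) = 0 := by
  cases n with
  | zero => rfl
  | succ n =>
    change fwd₁ 1 n u ((bwd₀ (n + 1) u η).curryLeft (dfL 0 u)) = 0
    rw [curryLeft_bwd₀, map_zero]

theorem fwd₂_bwd₁ {u : Sl2} (hu : u ≠ 0) (k : Fin 2) (η : Form (n + 1)) :
    fwd₂ n u (bwd₁ k n u η) = 0 := by
  cases n with
  | zero => rfl
  | succ n =>
    change fwd₁ 1 n u ((wedge1 (evV k u) (bwd₀ n u η)).curryLeft (dfL 0 u)) = 0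
    rw [curryLeft_wedge1_bwd₀ hu]
    split_ifs
    · exact fwd₁_bwd₀ u 1 η
    · exact map_zero _

theorem fwd₂_bwd₂ {u : Sl2} (hu : u ≠ 0) (η : Form (n + 2)) :
    fwd₂ (n + 2) u (bwd₂ (n + 2) u η) = fwd₀ n u (bwd₀ n u η) := by
  change fwd₁ 1 (n + 1) u ((bwd₂ (n + 2) u η).curryLeft (dfL 0 u)) = _
  rw [curryLeft_bwd₂ hu]
  exact fwd₁_bwd₁ hu 1 1 η

end Inverse

end FlatPoisson

end

open scoped Topology

noncomputable section

namespace FlatPoisson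

set_option maxSynthPendingDepth 6

open ContinuousAlternatingMap (alternatizeUncurryFinCLM)

/-! ### The isomorphism on fibres -/

section Fibre

theorem IsHomogeneous.comp_left {H E F G : Type*} [NormedAddCommGroup H] [NormedSpace ℝ H]
    [NormedAddCommGroup E] [NormedSpace ℝ E] [NormedAddCommGroup F] [NormedSpace ℝ F]
    [NormedAddCommGroup G] [NormedSpace ℝ G] {e : ℤ} {c : H → E →L[ℝ] F}
    (hc : IsHomogeneous e c) (L : F →L[ℝ] G) : IsHomogeneous e fun u => L ∘L c u :=
  hc.comp_clm (ContinuousLinearMap.compL ℝ E F G L)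

theorem IsHomogeneous.comp_right {H E F G : Type*} [NormedAddCommGroup H] [NormedSpace ℝ H]
    [NormedAddCommGroup E] [NormedSpace ℝ E] [NormedAddCommGroup F] [NormedSpace ℝ F]
    [NormedAddCommGroup G] [NormedSpace ℝ G] {e : ℤ} {c : H → F →L[ℝ] G}
    (hc : IsHomogeneous e c) (L : E →L[ℝ] F) : IsHomogeneous e fun u => c u ∘L L :=
  hc.comp_clm ((ContinuousLinearMap.compL ℝ E F G).flip L)

variable {n : ℕ}

/-- The inclusion of the summand `𝒞ⁿ`. -/
def inc₀ (n : ℕ) : Form (n + 2) →L[ℝ] Fib n := ContinuousLinearMap.inl ℝ _ _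

/-- The inclusion of the summand `𝒞ⁿ⁻¹ ⊗ e_k`. -/
def inc₁ (n : ℕ) (k : Fin 2) : Form (n + 1) →L[ℝ] Fib n :=
  ContinuousLinearMap.inr ℝ _ _ ∘L ContinuousLinearMap.inl ℝ _ _ ∘L
    ContinuousLinearMap.single ℝ (fun _ : Fin 2 => Form (n + 1)) k

/-- The inclusion of the summand `𝒞ⁿ⁻² ⊗ e₁ ∧ e₂`. -/
def inc₂ (n : ℕ) : Form n →L[ℝ] Fib n :=
  ContinuousLinearMap.inr ℝ _ _ ∘L ContinuousLinearMap.inr ℝ _ _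

/-- The projection to the summand `𝒞ⁿ`. -/
def proj₀ (n : ℕ) : Fib n →L[ℝ] Form (n + 2) := ContinuousLinearMap.fst ℝ _ _

/-- The projection to the summand `𝒞ⁿ⁻¹ ⊗ e_k`. -/
def proj₁ (n : ℕ) (k : Fin 2) : Fib n →L[ℝ] Form (n + 1) :=
  ContinuousLinearMap.proj k ∘L ContinuousLinearMap.fst ℝ _ _ ∘L ContinuousLinearMap.snd ℝ _ _

/-- The projection to the summand `𝒞ⁿ⁻² ⊗ e₁ ∧ e₂`. -/
def proj₂ (n : ℕ) : Fib n →L[ℝ] Form n :=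
  ContinuousLinearMap.snd ℝ _ _ ∘L ContinuousLinearMap.snd ℝ _ _

theorem inc_add_inc_add_inc (η₀ : Form (n + 2)) (η₁ : Fin 2 → Form (n + 1)) (η₂ : Form n) :
    inc₀ n η₀ + ∑ k, inc₁ n k (η₁ k) + inc₂ n η₂ = (η₀, η₁, η₂) := by
  refine Prod.ext ?_ (Prod.ext (funext fun i => ?_) ?_)
  · simp [inc₀, inc₁, inc₂]
  · fin_cases i <;> simp [inc₀, inc₁, inc₂]
  · simp [inc₀, inc₁, inc₂]

/-- The isomorphism from multivectors to cochains at the point `u`. -/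
def fwd (n : ℕ) (u : Sl2) : MultiVec Sl2 n →L[ℝ] Fib n :=
  inc₀ n ∘L fwd₀ n u + (inc₁ n 0 ∘L ((-1 : ℝ) ^ n • fwd₁ 0 n u) +
    inc₁ n 1 ∘L ((-1 : ℝ) ^ n • fwd₁ 1 n u)) + inc₂ n ∘L fwd₂ n u

/-- The inverse of `fwd`. -/
def bwd (n : ℕ) (u : Sl2) : Fib n →L[ℝ] MultiVec Sl2 n :=
  bwd₀ n u ∘L proj₀ n + (((-1 : ℝ) ^ n • bwd₁ 0 n u) ∘L proj₁ n 0 +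
    ((-1 : ℝ) ^ n • bwd₁ 1 n u) ∘L proj₁ n 1) + bwd₂ n u ∘L proj₂ n

/-- The operator `δ` at the point `u`. -/
def deltaL (n : ℕ) (u : Sl2) : Fib n →L[ℝ] Fib (n + 1) :=
  inc₀ (n + 1) ∘L ((-1 : ℝ) ^ (n + 1) • ∑ k, wedge2L Sl2 (n + 1) (gamma k u) ∘L proj₁ n k) +
    (inc₁ (n + 1) 0 ∘L (-((-1 : ℝ) ^ n • wedge2L Sl2 n (gamma 1 u) ∘L proj₂ n)) +
      inc₁ (n + 1) 1 ∘L ((-1 : ℝ) ^ n • wedge2L Sl2 n (gamma 0 u) ∘L proj₂ n))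

theorem fwd_apply (u : Sl2) (w : MultiVec Sl2 n) :
    fwd n u w = (fwd₀ n u w, fun k => (-1 : ℝ) ^ n • fwd₁ k n u w, fwd₂ n u w) := by
  rw [← inc_add_inc_add_inc, Fin.sum_univ_two]
  rfl

theorem bwd_apply (u : Sl2) (ξ : Fib n) :
    bwd n u ξ = bwd₀ n u ξ.1 + ∑ k, (-1 : ℝ) ^ n • bwd₁ k n u (ξ.2.1 k) + bwd₂ n u ξ.2.2 := by
  rw [Fin.sum_univ_two]
  rfl

theorem deltaL_apply (ξ : Sl2 → Fib n) (u : Sl2) : deltaL n u (ξ u) = deltaOp ξ u := by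
  rw [deltaOp, ← inc_add_inc_add_inc, map_zero, add_zero]
  simp only [deltaL, add_apply, sum_apply, ContinuousLinearMap.comp_apply, smul_apply,
    neg_apply, wedge2L_apply]
  refine congrArg₂ (· + ·) rfl ?_
  rw [Fin.sum_univ_two]
  rfl

theorem bwd_fwd_apply {u : Sl2} (hu : u ≠ 0) (w : MultiVec Sl2 n) : bwd n u (fwd n u w) = w := by
  rw [bwd_apply, fwd_apply]
  simp only [map_smul, smul_smul, ← mul_pow, neg_one_mul, neg_neg, one_pow, one_smul]
  exact bwd_fwd hu w

/-- The degree is `2 - n`; from `n = 5` on the operator vanishes off the origin and is homogeneous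
of any degree. -/
theorem exists_isHomogeneous_fwd₀ (n : ℕ) : ∃ e : ℤ, -2 ≤ e ∧ IsHomogeneous e (fwd₀ n) := by
  rcases Nat.lt_or_ge n 5 with hn | hn
  · exact ⟨2 + -n, by omega, (isHomogeneous_wedgePhi n).clm_comp (isHomogeneous_pullOmega n)⟩
  · refine ⟨0, by norm_num, (IsHomogeneous.zero 0).congr fun u hu => ?_⟩
    ext1 w
    have h := comp_omegaFlat_eq_zero hu hn w
    change wedgePhi n u (w.compContinuousLinearMap (omegaFlat u)) = 0
    rw [h, map_zero]

theorem exists_isHomogeneous_fwd₁ (k : Fin 2) (n : ℕ) :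
    ∃ e : ℤ, -2 ≤ e ∧ IsHomogeneous e (fwd₁ k n) := by
  cases n with
  | zero => exact ⟨0, by norm_num, IsHomogeneous.zero 0⟩
  | succ n =>
    obtain ⟨e, he, h⟩ := exists_isHomogeneous_fwd₀ n
    exact ⟨e + 1, by omega,
      h.clm_comp ((IsHomogeneous.clm (dfL k)).comp_clm (interiorL (Sl2 →L[ℝ] ℝ) n))⟩

theorem exists_isHomogeneous_fwd₂ (n : ℕ) : ∃ e : ℤ, -2 ≤ e ∧ IsHomogeneous e (fwd₂ n) := by
  cases n with
  | zero => exact ⟨0, by norm_num, IsHomogeneous.zero 0⟩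
  | succ n =>
    obtain ⟨e, he, h⟩ := exists_isHomogeneous_fwd₁ 1 n
    exact ⟨e + 1, by omega,
      h.clm_comp ((IsHomogeneous.clm (dfL 0)).comp_clm (interiorL (Sl2 →L[ℝ] ℝ) n))⟩

theorem exists_isHomogeneous_bwd₀ (n : ℕ) : ∃ e : ℤ, -2 ≤ e ∧ IsHomogeneous e (bwd₀ n) :=
  ⟨n + (-1 + -1), by omega, (isHomogeneous_pullPi n).clm_comp
    (((isHomogeneous_V 1).comp_clm (interiorL Sl2 n)).clm_comp
      ((isHomogeneous_V 0).comp_clm (interiorL Sl2 (n + 1))))⟩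

theorem exists_isHomogeneous_bwd₁ (k : Fin 2) (n : ℕ) :
    ∃ e : ℤ, -3 ≤ e ∧ IsHomogeneous e (bwd₁ k n) := by
  cases n with
  | zero => exact ⟨0, by norm_num, IsHomogeneous.zero 0⟩
  | succ n =>
    obtain ⟨e, he, h⟩ := exists_isHomogeneous_bwd₀ n
    exact ⟨-1 + e, by omega,
      ((isHomogeneous_evV k).comp_clm (wedge1L (Sl2 →L[ℝ] ℝ) n)).clm_comp h⟩

/-- Two factors `V` come from the contraction and two from the wedge products, each of degree -1,
while `π` contributes a nonnegative degree. -/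
theorem exists_isHomogeneous_bwd₂ (n : ℕ) : ∃ e : ℤ, -4 ≤ e ∧ IsHomogeneous e (bwd₂ n) := by
  cases n with
  | zero => exact ⟨0, by norm_num, IsHomogeneous.zero 0⟩
  | succ n =>
    obtain ⟨e, he, h⟩ := exists_isHomogeneous_bwd₁ 1 n
    exact ⟨-1 + e, by omega,
      ((isHomogeneous_evV 0).comp_clm (wedge1L (Sl2 →L[ℝ] ℝ) n)).clm_comp h⟩

theorem hasPoleLE_inc₁_comp (k : Fin 2) (n : ℕ) :
    HasPoleLE 2 fun u => inc₁ n k ∘L ((-1 : ℝ) ^ n • fwd₁ k n u) := by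
  obtain ⟨e, he, h⟩ := exists_isHomogeneous_fwd₁ k n
  exact ((h.const_smul ((-1 : ℝ) ^ n)).comp_left (inc₁ n k)).hasPoleLE he

theorem hasPoleLE_fwd (n : ℕ) : HasPoleLE 2 (fwd n) := by
  obtain ⟨e₀, he₀, h₀⟩ := exists_isHomogeneous_fwd₀ n
  obtain ⟨e₂, he₂, h₂⟩ := exists_isHomogeneous_fwd₂ n
  have h₀' := (h₀.comp_left (inc₀ n)).hasPoleLE he₀
  have h₂' := (h₂.comp_left (inc₂ n)).hasPoleLE he₂
  exact (h₀'.add ((hasPoleLE_inc₁_comp 0 n).add (hasPoleLE_inc₁_comp 1 n))).add h₂'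

theorem hasPoleLE_comp_proj₁ (k : Fin 2) (n : ℕ) :
    HasPoleLE 4 fun u => ((-1 : ℝ) ^ n • bwd₁ k n u) ∘L proj₁ n k := by
  obtain ⟨e, he, h⟩ := exists_isHomogeneous_bwd₁ k n
  have he' : -((4 : ℕ) : ℤ) ≤ e := by
    push_cast
    omega
  exact ((h.const_smul ((-1 : ℝ) ^ n)).comp_right (proj₁ n k)).hasPoleLE he'

theorem hasPoleLE_bwd (n : ℕ) : HasPoleLE 4 (bwd n) := by
  obtain ⟨e₀, he₀, h₀⟩ := exists_isHomogeneous_bwd₀ n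
  obtain ⟨e₂, he₂, h₂⟩ := exists_isHomogeneous_bwd₂ n
  have he' : -((4 : ℕ) : ℤ) ≤ e₀ := by
    push_cast
    omega
  have h₀' := (h₀.comp_right (proj₀ n)).hasPoleLE he'
  have h₂' := (h₂.comp_right (proj₂ n)).hasPoleLE he₂
  exact (h₀'.add ((hasPoleLE_comp_proj₁ 0 n).add (hasPoleLE_comp_proj₁ 1 n))).add h₂'

theorem isHomogeneous_wedge2L_gamma (k : Fin 2) {n m : ℕ} (L : Fib n →L[ℝ] Form m) :
    IsHomogeneous (-3) fun u => wedge2L Sl2 m (gamma k u) ∘L L :=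
  ((isHomogeneous_gamma k).comp_clm (wedge2L Sl2 m)).comp_right L

theorem isHomogeneous_deltaL (n : ℕ) : IsHomogeneous (-3) (deltaL n) := by
  have h₀ := ((IsHomogeneous.sum Finset.univ fun k _ =>
    isHomogeneous_wedge2L_gamma k (proj₁ n k)).const_smul ((-1 : ℝ) ^ (n + 1))).comp_left
      (inc₀ (n + 1))
  have h₁ := ((isHomogeneous_wedge2L_gamma 1 (proj₂ n)).const_smul ((-1 : ℝ) ^ n)).neg.comp_left
    (inc₁ (n + 1) 0)
  have h₂ := ((isHomogeneous_wedge2L_gamma 0 (proj₂ n)).const_smul ((-1 : ℝ) ^ n)).comp_left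
    (inc₁ (n + 1) 1)
  exact h₀.add (h₁.add h₂)

end Fibre

/-! ### The flat foliated complex -/

section Complex

variable {n m : ℕ}

theorem mem_CC_iff {p : ℕ} {f : Sl2 → Form (p + 2)} :
    f ∈ CC p ↔ ∃ η ∈ flatSections Sl2 (Form p), ∀ u, f u = wedgePhi p u (η u) := by
  rw [CC, Submodule.mem_map]
  refine exists_congr fun η => and_congr_right fun _ => ?_
  rw [eq_comm, funext_iff]
  exact forall_congr' fun u => by rw [← wedge2_phi]; rfl

theorem clm_apply_mem_flatSections {E F : Type*} [NormedAddCommGroup E] [NormedSpace ℝ E]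
    [NormedAddCommGroup F] [NormedSpace ℝ F] (L : E →L[ℝ] F) {s : Sl2 → E}
    (hs : s ∈ flatSections Sl2 E) : (fun u => L (s u)) ∈ flatSections Sl2 F :=
  (IsHomogeneous.const (H := Sl2) L).clm_apply_mem_flatSections hs

theorem CCForm_le : ∀ m : ℕ, CCForm m ≤ flatSections Sl2 (Form m)
  | 0 => bot_le
  | 1 => bot_le
  | p + 2 => fun f hf => by
    obtain ⟨η, hη, h⟩ := mem_CC_iff.mp hf
    rw [funext h]
    exact (isHomogeneous_wedgePhi p).clm_apply_mem_flatSections hη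

theorem cochains_le (n : ℕ) : cochains n ≤ flatSections Sl2 (Fib n) := by
  rintro ξ ⟨h₀, h₁, h₂⟩
  have h : ξ = (fun u => inc₀ n (ξ u).1) + ∑ k, (fun u => inc₁ n k ((ξ u).2.1 k)) +
      fun u => inc₂ n (ξ u).2.2 := by
    funext u
    rw [Pi.add_apply, Pi.add_apply, Finset.sum_apply, inc_add_inc_add_inc]
  rw [h]
  exact Submodule.add_mem _ (Submodule.add_mem _
    (clm_apply_mem_flatSections _ (CCForm_le _ h₀))
    (Submodule.sum_mem _ fun k _ => clm_apply_mem_flatSections _ (CCForm_le _ (h₁ k))))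
    (clm_apply_mem_flatSections _ (CCForm_le _ h₂))

theorem extDeriv_mem_flatSections {η : Sl2 → Form n} (hη : η ∈ flatSections Sl2 (Form n)) :
    extDeriv η ∈ flatSections Sl2 (Form (n + 1)) :=
  clm_apply_mem_flatSections (alternatizeUncurryFinCLM ℝ Sl2 ℝ) (fderiv_mem_flatSections hη)

/-- As `φ` is closed and even, `d(φ ∧ η) = φ ∧ dη`. -/
theorem extDeriv_mem_CCForm : ∀ {m : ℕ} {f : Sl2 → Form m}, f ∈ CCForm m →
    extDeriv f ∈ CCForm (m + 1)
  | 0, f, hf => by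
    have h : f = fun _ => 0 := hf
    have h' : extDeriv f = 0 := by
      rw [h]
      exact funext extDeriv_zero
    rw [h']
    exact Submodule.zero_mem _
  | 1, f, hf => by
    have h : f = fun _ => 0 := hf
    have h' : extDeriv f = 0 := by
      rw [h]
      exact funext extDeriv_zero
    rw [h']
    exact Submodule.zero_mem _
  | p + 2, f, hf => by
    obtain ⟨η, hη, h⟩ := mem_CC_iff.mp hf
    refine mem_CC_iff.mpr ⟨extDeriv η, extDeriv_mem_flatSections hη, fun u => ?_⟩
    rw [funext h]
    exact extDeriv_wedgePhi (contDiff_of_mem_flatSections hη).contDiffAt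

/-- Two-forms commute with `φ`, so `γ_k ∧ φ ∧ η = φ ∧ (γ_k ∧ η)`, and the flat form `η` absorbs the
pole of `γ_k`. -/
theorem wedge2_gamma_mem_CCForm (k : Fin 2) : ∀ {m : ℕ} {f : Sl2 → Form m}, f ∈ CCForm m →
    (fun u => wedge2 (gamma k u) (f u)) ∈ CCForm (m + 2)
  | 0, f, hf => by
    have h : f = fun _ => 0 := hf
    rw [h, funext fun u => wedge2_zero _]
    exact Submodule.zero_mem _
  | 1, f, hf => by
    have h : f = fun _ => 0 := hf
    rw [h, funext fun u => wedge2_zero _]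
    exact Submodule.zero_mem _
  | p + 2, f, hf => by
    obtain ⟨η, hη, h⟩ := mem_CC_iff.mp hf
    refine mem_CC_iff.mpr ⟨fun u => wedge2 (gamma k u) (η u), ?_, fun u => ?_⟩
    · exact ((isHomogeneous_gamma k).comp_clm (wedge2L Sl2 p)).clm_apply_mem_flatSections hη
    · rw [h, wedge2_wedgePhi]

theorem dOp_mem_cochains {ξ : Sl2 → Fib n} (hξ : ξ ∈ cochains n) : dOp ξ ∈ cochains (n + 1) :=
  ⟨extDeriv_mem_CCForm hξ.1, fun i => extDeriv_mem_CCForm (hξ.2.1 i), extDeriv_mem_CCForm hξ.2.2⟩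

theorem deltaOp_mem_cochains {ξ : Sl2 → Fib n} (hξ : ξ ∈ cochains n) :
    deltaOp ξ ∈ cochains (n + 1) := by
  refine ⟨?_, fun i => ?_, Submodule.zero_mem _⟩
  · have h := Submodule.smul_mem _ ((-1 : ℝ) ^ (n + 1)) (Submodule.sum_mem (t := Finset.univ) _
      fun k _ => wedge2_gamma_mem_CCForm k (hξ.2.1 k))
    refine (congrArg (· ∈ CCForm (n + 3)) (funext fun u => ?_)).mp h
    rw [Pi.smul_apply, Finset.sum_apply]
    rfl
  · fin_cases i
    · exact Submodule.neg_mem _ (Submodule.smul_mem _ _ (wedge2_gamma_mem_CCForm 1 hξ.2.2))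
    · exact Submodule.smul_mem _ _ (wedge2_gamma_mem_CCForm 0 hξ.2.2)

theorem fwd₀_mem_CCForm {w : Sl2 → MultiVec Sl2 n} (hw : w ∈ flatMultivectors n) :
    (fun u => fwd₀ n u (w u)) ∈ CCForm (n + 2) :=
  mem_CC_iff.mpr ⟨_, (isHomogeneous_pullOmega n).clm_apply_mem_flatSections hw, fun _ => rfl⟩

theorem curryLeft_dfL_mem (k : Fin 2) {w : Sl2 → MultiVec Sl2 (n + 1)}
    (hw : w ∈ flatMultivectors (n + 1)) :
    (fun u => (w u).curryLeft (dfL k u)) ∈ flatMultivectors n :=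
  ((IsHomogeneous.clm (dfL k)).comp_clm
    (interiorL (Sl2 →L[ℝ] ℝ) n)).clm_apply_mem_flatSections hw

theorem fwd₁_mem_CCForm (k : Fin 2) {w : Sl2 → MultiVec Sl2 n} (hw : w ∈ flatMultivectors n) :
    (fun u => fwd₁ k n u (w u)) ∈ CCForm (n + 1) := by
  cases n with
  | zero => exact Submodule.zero_mem _
  | succ n => exact fwd₀_mem_CCForm (curryLeft_dfL_mem k hw)

theorem fwd₂_mem_CCForm {w : Sl2 → MultiVec Sl2 n} (hw : w ∈ flatMultivectors n) :
    (fun u => fwd₂ n u (w u)) ∈ CCForm n := by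
  cases n with
  | zero => exact Submodule.zero_mem _
  | succ n => exact fwd₁_mem_CCForm 1 (curryLeft_dfL_mem 0 hw)

theorem fwd_mem_cochains {w : Sl2 → MultiVec Sl2 n} (hw : w ∈ flatMultivectors n) :
    (fun u => fwd n u (w u)) ∈ cochains n := by
  simp only [fwd_apply]
  exact ⟨fwd₀_mem_CCForm hw, fun k => Submodule.smul_mem _ _ (fwd₁_mem_CCForm k hw),
    fwd₂_mem_CCForm hw⟩

theorem fwd_bwd_apply {u : Sl2} (hu : u ≠ 0) {ξ : Sl2 → Fib n} (hξ : ξ ∈ cochains n) :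
    fwd n u (bwd n u (ξ u)) = ξ u := by
  obtain ⟨h₀, h₁, h₂⟩ := hξ
  rw [fwd_apply, bwd_apply]
  refine Prod.ext ?_ (Prod.ext (funext fun k => ?_) ?_)
  · obtain ⟨η, -, hη⟩ := mem_CC_iff.mp h₀
    simp only [map_add, map_sum, map_smul, fwd₀_bwd₁, fwd₀_bwd₂, smul_zero, Finset.sum_const_zero,
      add_zero]
    rw [hη, fwd₀_bwd₀ hu]
  -- In degree zero the components along `e_k` lie in `CCForm 1`, which is zero.
  · cases n with
    | zero =>
      have h : (ξ u).2.1 k = 0 := congrFun (h₁ k : (fun u => (ξ u).2.1 k) = 0) u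
      refine Eq.trans ?_ h.symm
      exact smul_zero _
    | succ n =>
      obtain ⟨η, -, hη⟩ := mem_CC_iff.mp (h₁ k)
      simp only [map_add, map_sum, map_smul, fwd₁_bwd₀, fwd₁_bwd₂ hu, fwd₁_bwd₁ hu, add_zero,
        zero_add, smul_ite, smul_zero, Finset.sum_ite_eq, Finset.mem_univ, if_true, smul_smul,
        ← mul_pow, neg_one_mul, neg_neg, one_pow, one_smul]
      rw [hη, fwd₀_bwd₀ hu]
  -- Below degree two there is no `e₁ ∧ e₂` component, since `CCForm 0` and `CCForm 1` are zero.
  · match n with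
    | 0 => exact (congrFun (h₂ : (fun u => (ξ u).2.2) = 0) u).symm
    | 1 =>
      refine Eq.trans ?_ (congrFun (h₂ : (fun u => (ξ u).2.2) = 0) u).symm
      rfl
    | n + 2 =>
      obtain ⟨η, -, hη⟩ := mem_CC_iff.mp h₂
      simp only [map_add, map_sum, map_smul, fwd₂_bwd₀, fwd₂_bwd₁ hu, smul_zero,
        Finset.sum_const_zero, zero_add]
      rw [fwd₂_bwd₂ hu, hη, fwd₀_bwd₀ hu]

/-- The isomorphism from flat multivector fields to the flat foliated complex. -/
def isoCochains (n : ℕ) : flatMultivectors n ≃ₗ[ℝ] cochains n where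
  toFun w := ⟨fun u => fwd n u (w.1 u), fwd_mem_cochains w.2⟩
  map_add' w w' := Subtype.ext (funext fun u => map_add (fwd n u) (w.1 u) (w'.1 u))
  map_smul' c w := Subtype.ext (funext fun u => map_smul (fwd n u) c (w.1 u))
  invFun ξ := ⟨fun u => bwd n u (ξ.1 u),
    (hasPoleLE_bwd n).clm_apply_mem_flatSections (cochains_le n ξ.2)⟩
  left_inv w := Subtype.ext <| funext fun u => by
    -- At the origin the inverse of `R²` takes a default value and the coefficients are not inverse
    -- to each other, but flat sections vanish there.
    rcases eq_or_ne u 0 with rfl | hu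
    · simp [apply_zero_of_mem_flatSections w.2]
    · exact bwd_fwd_apply hu _
  right_inv ξ := Subtype.ext <| funext fun u => by
    rcases eq_or_ne u 0 with rfl | hu
    · simp [apply_zero_of_mem_flatSections (cochains_le n ξ.2)]
    · exact fwd_bwd_apply hu ξ.2

/-- The exterior derivative on the flat foliated complex. -/
def dCochains (n : ℕ) : cochains n →ₗ[ℝ] cochains (n + 1) where
  toFun ξ := ⟨dOp ξ.1, dOp_mem_cochains ξ.2⟩
  map_add' ξ ξ' := Subtype.ext <| funext fun u => by
    have hd : ∀ {m : ℕ} {f : Sl2 → Form m}, f ∈ CCForm m → DifferentiableAt ℝ f u :=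
      fun hf => differentiable_of_mem_flatSections (CCForm_le _ hf) u
    exact Prod.ext (extDeriv_fun_add (hd ξ.2.1) (hd ξ'.2.1)) (Prod.ext
      (funext fun i => extDeriv_fun_add (hd (ξ.2.2.1 i)) (hd (ξ'.2.2.1 i)))
      (extDeriv_fun_add (hd ξ.2.2.2) (hd ξ'.2.2.2)))
  map_smul' c ξ := Subtype.ext <| funext fun u =>
    Prod.ext (extDeriv_fun_smul c _) (Prod.ext (funext fun i => extDeriv_fun_smul c _)
      (extDeriv_fun_smul c _))

/-- The operator `δ` on the flat foliated complex. -/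
def deltaCochains (n : ℕ) : cochains n →ₗ[ℝ] cochains (n + 1) where
  toFun ξ := ⟨deltaOp ξ.1, deltaOp_mem_cochains ξ.2⟩
  map_add' ξ ξ' := Subtype.ext <| funext fun u => by
    change deltaOp (ξ.1 + ξ'.1) u = deltaOp ξ.1 u + deltaOp ξ'.1 u
    rw [← deltaL_apply, ← deltaL_apply, ← deltaL_apply, Pi.add_apply, map_add]
  map_smul' c ξ := Subtype.ext <| funext fun u => by
    change deltaOp (c • ξ.1) u = c • deltaOp ξ.1 u
    rw [← deltaL_apply, ← deltaL_apply, Pi.smul_apply, map_smul]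

/-- The principal part of the Poisson differential. -/
def poissonSymbol (n : ℕ) (u : Sl2) : (Sl2 →L[ℝ] MultiVec Sl2 n) →L[ℝ] MultiVec Sl2 (n + 1) :=
  alternatizeUncurryFinCLM ℝ (Sl2 →L[ℝ] ℝ) ℝ ∘L
    (ContinuousLinearMap.compL ℝ (Sl2 →L[ℝ] ℝ) Sl2 (MultiVec Sl2 n)).flip (piSharp u)

theorem poissonSymbol_apply (u : Sl2) (A : Sl2 →L[ℝ] MultiVec Sl2 n) :
    poissonSymbol n u A =
      ContinuousAlternatingMap.alternatizeUncurryFin (A ∘L piSharp u) := rfl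

theorem isHomogeneous_poissonSymbol (n : ℕ) : IsHomogeneous 1 (poissonSymbol n) :=
  (isHomogeneous_piSharp.comp_clm
    (ContinuousLinearMap.compL ℝ (Sl2 →L[ℝ] ℝ) Sl2 (MultiVec Sl2 n)).flip).comp_left _

/-- For a linear Poisson structure the bracket of constant covectors does not depend on the base
point, so the zeroth-order part has constant coefficients. Preservation of flatness and linearity
follow from this form. -/
theorem exists_poissonDiff_eq (n : ℕ) :
    ∃ c : MultiVec Sl2 n →L[ℝ] MultiVec Sl2 (n + 1), ∀ (w : Sl2 → MultiVec Sl2 n) (u : Sl2),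
      poissonDiff piSharp w u = poissonSymbol n u (fderiv ℝ w u) + c (w u) := by
  cases n with
  | zero => exact ⟨0, fun w u => (add_zero _).symm⟩
  | succ n =>
    refine ⟨-((1 / 2 : ℝ) • (alternatize₂CLM (Sl2 →L[ℝ] ℝ) n ∘L
      contractBracket n (koszulBracket piSharp 0))), fun w u => ?_⟩
    have h : koszulBracket piSharp u = koszulBracket piSharp 0 := by
      rw [← coe_piSharpL]
      exact koszulBracket_clm piSharpL u 0
    rw [poissonDiff_succ_eq, h, sub_eq_add_neg, poissonSymbol_apply, neg_apply, smul_apply,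
      ContinuousLinearMap.comp_apply, alternatize₂CLM_apply]

theorem poissonDiff_mem {w : Sl2 → MultiVec Sl2 n} (hw : w ∈ flatMultivectors n) :
    poissonDiff piSharp w ∈ flatMultivectors (n + 1) := by
  obtain ⟨c, h⟩ := exists_poissonDiff_eq n
  rw [funext (h w)]
  exact Submodule.add_mem _
    ((isHomogeneous_poissonSymbol n).clm_apply_mem_flatSections (fderiv_mem_flatSections hw))
    (clm_apply_mem_flatSections c hw)

/-- The Poisson differential on flat multivector fields. -/
def dPoisson (n : ℕ) : flatMultivectors n →ₗ[ℝ] flatMultivectors (n + 1) where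
  toFun w := ⟨poissonDiff piSharp w.1, poissonDiff_mem w.2⟩
  map_add' w w' := Subtype.ext <| funext fun u => by
    obtain ⟨b, h⟩ := exists_poissonDiff_eq n
    have hd := fderiv_add (differentiable_of_mem_flatSections w.2 u)
      (differentiable_of_mem_flatSections w'.2 u)
    change poissonDiff piSharp (w.1 + w'.1) u =
      poissonDiff piSharp w.1 u + poissonDiff piSharp w'.1 u
    rw [h, h, h, hd, Pi.add_apply, map_add, map_add]
    abel
  map_smul' c w := Subtype.ext <| funext fun u => by
    obtain ⟨b, h⟩ := exists_poissonDiff_eq n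
    have hd := fderiv_const_smul (differentiable_of_mem_flatSections w.2 u) c
    change poissonDiff piSharp (c • w.1) u = c • poissonDiff piSharp w.1 u
    rw [h, h, hd, Pi.smul_apply, map_smul, map_smul, smul_add]

theorem dPoisson_comp_dPoisson (n : ℕ) : dPoisson (n + 1) ∘ₗ dPoisson n = 0 := by
  refine LinearMap.ext fun w => Subtype.ext (funext fun u => ?_)
  change poissonDiff piSharp (poissonDiff piSharp w.1) u = 0
  rw [← coe_piSharpL]
  refine poissonDiff_poissonDiff (K := koszulBracket piSharp 0) (fun x => ?_) (fun x ξ η => ?_)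
    (koszulBracket_piSharp_antisymm 0) koszulBracket_koszulBracket
    (contDiff_of_mem_flatSections w.2) u
  · rw [← coe_piSharpL]
    exact koszulBracket_clm piSharpL x 0
  · simp only [piSharpL_apply]
    exact piSharp_piSharp_sub x ξ η

theorem isoCochains_dPoisson (n : ℕ) (w : flatMultivectors n) :
    isoCochains (n + 1) (dPoisson n w) = (dCochains n + deltaCochains n) (isoCochains n w) := by
  refine Subtype.ext (funext fun u => ?_)
  rcases eq_or_ne u 0 with rfl | hu
  · rw [apply_zero_of_mem_flatSections (cochains_le _ (Subtype.prop _)),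
      apply_zero_of_mem_flatSections (cochains_le _ (Subtype.prop _))]
  have hw := contDiff_of_mem_flatSections w.2
  change fwd (n + 1) u (poissonDiff piSharp w.1 u) =
    dOp (fun v => fwd n v (w.1 v)) u + deltaOp (fun v => fwd n v (w.1 v)) u
  simp only [fwd_apply, dOp, deltaOp]
  refine Prod.ext ?_ (Prod.ext (funext fun k => ?_) ?_)
  · have h := extDeriv_fwd₀ hw hu
    change fwd₀ (n + 1) u (poissonDiff piSharp w.1 u) = extDeriv (fun v => fwd₀ n v (w.1 v)) u +
      (-1 : ℝ) ^ (n + 1) • ∑ k, wedge2 (gamma k u) ((-1 : ℝ) ^ n • fwd₁ k n u (w.1 u))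
    -- The sign of `δ` and the sign in the middle component of `fwd` multiply to -1, so `δ` cancels
    -- the terms with `γ_k` in `extDeriv_fwd₀`.
    have hs : (-1 : ℝ) ^ (n + 1) * (-1) ^ n = -1 := by
      rw [pow_succ, mul_assoc, neg_one_mul, mul_neg, ← mul_pow]
      simp
    simp only [wedge2_smul, ← Finset.smul_sum, smul_smul, hs]
    rw [h, neg_one_smul]
    abel
  · have h := extDeriv_fwd₁ hw hu k
    change (-1 : ℝ) ^ (n + 1) • fwd₁ k (n + 1) u (poissonDiff piSharp w.1 u) =
      extDeriv (fun v => (-1 : ℝ) ^ n • fwd₁ k n v (w.1 v)) u +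
        ![-((-1 : ℝ) ^ n • wedge2 (gamma 1 u) (fwd₂ n u (w.1 u))),
          (-1 : ℝ) ^ n • wedge2 (gamma 0 u) (fwd₂ n u (w.1 u))] k
    have h2 := extDeriv_fun_smul ((-1 : ℝ) ^ n) (fun v => fwd₁ k n v (w.1 v)) (x := u)
    -- The change of sign from `(-1) ^ n` to `(-1) ^ (n + 1)` matches the minus sign of
    -- `extDeriv_fwd₁`, and the terms with `γ` cancel against `δ` for each `k`.
    refine Eq.trans ?_ (congrArg (· + _) (h2.trans (congrArg ((-1 : ℝ) ^ n • ·) h)).symm)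
    fin_cases k
    · change _ = (-1 : ℝ) ^ n • (-fwd₁ 0 (n + 1) u (poissonDiff piSharp w.1 u) +
        wedge2 (gamma 1 u) (fwd₂ n u (w.1 u))) +
          -((-1 : ℝ) ^ n • wedge2 (gamma 1 u) (fwd₂ n u (w.1 u)))
      rw [smul_add, add_neg_cancel_right, pow_succ, mul_neg_one, neg_smul, smul_neg]
      rfl
    · change _ = (-1 : ℝ) ^ n • (-fwd₁ 1 (n + 1) u (poissonDiff piSharp w.1 u) +
        -wedge2 (gamma 0 u) (fwd₂ n u (w.1 u))) +
          (-1 : ℝ) ^ n • wedge2 (gamma 0 u) (fwd₂ n u (w.1 u))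
      rw [smul_add, smul_neg ((-1 : ℝ) ^ n) (wedge2 _ _), neg_add_cancel_right, pow_succ,
        mul_neg_one, neg_smul, smul_neg]
      rfl
  · have h := extDeriv_fwd₂ hw hu
    refine h.symm.trans ?_
    exact (add_zero _).symm

/-- Transported from `d_π² = 0` through the isomorphism, so no identities for the `γ_k` have to be
checked. -/
theorem dCochains_add_deltaCochains_comp (n : ℕ) :
    (dCochains (n + 1) + deltaCochains (n + 1)) ∘ₗ (dCochains n + deltaCochains n) = 0 := by
  refine LinearMap.ext fun ξ => ?_
  obtain ⟨w, rfl⟩ := (isoCochains n).surjective ξ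
  rw [LinearMap.comp_apply, ← isoCochains_dPoisson, ← isoCochains_dPoisson]
  have h := LinearMap.congr_fun (dPoisson_comp_dPoisson n) w
  rw [LinearMap.comp_apply] at h
  rw [h]
  simp

end Complex

end FlatPoisson

end

theorem proposition4p1 :
    ∃ (dπ : ∀ n : ℕ, flatMultivectors n →ₗ[ℝ] flatMultivectors (n + 1))
      (d δ : ∀ n : ℕ, cochains n →ₗ[ℝ] cochains (n + 1))
      (a : ∀ n : ℕ, flatMultivectors n ≃ₗ[ℝ] cochains n),
      (∀ (n : ℕ) (w : flatMultivectors n),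
        (dπ n w : Sl2 → MultiVec Sl2 (n + 1)) = poissonDiff piSharp w) ∧
      (∀ (n : ℕ) (ξ : cochains n), (d n ξ : Sl2 → Fib (n + 1)) = dOp ξ) ∧
      (∀ (n : ℕ) (ξ : cochains n), (δ n ξ : Sl2 → Fib (n + 1)) = deltaOp ξ) ∧
      (∀ n : ℕ, dπ (n + 1) ∘ₗ dπ n = 0) ∧
      (∀ n : ℕ, (d (n + 1) + δ (n + 1)) ∘ₗ (d n + δ n) = 0) ∧
      (∀ (n : ℕ) (w : flatMultivectors n), a (n + 1) (dπ n w) = (d n + δ n) (a n w)) ∧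
      (∀ n : ℕ, PropertySLB (a n : flatMultivectors n →ₗ[ℝ] cochains n) 0 0 2) ∧
      (∀ n : ℕ, PropertySLB ((a n).symm : cochains n →ₗ[ℝ] flatMultivectors n) 0 0 4) ∧
      (∀ n : ℕ, PropertySLB (δ n) 0 0 3) := by
  refine ⟨dPoisson, dCochains, deltaCochains, isoCochains, fun _ _ => rfl, fun _ _ => rfl,
    fun _ _ => rfl, dPoisson_comp_dPoisson, dCochains_add_deltaCochains_comp,
    isoCochains_dPoisson, fun n => ?_, fun n => ?_, fun n => ?_⟩
  · exact propertySLB_of_hasPoleLE le_rfl _ (hasPoleLE_fwd n) fun _ _ => rfl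
  · exact propertySLB_of_hasPoleLE (cochains_le n) _ (hasPoleLE_bwd n) fun _ _ => rfl
  · exact propertySLB_of_hasPoleLE (cochains_le n) _
      ((isHomogeneous_deltaL n).hasPoleLE (by norm_num)) fun ξ u => (deltaL_apply ξ.1 u).symm
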